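/- Let $\Omega$ be the strip $\mathbb{R}\times(-1,1)$ or the half-plane $\mathbb{R}\times(0,\infty)$. Let $\mathbf{v}=(v_1,v_2)\in H^1_{loc}(\overline\Omega)\cap C(\overline\Omega)$ (where $loc(\overline\Omega)$ means: on every bounded part of $\Omega$, up to the boundary) solve the steady Euler system $$\mathbf{v}\cdot\nabla\mathbf{v}+\nabla P=0,\qquad \operatorname{div}\mathbf{v}=0\qquad\text{in }\Omega$$ for some distribution $P$ on $\Omega$ (the first equation holding in the sense of distributions), with $v_2=0$ on $\partial\Omega$. Assume that there is a constant $C>0$ such that, for all $R>100$, $$\sup_{[-R,R]\times[-1,1]}|\mathbf{v}|\le C\sqrt{R}\quad\text{if $\Omega$ is the strip},\qquad \sup_{x\in\Omega,\ |x|\le R}|\mathbf{v}(x)|\le C\sqrt{\log R}\quad\text{if $\Omega$ is the half-plane}.$$ For a set $A\subset\overline\Omega$ let $\Theta(\mathbf{v};A)=\{\mathbf{v}(x)/|\mathbf{v}(x)| : x\in A,\ |\mathbf{v}(x)|>0\}\subset S^1$ be the set of flow angles, and for $\theta_0\in\mathbb{R}$, $\beta\in(0,\pi)$ let $\mathcal{S}_{\theta_0,\beta}=\{(\cos\theta,\sin\theta)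 : -\pi+\beta+\theta_0\le\theta\le\pi-\beta+\theta_0\}$. Let $S^1_\pm=\mathcal{S}_{\pm\pi/2,\pi/2}$ be the upper and lower closed semicircles. Call $\mathbf{v}$ a shear flow if $\mathbf{v}\equiv(v_1(x_2),0)$ on $\overline\Omega$. Then: (i) If there is $\beta\in(0,\pi)$ such that $\Theta(\mathbf{v};\overline\Omega)\subset\mathcal{S}_{0,\beta}$ or $\Theta(\mathbf{v};\overline\Omega)\subset\mathcal{S}_{\pi,\beta}$, then $\mathbf{v}$ is a shear flow. (ii) If additionally (to the standing assumptions) $\mathbf{v}\in C^1(\overline\Omega)\cap W^{2,1}_{loc}(\overline\Omega)$ and $v_1$ is bounded on $\partial\Omega$, then exactly one of the following holds: (a) $\mathbf{v}$ is a shear flow; (b) $\Theta(\mathbf{v};\overline\Omega)=S^1$; (c) $\Theta(\mathbf{v};\overline\Omega)=S^1_+$ or $\Theta(\mathbf{v};\overline\Omega)=S^1_-$. (iii) If additionally (to the standing assumptions) $\mathbf{v}\in C^1(\overline\Omega)\cap W^{2,1}_{loc}(\overline\Omega)$ and there is $T>0$ with $\mathbf{v}(x_1+T,x_2)=\mathbf{v}(x_1,x_2)$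 for all $(x_1,x_2)\in\Omega$, then either $\mathbf{v}$ is a shear flow or $\Theta(\mathbf{v};\Omega)=S^1$. -/

import Mathlib

open MeasureTheory TopologicalSpace Set
open scoped Distributions LineDeriv ENNReal

/-- The Euclidean plane; the coordinates `(x₁, x₂)` of a point `x` are `x 0` and `x 1`. -/
abbrev Plane : Type := EuclideanSpace ℝ (Fin 2)

/-- The unit vectors `e₁ = (1, 0)` and `e₂ = (0, 1)`. -/
noncomputable def stdVec (i : Fin 2) : Plane := EuclideanSpace.single i (1 : ℝ)

/-- The infinite strip `ℝ × (-1, 1)`. -/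
def strip : Opens Plane where
  carrier := {x | -1 < x 1 ∧ x 1 < 1}
  is_open' := by
    have h : Continuous fun x : Plane => x 1 := by fun_prop
    exact (isOpen_lt continuous_const h).inter (isOpen_lt h continuous_const)

/-- The upper half-plane `ℝ × (0, ∞)`. -/
def upperHalfPlane : Opens Plane where
  carrier := {x | 0 < x 1}
  is_open' := isOpen_lt continuous_const (by fun_prop)

/-- `g` is the weak derivative `∂ᵢ f` in the open set `Ω`: both are locally integrable in `Ω` and
`∫ f ∂ᵢφ = - ∫ g φ` for all smooth `φ` with compact support in `Ω`. -/
def IsWeakDeriv (Ω : Opens Plane) (i : Fin 2) (f g : Plane → ℝ) : Prop :=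
  LocallyIntegrableOn f (Ω : Set Plane) ∧ LocallyIntegrableOn g (Ω : Set Plane) ∧
    ∀ φ : 𝓓(Ω, ℝ), ∫ x in (Ω : Set Plane), f x * (∂_{stdVec i} φ) x
      = - ∫ x in (Ω : Set Plane), g x * φ x

/-- `f ∈ L^p_loc(closure Ω)`: `f` is `L^p` on every bounded part of `Ω`, up to the boundary. -/
def MemLpLocBar (Ω : Opens Plane) (p : ℝ≥0∞) (f : Plane → ℝ) : Prop :=
  ∀ R : ℝ, MemLp f p (volume.restrict ((Ω : Set Plane) ∩ Metric.ball 0 R))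

/-- `f ∈ W^{k,p}_loc(closure Ω)`: all weak derivatives of `f` in `Ω` of order at most `k` exist and
are in `L^p_loc(closure Ω)`. -/
def MemSobolevLocBar (Ω : Opens Plane) (p : ℝ≥0∞) : ℕ → (Plane → ℝ) → Prop
  | 0, f => MemLpLocBar Ω p f
  | k + 1, f => MemLpLocBar Ω p f ∧
      ∀ i : Fin 2, ∃ g : Plane → ℝ, IsWeakDeriv Ω i f g ∧ MemSobolevLocBar Ω p k g

/-- `v` is a weakly differentiable solution of the steady Euler system in `Ω`: with `G j i` the
weak derivative `∂ⱼ vᵢ`, we have `∂₁ v₁ + ∂₂ v₂ = 0` almost everywhere in `Ω`, and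
`v₁ ∂₁ vᵢ + v₂ ∂₂ vᵢ + ∂ᵢ P = 0` (for `i = 1, 2`) as distributions in `Ω`, for some distribution
`P` (the pressure). -/
def IsSteadyEuler (Ω : Opens Plane) (v : Plane → Plane) : Prop :=
  ∃ (G : Fin 2 → Fin 2 → Plane → ℝ) (P : 𝓓'(Ω, ℝ)),
    (∀ j i, IsWeakDeriv Ω j (fun x => v x i) (G j i)) ∧
    (∀ᵐ x ∂(volume.restrict (Ω : Set Plane)), G 0 0 x + G 1 1 x = 0) ∧
    ∀ (i : Fin 2) (φ : 𝓓(Ω, ℝ)),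
      (∫ x in (Ω : Set Plane), (v x 0 * G 0 i x + v x 1 * G 1 i x) * φ x)
        + (∂_{stdVec i} P) φ = 0

/-- The unit circle `S¹`. -/
def unitCircle : Set Plane := Metric.sphere 0 1

/-- The set `Θ(u; A)` of flow angles of `u` in `A`. -/
noncomputable def flowAngles (u : Plane → Plane) (A : Set Plane) : Set Plane :=
  {y | ∃ x ∈ A, 0 < ‖u x‖ ∧ y = ‖u x‖⁻¹ • u x}

/-- The closed arc of the unit circle with midpoint at angle `θ₀` and length `2π - 2β`. -/
noncomputable def arc (θ₀ β : ℝ) : Set Plane :=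
  {y | ∃ θ : ℝ, -Real.pi + β + θ₀ ≤ θ ∧ θ ≤ Real.pi - β + θ₀ ∧
    y = !₂[Real.cos θ, Real.sin θ]}

/-- The upper closed semicircle. -/
noncomputable def upperSemicircle : Set Plane := arc (Real.pi / 2) (Real.pi / 2)

/-- The lower closed semicircle. -/
noncomputable def lowerSemicircle : Set Plane := arc (-(Real.pi / 2)) (Real.pi / 2)

/-- `v` is a shear flow in the closure of `Ω`: `v = (s(x₂), 0)`. -/
def IsShearFlow (Ω : Opens Plane) (v : Plane → Plane) : Prop :=
  ∃ s : ℝ → ℝ, ∀ x ∈ closure (Ω : Set Plane), v x = !₂[s (x 1), 0]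

/-- The growth condition in the strip: `|v| ≤ C √R` on `[-R, R] × [-1, 1]` for all `R > 100`. -/
def StripGrowth (v : Plane → Plane) : Prop :=
  ∃ C : ℝ, 0 < C ∧ ∀ R : ℝ, 100 < R → ∀ x : Plane,
    x 0 ∈ Icc (-R) R → x 1 ∈ Icc (-1 : ℝ) 1 → ‖v x‖ ≤ C * Real.sqrt R

/-- The growth condition in the upper half-plane: `|v| ≤ C √(log R)` on the part of it in
`|x| ≤ R`, for all `R > 100`. -/
def HalfPlaneGrowth (v : Plane → Plane) : Prop :=
  ∃ C : ℝ, 0 < C ∧ ∀ R : ℝ, 100 < R → ∀ x ∈ upperHalfPlane,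
    ‖x‖ ≤ R → ‖v x‖ ≤ C * Real.sqrt (Real.log R)

/-! Write v = |v|(cos θ, sin θ). Cross-differentiation eliminates the pressure from the Euler
system, and with div v = 0 what remains is div J = 0 for J = v₁∇v₂ − v₂∇v₁ = |v|²∇θ. So the angle
solves an elliptic equation in divergence form, degenerate where v vanishes. The theorem rests on
one Liouville-type statement, `PlanarFlow.apply_one_nonpos`: if some angle τ ∈ [0, π] is not
attained on the closure, then v₂ ≤ 0.

To prove it, test the equation with η²F(θ), where F is nondecreasing on each side of τ. A jump of F
at τ does no harm, because τ is not attained. F vanishes for downward velocities and near the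
attained horizontal ones. Hence the boundary, where v is horizontal, contributes nothing although η
need not vanish there, and the branch cut of the argument is invisible. Zeros of v are handled by a
cutoff in |v|, whose error is dominated by |∇v|². Since F² ≤ κF', absorption yields the Caccioppoli
inequality ∫ η²F'(θ)|v|²|∇θ|² ≤ C ∫ |v|²|∇η|² (`PlanarFlow.integral_angF'_le`).

Both growth conditions bound ∫|v|² over balls of radius R by R² log R. This is the borderline rate
at which averaging dyadic cutoffs with harmonic weights makes the right side arbitrarily small
(`PlanarFlow.exists_slow_cutoff`). Hence J = 0 where v₂ > 0. There v₁/v₂ is locally constant, and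
div v = 0 then makes v constant along its own direction: streamlines are straight and carry a
constant velocity. Follow one backwards from a point with v₂ > 0. It must leave the domain through
the boundary, still with v₂ > 0, which contradicts tangency.

Consequently a point with v₂ > 0 forces all angles of the upper semicircle to occur on the closure.
Applied to −v, this gives the lower semicircle from a point with v₂ < 0. If v₂ vanishes identically,
then ∂₁v₁ = 0 and v is a shear flow. Parts (i) and (ii) follow by distinguishing the signs that v₂
takes.

For periodic v, the flux through a horizontal line over one period vanishes, so a nonzero v₂ takes
both signs. Non-horizontal angles are attained only in the interior. For the horizontal ones,
`nonneg_of_vanishing_flux` shows that a flow moving to the left somewhere on a wall also points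
exactly left somewhere in the interior. Otherwise v₂ would have a fixed sign close to a stretch of
the wall where v₁ < 0, and the flux balance in a thin rectangle would fail. -/

section

open Filter Topology Metric ContinuousLinearMap
open scoped Convolution

/-! ### Mollification in L² -/

/-- The standard mollifier of radius `1 / (n + 1)` in the plane. -/
noncomputable def mollBump (n : ℕ) : ContDiffBump (0 : Plane) where
  rIn := 1 / (2 * ((n : ℝ) + 1))
  rOut := 1 / ((n : ℝ) + 1)
  rIn_pos := by positivity
  rIn_lt_rOut := by
    apply one_div_lt_one_div_of_lt <;> linarith [(Nat.cast_nonneg n : (0 : ℝ) ≤ n)]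

/-- Mollification of `f` at scale `1 / (n + 1)`. -/
noncomputable def moll (n : ℕ) (f : Plane → ℝ) : Plane → ℝ :=
  (mollBump n).normed volume ⋆[lsmul ℝ ℝ, volume] f

theorem contDiff_moll {n : ℕ} {f : Plane → ℝ} (hf : LocallyIntegrable f) :
    ContDiff ℝ (⊤ : ℕ∞) (moll n f) :=
  (mollBump n).hasCompactSupport_normed.contDiff_convolution_left _
    (mollBump n).contDiff_normed hf

theorem moll_apply (n : ℕ) (f : Plane → ℝ) (x : Plane) :
    moll n f x = ∫ y, (mollBump n).normed volume (x - y) * f y := by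
  rw [moll, convolution_eq_swap]; rfl

theorem fderiv_moll_apply {n : ℕ} {f : Plane → ℝ} (hf : LocallyIntegrable f) (x e : Plane) :
    fderiv ℝ (moll n f) x e
      = ∫ y, fderiv ℝ ((mollBump n).normed volume) (x - y) e * f y := by
  have h := ((mollBump n).hasCompactSupport_normed (μ := volume)).hasFDerivAt_convolution_left
    (lsmul ℝ ℝ) (μ := volume) (ContDiffBump.contDiff_normed _) hf x
  rw [moll, h.fderiv, convolution_eq_swap, ContinuousLinearMap.integral_apply]
  · rfl
  · have := (((mollBump n).hasCompactSupport_normed (μ := volume)).fderiv ℝ).convolutionExists_left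
      ((lsmul ℝ ℝ).precompL Plane) (μ := volume)
      ((ContDiffBump.contDiff_normed (n := 1) _).continuous_fderiv one_ne_zero) hf x
    exact this.integrable_swap

/-- Jensen's inequality for the probability measure with density the mollifier: an L¹ norm is at
most the L² norm. -/
theorem enorm_moll_sq_le (n : ℕ) {f : Plane → ℝ} (hf : AEStronglyMeasurable f) (x : Plane) :
    ‖moll n f x‖ₑ ^ 2 ≤
      ∫⁻ t, ENNReal.ofReal ((mollBump n).normed volume t) * ‖f (x - t)‖ₑ ^ 2 := by
  set ρ := (mollBump n).normed (volume : Measure Plane) with hρ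
  have hρm : Measurable fun t => ENNReal.ofReal (ρ t) :=
    ((mollBump n).continuous_normed.measurable).ennreal_ofReal
  have hfx : AEStronglyMeasurable (fun t => f (x - t)) (volume : Measure Plane) :=
    hf.comp_measurePreserving (Measure.measurePreserving_sub_left volume x)
  have h1 : ‖moll n f x‖ₑ ≤ ∫⁻ t, ENNReal.ofReal (ρ t) * ‖f (x - t)‖ₑ := by
    refine (enorm_integral_le_lintegral_enorm _).trans (lintegral_mono fun t => ?_)
    simp only [lsmul_apply, smul_eq_mul, enorm_mul]
    rw [Real.enorm_eq_ofReal ((mollBump n).nonneg_normed t)]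
  have htot : ∫⁻ t, ENNReal.ofReal (ρ t) = 1 := by
    rw [← ofReal_integral_eq_lintegral_ofReal (mollBump n).integrable_normed
      (Eventually.of_forall (mollBump n).nonneg_normed), (mollBump n).integral_normed]
    simp
  set ν := (volume : Measure Plane).withDensity fun t => ENNReal.ofReal (ρ t) with hν
  have hνp : IsProbabilityMeasure ν := ⟨by rw [hν, withDensity_apply _ MeasurableSet.univ]; simpa⟩
  have hac : ν ≪ volume := withDensity_absolutelyContinuous _ _
  have h2 := eLpNorm_le_eLpNorm_of_exponent_le (p := 1) (q := 2) (by norm_num)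
    (hfx.mono_ac hac)
  have hconv : ∀ g : Plane → ℝ≥0∞, AEMeasurable g → 
      ∫⁻ t, g t ∂ν = ∫⁻ t, ENNReal.ofReal (ρ t) * g t := fun g hg =>
    lintegral_withDensity_eq_lintegral_mul₀ hρm.aemeasurable hg
  rw [eLpNorm_one_eq_lintegral_enorm, hconv _ hfx.enorm] at h2
  have h3 : eLpNorm (fun t => f (x - t)) 2 ν ^ 2
      = ∫⁻ t, ENNReal.ofReal (ρ t) * ‖f (x - t)‖ₑ ^ 2 := by
    rw [← hconv _ (hfx.enorm.pow_const 2)]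
    rw [eLpNorm_eq_lintegral_rpow_enorm_toReal (by norm_num) (by norm_num), ← ENNReal.rpow_natCast,
      ← ENNReal.rpow_mul]
    norm_num
  rw [← h3]
  gcongr
  exact h1.trans h2

/-- Integrate the pointwise Jensen bound, exchange the integrals and use translation invariance. The
uniform bound reduces L² convergence to a dense class. -/
theorem eLpNorm_moll_le (n : ℕ) {f : Plane → ℝ} (hf : AEStronglyMeasurable f) :
    eLpNorm (moll n f) 2 volume ≤ eLpNorm f 2 volume := by
  have hρm : Measurable fun t => ENNReal.ofReal ((mollBump n).normed (volume : Measure Plane) t) :=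
    ((mollBump n).continuous_normed.measurable).ennreal_ofReal
  have htot : ∫⁻ t, ENNReal.ofReal ((mollBump n).normed (volume : Measure Plane) t) = 1 := by
    rw [← ofReal_integral_eq_lintegral_ofReal (mollBump n).integrable_normed
      (Eventually.of_forall (mollBump n).nonneg_normed), (mollBump n).integral_normed]
    simp
  have key : ∫⁻ x, ‖moll n f x‖ₑ ^ 2 ≤ ∫⁻ x, ‖f x‖ₑ ^ 2 := by
    calc ∫⁻ x, ‖moll n f x‖ₑ ^ 2
        ≤ ∫⁻ x, ∫⁻ t, ENNReal.ofReal ((mollBump n).normed volume t) * ‖f (x - t)‖ₑ ^ 2 :=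
          lintegral_mono fun x => enorm_moll_sq_le n hf x
      _ = ∫⁻ t, ∫⁻ x, ENNReal.ofReal ((mollBump n).normed volume t) * ‖f (x - t)‖ₑ ^ 2 := by
          refine lintegral_lintegral_swap ?_
          refine AEMeasurable.mul (hρm.comp measurable_snd).aemeasurable ?_
          exact ((hf.comp_quasiMeasurePreserving
            (quasiMeasurePreserving_sub_of_right_invariant volume volume)).enorm).pow_const 2
      _ = ∫⁻ t, ENNReal.ofReal ((mollBump n).normed volume t) * ∫⁻ x, ‖f x‖ₑ ^ 2 := by
          refine lintegral_congr fun t => ?_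
          have hm : AEStronglyMeasurable (fun x => f (x - t)) (volume : Measure Plane) :=
            hf.comp_measurePreserving (measurePreserving_sub_right volume t)
          rw [lintegral_const_mul'' _ (hm.enorm.pow_const 2)]
          congr 1
          exact lintegral_sub_right_eq_self (fun x => ‖f x‖ₑ ^ 2) t
      _ = ∫⁻ x, ‖f x‖ₑ ^ 2 := by
          rw [lintegral_mul_const _ hρm, htot, one_mul]
  rw [eLpNorm_eq_lintegral_rpow_enorm_toReal (by norm_num) (by norm_num),
    eLpNorm_eq_lintegral_rpow_enorm_toReal (by norm_num) (by norm_num)]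
  norm_num
  gcongr

theorem moll_sub {n : ℕ} {f g : Plane → ℝ} (hf : LocallyIntegrable f) (hg : LocallyIntegrable g) :
    moll n (f - g) = moll n f - moll n g := by
  have hc : Continuous ((mollBump n).normed (volume : Measure Plane)) :=
    (mollBump n).continuous_normed
  have hs := (mollBump n).hasCompactSupport_normed (μ := (volume : Measure Plane))
  ext x
  rw [Pi.sub_apply, moll_apply, moll_apply, moll_apply, ← integral_sub]
  · simp only [Pi.sub_apply, mul_sub]
  · exact (hs.convolutionExists_left (lsmul ℝ ℝ) hc hf x).integrable_swap
  · exact (hs.convolutionExists_left (lsmul ℝ ℝ) hc hg x).integrable_swap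

theorem dist_moll_le {n : ℕ} {f : Plane → ℝ} (hf : AEStronglyMeasurable f) {x : Plane} {ε : ℝ}
    (h : ∀ y ∈ ball x (1 / ((n : ℝ) + 1)), dist (f y) (f x) ≤ ε) : dist (moll n f x) (f x) ≤ ε :=
  ContDiffBump.dist_normed_convolution_le hf h

/-- Mollifications of a square integrable function converge in `L²`. -/
theorem tendsto_eLpNorm_moll_sub {g : Plane → ℝ} (hg : MemLp g 2) :
    Tendsto (fun n => eLpNorm (moll n g - g) 2 volume) atTop (𝓝 0) := by
  rw [ENNReal.tendsto_nhds_zero]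
  intro ε hε
  by_cases hεt : ε = ∞
  · simp [hεt]
  have hε3 : ε / 3 ≠ 0 := by simp [hε.ne']
  obtain ⟨c, hcs, hcg, hcc, hcL⟩ :=
    hg.exists_hasCompactSupport_eLpNorm_sub_le (by norm_num) hε3
  have hgl : LocallyIntegrable g := hg.locallyIntegrable (by norm_num)
  have hcl : LocallyIntegrable c := hcc.locallyIntegrable
  set K := cthickening 1 (tsupport c) with hK
  have hKc : IsCompact K := hcs.isCompact.cthickening
  -- uniform convergence of the mollifications of `c`
  obtain ⟨η, hη, hηε⟩ : ∃ η : ℝ, 0 < η ∧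
      ENNReal.ofReal η * volume K ^ (1 / (2 : ℝ)) ≤ ε / 3 := by
    have hV : volume K ^ (1 / (2 : ℝ)) ≠ ∞ :=
      ENNReal.rpow_ne_top_of_nonneg (by norm_num) hKc.measure_lt_top.ne
    have : Tendsto (fun η : ℝ => ENNReal.ofReal η * volume K ^ (1 / (2 : ℝ))) (𝓝[>] 0) (𝓝 0) := by
      have := ENNReal.Tendsto.mul_const (b := volume K ^ (1 / (2 : ℝ)))
        (ENNReal.tendsto_ofReal (tendsto_id (α := ℝ) (x := 𝓝 0))) (Or.inr hV)
      simpa using this.mono_left nhdsWithin_le_nhds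
    have h2 := (ENNReal.tendsto_nhds_zero.1 this (ε / 3) (pos_iff_ne_zero.2 hε3)).and
      self_mem_nhdsWithin
    obtain ⟨η, h, h'⟩ := h2.exists
    exact ⟨η, h', h⟩
  have huc : UniformContinuous c := hcs.uniformContinuous_of_continuous hcc
  obtain ⟨δ, hδ, hδc⟩ := Metric.uniformContinuous_iff.1 huc η hη
  have hev : ∀ᶠ n : ℕ in atTop, 1 / ((n : ℝ) + 1) < δ :=
    tendsto_one_div_add_atTop_nhds_zero_nat.eventually_lt_const hδ
  filter_upwards [hev] with n hn
  have hn1 : 1 / ((n : ℝ) + 1) ≤ 1 := by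
    rw [div_le_one (by positivity)]; linarith [(Nat.cast_nonneg n : (0 : ℝ) ≤ n)]
  have hpt : ∀ x, ‖(moll n c - c) x‖ ≤ η := fun x => by
    rw [Pi.sub_apply, ← dist_eq_norm]
    exact dist_moll_le hcc.aestronglyMeasurable fun y hy => (hδc ((mem_ball.1 hy).trans hn)).le
  have hout : ∀ x ∉ K, (moll n c - c) x = 0 := fun x hx => by
    have h0 : ∀ y ∈ ball x (1 / ((n : ℝ) + 1)), c y = 0 := fun y hy => by
      by_contra hne
      refine hx (mem_cthickening_of_dist_le x y 1 _ (subset_tsupport c hne) ?_)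
      rw [dist_comm]; exact (mem_ball.1 hy).le.trans hn1
    have hx0 : c x = 0 := h0 x (mem_ball_self (by positivity))
    have := dist_moll_le (n := n) (x := x) (ε := 0) hcc.aestronglyMeasurable fun y hy => by
      rw [h0 y hy, hx0, dist_self]
    rw [Pi.sub_apply, sub_eq_zero]
    exact dist_le_zero.1 this
  have hmid : eLpNorm (moll n c - c) 2 volume ≤ ε / 3 := by
    have hind : moll n c - c = K.indicator (moll n c - c) := by
      ext x
      by_cases hx : x ∈ K
      · simp [hx]
      · simp [hx, hout x hx]
    rw [hind, eLpNorm_indicator_eq_eLpNorm_restrict hKc.measurableSet]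
    refine (eLpNorm_le_of_ae_bound (C := η) (Eventually.of_forall hpt)).trans ?_
    rw [mul_comm]
    simpa using hηε
  have hmc : AEStronglyMeasurable (moll n c) (volume : Measure Plane) :=
    (contDiff_moll hcl).continuous.aestronglyMeasurable
  have hmg : AEStronglyMeasurable (moll n g) (volume : Measure Plane) :=
    (contDiff_moll hgl).continuous.aestronglyMeasurable
  -- Three-term splitting through a compactly supported continuous `c` close to `g`: the outer terms
  -- are small by contractivity and density, the middle one by uniform convergence on a fixed
  -- compact set.
  have hdec : moll n g - g = moll n (g - c) + (moll n c - c) + (c - g) := by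
    rw [moll_sub hgl hcl]; abel
  have h1 : eLpNorm (moll n (g - c)) 2 volume ≤ ε / 3 :=
    (eLpNorm_moll_le n (hg.1.sub hcL.1)).trans hcg
  have h3 : eLpNorm (c - g) 2 volume ≤ ε / 3 := by rwa [eLpNorm_sub_comm]
  rw [hdec]
  calc _ ≤ eLpNorm (moll n (g - c)) 2 volume + eLpNorm (moll n c - c) 2 volume
        + eLpNorm (c - g) 2 volume := by
        refine (eLpNorm_add_le ((?_ : AEStronglyMeasurable _ _).add (hmc.sub hcL.1))
          (hcL.1.sub hg.1) (by norm_num)).trans ?_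
        · rw [moll_sub hgl hcl]; exact hmg.sub hmc
        · gcongr
          refine eLpNorm_add_le ?_ (hmc.sub hcL.1) (by norm_num)
          rw [moll_sub hgl hcl]; exact hmg.sub hmc
    _ ≤ ε / 3 + ε / 3 + ε / 3 := by gcongr
    _ = ε := ENNReal.add_thirds ε

/-! ### Weak derivatives and their mollifications -/

/-- `φ` is smooth with compact support in `U`. -/
structure IsTest (U : Set Plane) (φ : Plane → ℝ) : Prop where
  contDiff : ContDiff ℝ (⊤ : ℕ∞) φ
  hasCompactSupport : HasCompactSupport φ
  tsupport_subset : tsupport φ ⊆ U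

/-- `g` is a weak derivative of `f` in the direction `e`, in `U`. -/
def HasWeakDeriv (U : Set Plane) (e : Plane) (f g : Plane → ℝ) : Prop :=
  ∀ φ, IsTest U φ → ∫ x, f x * fderiv ℝ φ x e = - ∫ x, g x * φ x

theorem IsTest.mono {U V : Set Plane} {φ : Plane → ℝ} (h : IsTest U φ) (hUV : U ⊆ V) :
    IsTest V φ :=
  ⟨h.1, h.2, h.3.trans hUV⟩

theorem tsupport_mollBump_sub_subset (n : ℕ) (x : Plane) :
    tsupport (fun y => (mollBump n).normed (volume : Measure Plane) (x - y))
      ⊆ closedBall x (1 / ((n : ℝ) + 1)) := by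
  refine closure_minimal (fun y hy => ?_) isClosed_closedBall
  have h : x - y ∈ Function.support ((mollBump n).normed (volume : Measure Plane)) := hy
  rw [ContDiffBump.support_normed_eq, mem_ball_zero_iff] at h
  rw [mem_closedBall, dist_comm, dist_eq_norm]
  exact h.le

theorem isTest_mollBump_sub {U : Set Plane} {n : ℕ} {x : Plane}
    (h : closedBall x (1 / ((n : ℝ) + 1)) ⊆ U) :
    IsTest U fun y => (mollBump n).normed (volume : Measure Plane) (x - y) := by
  refine ⟨(ContDiffBump.contDiff_normed _).comp (contDiff_const.sub contDiff_id), ?_,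
    (tsupport_mollBump_sub_subset n x).trans h⟩
  exact (isCompact_closedBall x _).of_isClosed_subset (isClosed_tsupport _)
    (tsupport_mollBump_sub_subset n x)

theorem fderiv_mollBump_sub (n : ℕ) (x y e : Plane) :
    fderiv ℝ (fun y => (mollBump n).normed (volume : Measure Plane) (x - y)) y e
      = - fderiv ℝ ((mollBump n).normed (volume : Measure Plane)) (x - y) e := by
  have h1 : DifferentiableAt ℝ ((mollBump n).normed (volume : Measure Plane)) (x - y) :=
    ((ContDiffBump.contDiff_normed (n := 1) _).differentiable one_ne_zero) _
  have h2 : HasFDerivAt (fun y : Plane => x - y) (-(ContinuousLinearMap.id ℝ Plane)) y := by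
    simpa using (hasFDerivAt_id y).const_sub x
  have h3 := h1.hasFDerivAt.comp y h2
  rw [show (fun y => (mollBump n).normed (volume : Measure Plane) (x - y))
    = (mollBump n).normed (volume : Measure Plane) ∘ fun y => x - y from rfl, h3.fderiv]
  simp

/-- Mollification commutes with weak differentiation, away from the boundary. -/
theorem fderiv_moll_eq_moll {U K : Set Plane} (hK : MeasurableSet K) (hKU : K ⊆ U) {e : Plane}
    {f g : Plane → ℝ} (hw : HasWeakDeriv U e f g) (hf : IntegrableOn f K)
    {n : ℕ} {x : Plane} (hx : closedBall x (1 / ((n : ℝ) + 1)) ⊆ K) :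
    fderiv ℝ (moll n (K.indicator f)) x e = moll n (K.indicator g) x := by
  have hf' : LocallyIntegrable (K.indicator f) := ((integrable_indicator_iff hK).2 hf).locallyIntegrable
  have ht := isTest_mollBump_sub (hx.trans hKU)
  have hts := tsupport_mollBump_sub_subset n x
  have hw' := hw _ ht
  rw [fderiv_moll_apply hf', moll_apply]
  have h1 : ∀ y, fderiv ℝ ((mollBump n).normed volume) (x - y) e * K.indicator f y
      = - (f y * fderiv ℝ
        (fun y => (mollBump n).normed (volume : Measure Plane) (x - y)) y e) := fun y => by
    by_cases hy : y ∈ K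
    · rw [indicator_of_mem hy, fderiv_mollBump_sub]; ring
    · have : fderiv ℝ (fun y => (mollBump n).normed (volume : Measure Plane) (x - y)) y = 0 := by
        by_contra hne
        exact hy (hx (hts (support_fderiv_subset ℝ hne)))
      rw [indicator_of_notMem hy, this]; simp
  have h2 : ∀ y, (mollBump n).normed volume (x - y) * K.indicator g y
      = g y * (mollBump n).normed volume (x - y) := fun y => by
    by_cases hy : y ∈ K
    · rw [indicator_of_mem hy]; ring
    · have : (mollBump n).normed (volume : Measure Plane) (x - y) = 0 := by
        by_contra hne
        exact hy (hx (hts (subset_tsupport _ hne)))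
      rw [indicator_of_notMem hy, this]; simp
  simp only [h1, h2]
  rw [integral_neg, hw', neg_neg]

/-- Mollifications of a continuous function converge uniformly on compact sets. -/
theorem tendstoUniformlyOn_moll {K K' : Set Plane} (hK' : IsCompact K') {f : Plane → ℝ}
    (hf : ContinuousOn f K') {δ : ℝ} (hδ : 0 < δ) (hKK : ∀ x ∈ K, closedBall x δ ⊆ K') :
    TendstoUniformlyOn (fun n => moll n (K'.indicator f)) f atTop K := by
  rw [Metric.tendstoUniformlyOn_iff]
  intro ε hε
  have huc := hK'.uniformContinuousOn_of_continuous hf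
  obtain ⟨r, hr, hrf⟩ := Metric.uniformContinuousOn_iff.1 huc (ε / 2) (half_pos hε)
  have hev : ∀ᶠ n : ℕ in atTop, 1 / ((n : ℝ) + 1) < min δ r :=
    tendsto_one_div_add_atTop_nhds_zero_nat.eventually_lt_const (lt_min hδ hr)
  filter_upwards [hev] with n hn x hx
  have hxK : x ∈ K' := hKK x hx (mem_closedBall_self hδ.le)
  have hm : AEStronglyMeasurable (K'.indicator f) (volume : Measure Plane) :=
    (aestronglyMeasurable_indicator_iff hK'.measurableSet).2
      (hf.aestronglyMeasurable_of_isCompact hK' hK'.measurableSet)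
  have := dist_moll_le (n := n) (x := x) (ε := ε / 2) hm fun y hy => by
    have hy' := mem_ball.1 hy
    have hyK : y ∈ K' := hKK x hx (mem_closedBall.2 (hy'.le.trans (hn.le.trans (min_le_left _ _))))
    rw [indicator_of_mem hyK, indicator_of_mem hxK]
    exact (hrf y hyK x hxK (hy'.trans (hn.trans_le (min_le_right _ _)))).le
  rw [indicator_of_mem hxK] at this
  rw [dist_comm]
  linarith

theorem exists_compact_closedBall_subset {K U : Set Plane} (hK : IsCompact K) (hU : IsOpen U)
    (hKU : K ⊆ U) :
    ∃ K' δ, IsCompact K' ∧ K' ⊆ U ∧ 0 < δ ∧ ∀ x ∈ K, closedBall x δ ⊆ K' := by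
  obtain ⟨δ, hδ, h⟩ := hK.exists_cthickening_subset_open hU hKU
  exact ⟨cthickening δ K, δ, hK.cthickening, h, hδ, fun x hx => closedBall_subset_cthickening hx δ⟩

/-- A continuous function whose distributional derivative in the direction `e` vanishes is
constant along segments with direction `e`. -/
theorem HasWeakDeriv.eq_of_segment_subset {U : Set Plane} (hU : IsOpen U) {e : Plane}
    {f : Plane → ℝ} (hf : ContinuousOn f U) (hw : HasWeakDeriv U e f 0) {x : Plane}
    (hseg : ∀ t ∈ Icc (0 : ℝ) 1, x + t • e ∈ U) : f (x + e) = f x := by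
  set K := (fun t : ℝ => x + t • e) '' Icc 0 1 with hKdef
  have hK : IsCompact K := isCompact_Icc.image (by fun_prop)
  have hKU : K ⊆ U := by rintro _ ⟨t, ht, rfl⟩; exact hseg t ht
  obtain ⟨K', δ, hK', hK'U, hδ, hKK⟩ := exists_compact_closedBall_subset hK hU hKU
  have hunif := tendstoUniformlyOn_moll hK' (hf.mono hK'U) hδ hKK
  have h0 : x ∈ K := ⟨0, by simp, by simp⟩
  have h1 : x + e ∈ K := ⟨1, by simp, by simp⟩
  refine tendsto_nhds_unique_of_eventuallyEq (hunif.tendsto_at h1) (hunif.tendsto_at h0) ?_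
  have hev : ∀ᶠ n : ℕ in atTop, 1 / ((n : ℝ) + 1) < δ :=
    tendsto_one_div_add_atTop_nhds_zero_nat.eventually_lt_const hδ
  filter_upwards [hev] with n hn
  have hfi : IntegrableOn f K' := (hf.mono hK'U).integrableOn_compact hK'
  have hli : LocallyIntegrable (K'.indicator f) :=
    ((integrable_indicator_iff hK'.measurableSet).2 hfi).locallyIntegrable
  set F := moll n (K'.indicator f)
  have hFd : Differentiable ℝ F := (contDiff_moll hli).differentiable (by simp)
  have hder : ∀ t ∈ Icc (0 : ℝ) 1, fderiv ℝ F (x + t • e) e = 0 := fun t ht => by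
    rw [fderiv_moll_eq_moll hK'.measurableSet hK'U hw hfi
      ((closedBall_subset_closedBall hn.le).trans (hKK _ ⟨t, ht, rfl⟩)), moll_apply]
    simp [indicator]
  have hd : ∀ t : ℝ, HasDerivAt (fun t : ℝ => F (x + t • e)) (fderiv ℝ F (x + t • e) e) t :=
    fun t => by
      have h2 : HasDerivAt (fun t : ℝ => x + t • e) e t := by
        simpa using ((hasDerivAt_id t).smul_const e).const_add x
      exact (hFd (x + t • e)).hasFDerivAt.comp_hasDerivAt t h2
  -- Each mollification has zero derivative along the segment, so it takes equal values at the
  -- endpoints; uniform convergence passes this to `f`.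
  have := constant_of_has_deriv_right_zero (a := 0) (b := 1) (f := fun t : ℝ => F (x + t • e))
    (fun t _ => (hd t).continuousAt.continuousWithinAt)
    (fun t ht => by simpa [hder t ⟨ht.1, ht.2.le⟩] using (hd t).hasDerivWithinAt) 1 (by simp)
  simpa using this

/-! ### Calculus of L² and uniform limits -/

/-- Convergence in `L²(μ)` of an eventually measurable sequence to a square integrable limit. -/
structure L2Lim (μ : Measure Plane) (hn : ℕ → Plane → ℝ) (h : Plane → ℝ) : Prop where
  meas : ∀ᶠ n in atTop, AEStronglyMeasurable (hn n) μ
  mem : MemLp h 2 μ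
  lim : Tendsto (fun n => eLpNorm (hn n - h) 2 μ) atTop (𝓝 0)

/-- Uniform convergence on `K` of an eventually measurable sequence to a bounded limit. -/
structure UnifLim (K : Set Plane) (Fn : ℕ → Plane → ℝ) (F : Plane → ℝ) : Prop where
  meas : ∀ᶠ n in atTop, AEStronglyMeasurable (Fn n) (volume.restrict K)
  lim_meas : AEStronglyMeasurable F (volume.restrict K)
  bound : ∃ C : ℝ, ∀ x ∈ K, |F x| ≤ C
  unif : TendstoUniformlyOn Fn F atTop K

theorem L2Lim.add {μ : Measure Plane} {f g : ℕ → Plane → ℝ} {F G : Plane → ℝ}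
    (hf : L2Lim μ f F) (hg : L2Lim μ g G) :
    L2Lim μ (fun n x => f n x + g n x) (fun x => F x + G x) where
  meas := by filter_upwards [hf.meas, hg.meas] with n h1 h2 using h1.add h2
  mem := hf.mem.add hg.mem
  lim := by
    have h0 : Tendsto (fun n => eLpNorm (f n - F) 2 μ + eLpNorm (g n - G) 2 μ) atTop (𝓝 0) := by
      simpa using hf.lim.add hg.lim
    refine tendsto_of_tendsto_of_tendsto_of_le_of_le' tendsto_const_nhds h0
      (Eventually.of_forall fun _ => zero_le) ?_
    filter_upwards [hf.meas, hg.meas] with n h1 h2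
    have : (fun x => f n x + g n x) - (fun x => F x + G x) = (f n - F) + (g n - G) := by
      ext x; simp only [Pi.sub_apply, Pi.add_apply]; ring
    rw [this]
    exact eLpNorm_add_le (h1.sub hf.mem.1) (h2.sub hg.mem.1) (by norm_num)

theorem UnifLim.l2Lim {K : Set Plane} (hK : IsCompact K) {Fn : ℕ → Plane → ℝ} {F : Plane → ℝ}
    (h : UnifLim K Fn F) : L2Lim (volume.restrict K) Fn F where
  meas := h.meas
  mem := by
    obtain ⟨C, hC⟩ := h.bound
    have : IsFiniteMeasure (volume.restrict K) := ⟨by simpa using hK.measure_lt_top⟩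
    exact MemLp.of_bound h.lim_meas C ((ae_restrict_iff' hK.measurableSet).2
      (Eventually.of_forall hC))
  lim := by
    rw [ENNReal.tendsto_nhds_zero]
    intro ε hε
    by_cases hεt : ε = ∞
    · simp [hεt]
    have hV : volume K ^ (1 / (2 : ℝ)) ≠ ∞ :=
      ENNReal.rpow_ne_top_of_nonneg (by norm_num) hK.measure_lt_top.ne
    obtain ⟨η, hη, hηε⟩ : ∃ η : ℝ, 0 < η ∧
        ENNReal.ofReal η * volume K ^ (1 / (2 : ℝ)) ≤ ε := by
      have : Tendsto (fun η : ℝ => ENNReal.ofReal η * volume K ^ (1 / (2 : ℝ)))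
          (𝓝[>] 0) (𝓝 0) := by
        have := ENNReal.Tendsto.mul_const (b := volume K ^ (1 / (2 : ℝ)))
          (ENNReal.tendsto_ofReal (tendsto_id (α := ℝ) (x := 𝓝 0))) (Or.inr hV)
        simpa using this.mono_left nhdsWithin_le_nhds
      have h2 := (ENNReal.tendsto_nhds_zero.1 this ε hε).and self_mem_nhdsWithin
      obtain ⟨η, h, h'⟩ := h2.exists
      exact ⟨η, h', h⟩
    filter_upwards [Metric.tendstoUniformlyOn_iff.1 h.unif η hη] with n hn
    refine (eLpNorm_le_of_ae_bound (C := η) ((ae_restrict_iff' hK.measurableSet).2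
      (Eventually.of_forall fun x hx => ?_))).trans ?_
    · rw [Pi.sub_apply, ← dist_eq_norm, dist_comm]; exact (hn x hx).le
    · rw [mul_comm]; simpa using hηε

/-- Split FₙKₙ − FK as Fₙ(Kₙ − K) + (Fₙ − F)K, where K denotes the L² limit: the first term is
controlled by the eventual bound C + 1 on Fₙ, the second by uniform convergence. -/
theorem L2Lim.mul {K : Set Plane} (hK : MeasurableSet K) {Fn k : ℕ → Plane → ℝ} {F h : Plane → ℝ}
    (hF : UnifLim K Fn F) (hk : L2Lim (volume.restrict K) k h) :
    L2Lim (volume.restrict K) (fun n x => Fn n x * k n x) (fun x => F x * h x) := by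
  obtain ⟨C, hC⟩ := hF.bound
  refine ⟨by filter_upwards [hF.meas, hk.meas] with n h1 h2 using h1.mul h2, ?_, ?_⟩
  · exact hk.mem.of_le_mul (c := C) (hF.lim_meas.mul hk.mem.1)
      ((ae_restrict_iff' hK).2 (Eventually.of_forall fun x hx => by
        rw [norm_mul]; exact mul_le_mul_of_nonneg_right (hC x hx) (norm_nonneg _)))
  · have h1 : Tendsto (fun n => ENNReal.ofReal (C + 1) *
        eLpNorm (k n - h) 2 (volume.restrict K)) atTop (𝓝 0) := by
      simpa using ENNReal.Tendsto.const_mul hk.lim (Or.inr ENNReal.ofReal_ne_top)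
    have h2 : Tendsto (fun n => eLpNorm (fun x => (Fn n x - F x) * h x) 2 (volume.restrict K))
        atTop (𝓝 0) := by
      rw [ENNReal.tendsto_nhds_zero]
      intro ε hε
      have hη : Tendsto (fun η : ℝ => ENNReal.ofReal η * eLpNorm h 2 (volume.restrict K))
          (𝓝[>] 0) (𝓝 0) := by
        have := ENNReal.Tendsto.mul_const (b := eLpNorm h 2 (volume.restrict K))
          (ENNReal.tendsto_ofReal (tendsto_id (α := ℝ) (x := 𝓝 0))) (Or.inr hk.mem.2.ne)
        simpa using this.mono_left nhdsWithin_le_nhds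
      obtain ⟨η, hηε, hη0⟩ := ((ENNReal.tendsto_nhds_zero.1 hη ε hε).and
        self_mem_nhdsWithin).exists
      filter_upwards [Metric.tendstoUniformlyOn_iff.1 hF.unif η hη0] with n hn
      refine (eLpNorm_le_mul_eLpNorm_of_ae_le_mul ((ae_restrict_iff' hK).2
        (Eventually.of_forall fun x hx => ?_)) 2).trans hηε
      rw [norm_mul]
      refine mul_le_mul_of_nonneg_right ?_ (norm_nonneg _)
      rw [← dist_eq_norm, dist_comm]; exact (hn x hx).le
    have h3 := h1.add h2
    rw [add_zero] at h3
    refine tendsto_of_tendsto_of_tendsto_of_le_of_le' tendsto_const_nhds h3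
      (Eventually.of_forall fun _ => zero_le) ?_
    filter_upwards [hF.meas, hk.meas, Metric.tendstoUniformlyOn_iff.1 hF.unif 1 one_pos]
      with n m1 m2 hn
    have : (fun x => Fn n x * k n x) - (fun x => F x * h x)
        = (fun x => Fn n x * (k n - h) x) + (fun x => (Fn n x - F x) * h x) := by
      ext x; simp only [Pi.sub_apply, Pi.add_apply]; ring
    rw [this]
    refine (eLpNorm_add_le (m1.mul (m2.sub hk.mem.1)) ((m1.sub hF.lim_meas).mul hk.mem.1)
      (by norm_num)).trans (add_le_add ?_ le_rfl)
    refine eLpNorm_le_mul_eLpNorm_of_ae_le_mul ((ae_restrict_iff' hK).2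
        (Eventually.of_forall fun x hx => ?_)) 2
    rw [Pi.mul_apply, norm_mul]
    refine mul_le_mul_of_nonneg_right ?_ (norm_nonneg _)
    have h4 := hn x hx
    rw [Real.dist_eq] at h4
    have h5 := hC x hx
    rw [Real.norm_eq_abs]
    have := abs_sub_abs_le_abs_sub (Fn n x) (F x)
    rw [abs_sub_comm] at this
    linarith

/-- Hölder's inequality: pairing with a fixed L² function is continuous in L². -/
theorem L2Lim.tendsto_integral {μ : Measure Plane} {k : ℕ → Plane → ℝ} {h A : Plane → ℝ}
    (hk : L2Lim μ k h) (hA : MemLp A 2 μ) :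
    Tendsto (fun n => ∫ x, A x * k n x ∂μ) atTop (𝓝 (∫ x, A x * h x ∂μ)) := by
  have hmem : ∀ᶠ n in atTop, MemLp (k n) 2 μ := by
    filter_upwards [hk.meas, hk.lim.eventually_lt_const ENNReal.zero_lt_top] with n h1 h2
    have : MemLp (k n - h) 2 μ := ⟨h1.sub hk.mem.1, h2⟩
    simpa using this.add hk.mem
  refine tendsto_integral_of_L1' _ (hA.integrable_mul hk.mem).1 ?_ ?_
  · filter_upwards [hmem] with n hn using hA.integrable_mul hn
  · have h1 : Tendsto (fun n => eLpNorm A 2 μ * eLpNorm (k n - h) 2 μ) atTop (𝓝 0) := by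
      simpa using ENNReal.Tendsto.const_mul hk.lim (Or.inr hA.2.ne)
    refine tendsto_of_tendsto_of_tendsto_of_le_of_le' tendsto_const_nhds h1
      (Eventually.of_forall fun _ => zero_le) ?_
    filter_upwards [hk.meas] with n hn
    have : (fun x => A x * k n x) - A * h = A • (k n - h) := by
      ext x; simp only [Pi.sub_apply, smul_eq_mul, Pi.smul_apply', Pi.mul_apply]; ring
    rw [this]
    exact eLpNorm_smul_le_mul_eLpNorm (hn.sub hk.mem.1) hA.1

/-- The image of the compact set has a compact neighbourhood in the open set `W`. Eventually all
approximations take values there, and `F` is uniformly continuous on it. -/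
theorem UnifLim.comp {E : Type*} [NormedAddCommGroup E] [ProperSpace E] {K : Set Plane}
    (hK : IsCompact K)
    {u : Plane → E} {un : ℕ → Plane → E} (hu : ContinuousOn u K) (hun : ∀ n, Continuous (un n))
    (hlim : TendstoUniformlyOn un u atTop K) {W : Set E} (hW : IsOpen W)
    (huW : MapsTo u K W) {F : E → ℝ} (hF : ContinuousOn F W) :
    (∀ᶠ n in atTop, MapsTo (un n) K W) ∧
      UnifLim K (fun n x => F (un n x)) (fun x => F (u x)) := by
  have hKu : IsCompact (u '' K) := hK.image_of_continuousOn hu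
  obtain ⟨δ, hδ, hδW⟩ := hKu.exists_cthickening_subset_open hW (image_subset_iff.2 huW)
  set V := cthickening δ (u '' K)
  have hVc : IsCompact V := hKu.cthickening
  have hev : ∀ᶠ n in atTop, MapsTo (un n) K V := by
    filter_upwards [Metric.tendstoUniformlyOn_iff.1 hlim δ hδ] with n hn x hx
    refine mem_cthickening_of_dist_le _ (u x) _ _ (mem_image_of_mem u hx) ?_
    rw [dist_comm]; exact (hn x hx).le
  have huV : MapsTo u K V := fun x hx => self_subset_cthickening _ (mem_image_of_mem u hx)
  have hFu : ContinuousOn (fun x => F (u x)) K := hF.comp hu huW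
  refine ⟨hev.mono fun n h => h.mono_right hδW, ?_, ?_, ?_, ?_⟩
  · filter_upwards [hev] with n hn
    exact (hF.comp (hun n).continuousOn (hn.mono_right hδW)).aestronglyMeasurable_of_isCompact hK
      hK.measurableSet
  · exact hFu.aestronglyMeasurable_of_isCompact hK hK.measurableSet
  · exact (hK.exists_bound_of_continuousOn hFu)
  · exact UniformContinuousOn.comp_tendstoUniformlyOn_eventually (s := V)
      (hev.mono fun n h => h) huV (hVc.uniformContinuousOn_of_continuous (hF.mono hδW)) hlim

theorem UnifLim.const {K : Set Plane} (hK : IsCompact K) {F : Plane → ℝ} (hF : ContinuousOn F K) :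
    UnifLim K (fun _ => F) F where
  meas := Eventually.of_forall fun _ =>
    hF.aestronglyMeasurable_of_isCompact hK hK.measurableSet
  lim_meas := hF.aestronglyMeasurable_of_isCompact hK hK.measurableSet
  bound := hK.exists_bound_of_continuousOn hF
  unif := by
    rw [Metric.tendstoUniformlyOn_iff]
    intro ε hε
    simp [hε]

/-- Mollifications of a weakly differentiable function: the derivatives converge in `L²`. -/
theorem l2Lim_fderiv_moll {U K K' : Set Plane} (hK : IsCompact K) (hK' : IsCompact K')
    (hKU : K' ⊆ U) {δ : ℝ} (hδ : 0 < δ) (hKK : ∀ x ∈ K, closedBall x δ ⊆ K') {e : Plane}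
    {f g : Plane → ℝ} (hw : HasWeakDeriv U e f g) (hf : IntegrableOn f K')
    (hg : MemLp g 2 (volume.restrict K')) :
    L2Lim (volume.restrict K) (fun n x => fderiv ℝ (moll n (K'.indicator f)) x e) g := by
  have hli : LocallyIntegrable (K'.indicator f) :=
    ((integrable_indicator_iff hK'.measurableSet).2 hf).locallyIntegrable
  have hgi : MemLp (K'.indicator g) 2 := (memLp_indicator_iff_restrict hK'.measurableSet).2 hg
  have hsub : K ⊆ K' := fun x hx => hKK x hx (mem_closedBall_self hδ.le)
  refine ⟨Eventually.of_forall fun n => ?_, hg.mono_measure (Measure.restrict_mono hsub le_rfl), ?_⟩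
  · exact (((contDiff_moll hli).continuous_fderiv (by simp)).clm_apply
      continuous_const).aestronglyMeasurable
  · refine tendsto_of_tendsto_of_tendsto_of_le_of_le' tendsto_const_nhds
      (tendsto_eLpNorm_moll_sub hgi) (Eventually.of_forall fun _ => zero_le) ?_
    have hev : ∀ᶠ n : ℕ in atTop, 1 / ((n : ℝ) + 1) < δ :=
      tendsto_one_div_add_atTop_nhds_zero_nat.eventually_lt_const hδ
    filter_upwards [hev] with n hn
    refine le_trans (le_of_eq ?_) (eLpNorm_restrict_le (moll n (K'.indicator g) - K'.indicator g)
      2 volume K)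
    refine eLpNorm_congr_ae ((ae_restrict_iff' hK.measurableSet).2 (Eventually.of_forall ?_))
    intro x hx
    simp only [Pi.sub_apply]
    rw [fderiv_moll_eq_moll hK'.measurableSet hKU hw hf
      ((closedBall_subset_closedBall hn.le).trans (hKK x hx)), indicator_of_mem (hsub hx)]

/-! ### Testing a divergence free field with a function of the velocity -/

/-- `A` is square integrable on compact subsets of `U`, and divergence free in `U` in the sense of
distributions. -/
structure WeaklyDivFree (U : Set Plane) (A : Fin 2 → Plane → ℝ) : Prop where
  memLp : ∀ j, ∀ K, IsCompact K → K ⊆ U → MemLp (A j) 2 (volume.restrict K)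
  integral_eq_zero : ∀ φ, IsTest U φ → ∫ x, ∑ j, A j x * fderiv ℝ φ x (stdVec j) = 0

theorem integral_mul_fderiv_of_contDiff_one {Φ : Plane → ℝ} (hΦ : ContDiff ℝ 1 Φ)
    (hΦc : HasCompactSupport Φ) (e : Plane) :
    HasWeakDeriv univ e Φ (fun x => fderiv ℝ Φ x e) := by
  intro φ hφ
  have hφ1 : ContDiff ℝ 1 φ := hφ.contDiff.of_le (by simp)
  have hd1 : Continuous fun x => fderiv ℝ Φ x e :=
    (hΦ.continuous_fderiv one_ne_zero).clm_apply continuous_const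
  have hd2 : Continuous fun x => fderiv ℝ φ x e :=
    (hφ1.continuous_fderiv one_ne_zero).clm_apply continuous_const
  refine integral_mul_fderiv_eq_neg_fderiv_mul_of_integrable ?_ ?_ ?_
    (fun x _ => hΦ.differentiable one_ne_zero x) (fun x _ => hφ1.differentiable one_ne_zero x)
  · exact (hd1.mul hφ1.continuous).integrable_of_hasCompactSupport hφ.hasCompactSupport.mul_left
  · exact (hΦ.continuous.mul hd2).integrable_of_hasCompactSupport hΦc.mul_right
  · exact (hΦ.continuous.mul hφ1.continuous).integrable_of_hasCompactSupport hΦc.mul_right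

/-- Mollifications of a C¹ test function are smooth, remain supported in a fixed compact set, and
converge together with their first derivatives. Functions of the angle are only C¹, hence the need.
-/
theorem WeaklyDivFree.integral_eq_zero_of_contDiff_one {U : Set Plane} (hU : IsOpen U)
    {A : Fin 2 → Plane → ℝ} (hA : WeaklyDivFree U A) {Φ : Plane → ℝ} (hΦ : ContDiff ℝ 1 Φ)
    (hΦc : HasCompactSupport Φ) (hΦU : tsupport Φ ⊆ U) :
    ∫ x, ∑ j, A j x * fderiv ℝ Φ x (stdVec j) = 0 := by
  obtain ⟨K, δ, hK, hKU, hδ, hKK⟩ := exists_compact_closedBall_subset hΦc.isCompact hU hΦU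
  have hd : ∀ j, Continuous fun x => fderiv ℝ Φ x (stdVec j) := fun j =>
    (hΦ.continuous_fderiv one_ne_zero).clm_apply continuous_const
  have hdc : ∀ j, HasCompactSupport fun x => fderiv ℝ Φ x (stdVec j) := fun j =>
    (hΦc.fderiv ℝ).comp_left (g := fun L : Plane →L[ℝ] ℝ => L (stdVec j)) (by simp)
  have hl : LocallyIntegrable Φ := hΦ.continuous.locallyIntegrable
  have hsub : tsupport Φ ⊆ K := fun x hx => hKK x hx (mem_closedBall_self hδ.le)
  have hev : ∀ᶠ n : ℕ in atTop, 1 / ((n : ℝ) + 1) < δ :=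
    tendsto_one_div_add_atTop_nhds_zero_nat.eventually_lt_const hδ
  have htest : ∀ᶠ n in atTop, IsTest U (moll n Φ) ∧ tsupport (moll n Φ) ⊆ K := by
    filter_upwards [hev] with n hn
    have hts : tsupport (moll n Φ) ⊆ K := by
      refine closure_minimal (fun x hx => ?_) hK.isClosed
      by_contra hxK
      have h0 : ∀ y ∈ ball x (1 / ((n : ℝ) + 1)), Φ y = 0 := fun y hy => by
        by_contra hne
        refine hxK (hKK y (subset_tsupport _ hne) ?_)
        rw [mem_closedBall, dist_comm]; exact ((mem_ball.1 hy).trans hn).le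
      have hx0 := h0 x (mem_ball_self (by positivity))
      have := dist_moll_le (n := n) (x := x) (ε := 0) hΦ.continuous.aestronglyMeasurable
        fun y hy => by rw [h0 y hy, hx0, dist_self]
      exact hx (by rw [dist_le_zero.1 this, hx0])
    exact ⟨⟨contDiff_moll hl, hK.of_isClosed_subset (isClosed_tsupport _) hts,
      hts.trans hKU⟩, hts⟩
  have hfd : ∀ j n x, fderiv ℝ (moll n Φ) x (stdVec j)
      = moll n (fun x => fderiv ℝ Φ x (stdVec j)) x := fun j n x => by
    have hint : Integrable Φ := hΦ.continuous.integrable_of_hasCompactSupport hΦc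
    have := fderiv_moll_eq_moll (n := n) (x := x) MeasurableSet.univ subset_rfl
      (integral_mul_fderiv_of_contDiff_one hΦ hΦc (stdVec j)) hint.integrableOn (subset_univ _)
    simpa using this
  have hunif : ∀ j, UnifLim K (fun n x => fderiv ℝ (moll n Φ) x (stdVec j))
      (fun x => fderiv ℝ Φ x (stdVec j)) := fun j => by
    refine ⟨Eventually.of_forall fun n => ?_, (hd j).aestronglyMeasurable,
      hK.exists_bound_of_continuousOn (hd j).continuousOn, ?_⟩
    · exact (((contDiff_moll hl).continuous_fderiv (by simp)).clm_apply
        continuous_const).aestronglyMeasurable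
    · rw [Metric.tendstoUniformlyOn_iff]
      intro ε hε
      obtain ⟨r, hr, hrf⟩ := Metric.uniformContinuous_iff.1
        ((hdc j).uniformContinuous_of_continuous (hd j)) (ε / 2) (half_pos hε)
      filter_upwards [tendsto_one_div_add_atTop_nhds_zero_nat.eventually_lt_const hr]
        with n hn x _
      have := dist_moll_le (n := n) (x := x) (ε := ε / 2) (hd j).aestronglyMeasurable
        fun y hy => (hrf ((mem_ball.1 hy).trans hn)).le
      rw [hfd, dist_comm]
      linarith
  have hlim : ∀ j, Tendsto (fun n => ∫ x in K, A j x * fderiv ℝ (moll n Φ) x (stdVec j)) atTop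
      (𝓝 (∫ x in K, A j x * fderiv ℝ Φ x (stdVec j))) := fun j =>
    ((hunif j).l2Lim hK).tendsto_integral (hA.memLp j K hK hKU)
  have hset : ∀ Ψ : Plane → ℝ, ContDiff ℝ 1 Ψ → tsupport Ψ ⊆ K →
      ∫ x, ∑ j, A j x * fderiv ℝ Ψ x (stdVec j)
        = ∑ j, ∫ x in K, A j x * fderiv ℝ Ψ x (stdVec j) := fun Ψ hΨ hΨK => by
    rw [← integral_finsetSum]
    · refine (setIntegral_eq_integral_of_forall_compl_eq_zero fun x hx => ?_).symm
      have : fderiv ℝ Ψ x = 0 := by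
        by_contra hne
        exact hx (hΨK (support_fderiv_subset ℝ hne))
      simp [this]
    · intro j _
      have hc : Continuous fun x => fderiv ℝ Ψ x (stdVec j) :=
        (hΨ.continuous_fderiv one_ne_zero).clm_apply continuous_const
      exact (hA.memLp j K hK hKU).integrable_mul
        ((UnifLim.const hK hc.continuousOn).l2Lim hK).mem
  rw [hset Φ hΦ hsub]
  refine tendsto_nhds_unique_of_eventuallyEq (tendsto_finsetSum _ fun j _ => hlim j)
    tendsto_const_nhds ?_
  filter_upwards [htest] with n hn
  rw [← hset _ (hn.1.contDiff.of_le (by simp)) hn.2]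
  exact hA.integral_eq_zero _ hn.1

theorem contDiff_of_contDiffAt_tsupport {f : Plane → ℝ}
    (h : ∀ x ∈ tsupport f, ContDiffAt ℝ 1 f x) : ContDiff ℝ 1 f := by
  refine contDiff_iff_contDiffAt.2 fun x => ?_
  by_cases hx : x ∈ tsupport f
  · exact h x hx
  · exact (contDiffAt_const (c := (0 : ℝ))).congr_of_eventuallyEq
      (notMem_tsupport_iff_eventuallyEq.1 hx)

/-- The velocity as a complex number. -/
noncomputable def cvel (v : Plane → Plane) (x : Plane) : ℂ := ⟨v x 0, v x 1⟩

theorem clm_apply_mk (L : ℂ →L[ℝ] ℝ) (a b : ℝ) :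
    L ⟨a, b⟩ = L 1 * a + L Complex.I * b := by
  have : (⟨a, b⟩ : ℂ) = a • (1 : ℂ) + b • Complex.I := by
    apply Complex.ext <;> simp
  rw [this, map_add, map_smul, map_smul, smul_eq_mul, smul_eq_mul]; ring

/-- Testing a divergence free field `A` with `ψ G(v)`, for a continuous and weakly differentiable
field `v`. -/
theorem WeaklyDivFree.integral_comp_eq_zero {U : Set Plane} (hU : IsOpen U)
    {A : Fin 2 → Plane → ℝ} (hA : WeaklyDivFree U A) {v : Plane → Plane} (hv : ContinuousOn v U)
    {g : Fin 2 → Fin 2 → Plane → ℝ}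
    (hw : ∀ j i, HasWeakDeriv U (stdVec j) (fun x => v x i) (g j i))
    (hg : ∀ j i, ∀ K, IsCompact K → K ⊆ U → MemLp (g j i) 2 (volume.restrict K))
    {ψ : Plane → ℝ} (hψ : ContDiff ℝ 1 ψ) (hψc : HasCompactSupport ψ) (hψU : tsupport ψ ⊆ U)
    {G : ℂ → ℝ} (hG : ∀ x ∈ tsupport ψ, ContDiffAt ℝ 1 G (cvel v x)) :
    ∫ x, ∑ j, A j x * (G (cvel v x) * fderiv ℝ ψ x (stdVec j)
      + ψ x * fderiv ℝ G (cvel v x) ⟨g j 0 x, g j 1 x⟩) = 0 := by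
  set K := tsupport ψ with hKdef
  have hK : IsCompact K := hψc.isCompact
  obtain ⟨K', δ, hK', hK'U, hδ, hKK⟩ := exists_compact_closedBall_subset hK hU hψU
  have hvi : ∀ i, ContinuousOn (fun x => v x i) K' := fun i =>
    (EuclideanSpace.proj (𝕜 := ℝ) i).continuous.comp_continuousOn (hv.mono hK'U)
  have hvint : ∀ i, IntegrableOn (fun x => v x i) K' := fun i => (hvi i).integrableOn_compact hK'
  have hli : ∀ i, LocallyIntegrable (K'.indicator fun x => v x i) := fun i =>
    ((integrable_indicator_iff hK'.measurableSet).2 (hvint i)).locallyIntegrable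
  set m : Fin 2 → ℕ → Plane → ℝ := fun i n => moll n (K'.indicator fun x => v x i) with hm
  have hmd : ∀ i n, ContDiff ℝ 1 (m i n) := fun i n => (contDiff_moll (hli i)).of_le (by simp)
  set un : ℕ → Plane → ℂ := fun n x => ⟨m 0 n x, m 1 n x⟩ with hun
  have hund : ∀ n, ContDiff ℝ 1 (un n) := fun n => by
    have : un n = fun x => Complex.equivRealProdCLM.symm (m 0 n x, m 1 n x) := rfl
    rw [this]
    exact Complex.equivRealProdCLM.symm.contDiff.comp ((hmd 0 n).prodMk (hmd 1 n))
  have hunfd : ∀ n x e, fderiv ℝ (un n) x e = ⟨fderiv ℝ (m 0 n) x e, fderiv ℝ (m 1 n) x e⟩ :=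
    fun n x e => by
      have h1 := ((hmd 0 n).differentiable one_ne_zero x).hasFDerivAt.prodMk
        ((hmd 1 n).differentiable one_ne_zero x).hasFDerivAt
      have h2 : HasFDerivAt (un n) _ x :=
        (Complex.equivRealProdCLM.symm.toContinuousLinearMap.hasFDerivAt).comp x h1
      rw [h2.fderiv]; rfl
  have hucont : ContinuousOn (cvel v) K := by
    have : cvel v = fun x => Complex.equivRealProdCLM.symm (v x 0, v x 1) := rfl
    have hsub : K ⊆ K' := fun x hx => hKK x hx (mem_closedBall_self hδ.le)
    rw [this]
    exact Complex.equivRealProdCLM.symm.continuous.comp_continuousOn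
      (((hvi 0).mono hsub).prodMk ((hvi 1).mono hsub))
  have hlim : TendstoUniformlyOn un (cvel v) atTop K := by
    have h0 := fun i => tendstoUniformlyOn_moll hK' (hvi i) hδ hKK
    rw [Metric.tendstoUniformlyOn_iff]
    intro ε hε
    filter_upwards [Metric.tendstoUniformlyOn_iff.1 (h0 0) (ε / 2) (half_pos hε),
      Metric.tendstoUniformlyOn_iff.1 (h0 1) (ε / 2) (half_pos hε)] with n h1 h2 x hx
    have a1 := h1 x hx
    have a2 := h2 x hx
    rw [Real.dist_eq] at a1 a2
    rw [dist_eq_norm]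
    refine (Complex.norm_le_abs_re_add_abs_im _).trans_lt ?_
    have : |(cvel v x - un n x).re| + |(cvel v x - un n x).im| < ε / 2 + ε / 2 := add_lt_add a1 a2
    linarith
  -- Being C¹ at a point is an open condition, so `G` is also C¹ at the values of late
  -- mollifications of `v`.
  set W := {z : ℂ | ContDiffAt ℝ 1 G z} with hWdef
  have hWG : ∀ z ∈ W, ContDiffAt ℝ 1 G z := fun z hz => hz
  have hW : IsOpen W := isOpen_iff_mem_nhds.2 fun z hz => ContDiffAt.eventually hz (by simp)
  have hGW : ContDiffOn ℝ 1 G W := fun z hz => ContDiffAt.contDiffWithinAt hz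
  have hdG : ∀ h : ℂ, ContinuousOn (fun z => fderiv ℝ G z h) W := fun h =>
    (hGW.continuousOn_fderiv_of_isOpen hW le_rfl).clm_apply continuousOn_const
  have hcomp := fun {F : ℂ → ℝ} (hF : ContinuousOn F W) =>
    UnifLim.comp hK hucont (fun n => (hund n).continuous) hlim hW hG hF
  have hdψ : ∀ j, Continuous fun x => fderiv ℝ ψ x (stdVec j) := fun j =>
    (hψ.continuous_fderiv one_ne_zero).clm_apply continuous_const
  have hder : ∀ i j, L2Lim (volume.restrict K) (fun n x => fderiv ℝ (m i n) x (stdVec j))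
      (g j i) := fun i j => l2Lim_fderiv_moll hK hK' hK'U hδ hKK (hw j i) (hvint i)
        (hg j i K' hK' hK'U)
  have hL2 : ∀ j, L2Lim (volume.restrict K)
      (fun n x => G (un n x) * fderiv ℝ ψ x (stdVec j)
        + (ψ x * (fderiv ℝ G (un n x) 1 * fderiv ℝ (m 0 n) x (stdVec j)
          + fderiv ℝ G (un n x) Complex.I * fderiv ℝ (m 1 n) x (stdVec j))))
      (fun x => G (cvel v x) * fderiv ℝ ψ x (stdVec j)
        + (ψ x * (fderiv ℝ G (cvel v x) 1 * g j 0 x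
          + fderiv ℝ G (cvel v x) Complex.I * g j 1 x))) := fun j =>
    (L2Lim.mul hK.measurableSet (hcomp hGW.continuousOn).2
      ((UnifLim.const hK (hdψ j).continuousOn).l2Lim hK)).add
    (L2Lim.mul hK.measurableSet (UnifLim.const hK hψ.continuous.continuousOn)
      ((L2Lim.mul hK.measurableSet (hcomp (hdG 1)).2 (hder 0 j)).add
       (L2Lim.mul hK.measurableSet (hcomp (hdG Complex.I)).2 (hder 1 j))))
  have hlimj := fun j => (hL2 j).tendsto_integral (hA.memLp j K hK hψU)
  have hzero : ∀ x ∉ K, ψ x = 0 ∧ fderiv ℝ ψ x = 0 := fun x hx =>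
    ⟨image_eq_zero_of_notMem_tsupport hx, by
      by_contra hne
      exact hx (support_fderiv_subset ℝ hne)⟩
  have hgoal : ∫ x, ∑ j, A j x * (G (cvel v x) * fderiv ℝ ψ x (stdVec j)
      + ψ x * fderiv ℝ G (cvel v x) ⟨g j 0 x, g j 1 x⟩)
      = ∑ j, ∫ x in K, A j x * (G (cvel v x) * fderiv ℝ ψ x (stdVec j)
        + (ψ x * (fderiv ℝ G (cvel v x) 1 * g j 0 x
          + fderiv ℝ G (cvel v x) Complex.I * g j 1 x))) := by
    rw [← integral_finsetSum]
    · rw [← setIntegral_eq_integral_of_forall_compl_eq_zero (s := K)]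
      · simp only [clm_apply_mk]
      · intro x hx
        simp [(hzero x hx).1, (hzero x hx).2]
    · intro j _
      exact (hA.memLp j K hK hψU).integrable_mul (hL2 j).mem
  rw [hgoal]
  -- With the mollified velocity the product `ψ G(un)` is an admissible C¹ test function and the
  -- classical chain rule applies, so the approximating integrals vanish. The gradients converge
  -- only in L², which suffices because `A` is in L².
  refine tendsto_nhds_unique_of_eventuallyEq (tendsto_finsetSum _ fun j _ => hlimj j)
    tendsto_const_nhds ?_
  filter_upwards [(hcomp hGW.continuousOn).1] with n hn
  have hts : tsupport (fun x => ψ x * G (un n x)) ⊆ K := tsupport_mul_subset_left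
  have hΦ : ContDiff ℝ 1 fun x => ψ x * G (un n x) := by
    refine contDiff_of_contDiffAt_tsupport fun x hx => ?_
    exact hψ.contDiffAt.mul (ContDiffAt.comp x (hWG _ (hn (hts hx))) (hund n).contDiffAt)
  have h0 := hA.integral_eq_zero_of_contDiff_one hU hΦ
    (hK.of_isClosed_subset (isClosed_tsupport _) hts) (hts.trans hψU)
  rw [← h0, ← setIntegral_eq_integral_of_forall_compl_eq_zero (s := K)]
  · rw [← integral_finsetSum]
    · refine setIntegral_congr_fun hK.measurableSet fun x hx => ?_
      refine Finset.sum_congr rfl fun j _ => ?_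
      have hGd : HasFDerivAt G (fderiv ℝ G (un n x)) (un n x) :=
        ((hWG _ (hn hx)).differentiableAt one_ne_zero).hasFDerivAt
      have h1 := (hψ.differentiable one_ne_zero x).hasFDerivAt.mul
        (hGd.comp x ((hund n).differentiable one_ne_zero x).hasFDerivAt)
      have h2 : fderiv ℝ (fun x => ψ x * G (un n x)) x = _ := h1.fderiv
      rw [h2]
      simp only [_root_.add_apply, _root_.smul_apply, smul_eq_mul,
        ContinuousLinearMap.comp_apply, hunfd, Function.comp_apply, clm_apply_mk]
      ring
    · intro j _
      have hc : Continuous fun x => fderiv ℝ (fun x => ψ x * G (un n x)) x (stdVec j) :=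
        (hΦ.continuous_fderiv one_ne_zero).clm_apply continuous_const
      have := (hA.memLp j K hK hψU).integrable_mul
        ((UnifLim.const hK hc.continuousOn).l2Lim hK).mem
      refine this.congr ((ae_restrict_iff' hK.measurableSet).2 (Eventually.of_forall ?_))
      intro x hx
      have hGd : HasFDerivAt G (fderiv ℝ G (un n x)) (un n x) :=
        ((hWG _ (hn hx)).differentiableAt one_ne_zero).hasFDerivAt
      have h1 := (hψ.differentiable one_ne_zero x).hasFDerivAt.mul
        (hGd.comp x ((hund n).differentiable one_ne_zero x).hasFDerivAt)
      have h2 : fderiv ℝ (fun x => ψ x * G (un n x)) x = _ := h1.fderiv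
      simp only [Pi.mul_apply]
      rw [h2]
      simp only [_root_.add_apply, _root_.smul_apply, smul_eq_mul,
        ContinuousLinearMap.comp_apply, hunfd, Function.comp_apply, clm_apply_mk]
      ring
  · intro x hx
    have : fderiv ℝ (fun x => ψ x * G (un n x)) x = 0 := by
      by_contra hne
      exact hx (hts (support_fderiv_subset ℝ hne))
    simp [this]

/-! ### Functions of the angle -/

theorem hasDerivAt_max_sq (x : ℝ) : HasDerivAt (fun x : ℝ => max x 0 ^ 2) (2 * max x 0) x := by
  rcases lt_trichotomy x 0 with hx | rfl | hx
  · have : (fun x : ℝ => max x 0 ^ 2) =ᶠ[𝓝 x] fun _ => 0 := by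
      filter_upwards [eventually_lt_nhds hx] with y hy
      rw [max_eq_right hy.le]; norm_num
    rw [max_eq_right hx.le, mul_zero]
    exact (hasDerivAt_const x (0 : ℝ)).congr_of_eventuallyEq this
  · rw [max_self, mul_zero, hasDerivAt_iff_isLittleO_nhds_zero]
    have h1 : (fun h : ℝ => max h 0 ^ 2) =O[𝓝 0] fun h : ℝ => h ^ 2 := by
      refine Asymptotics.IsBigO.of_bound 1 (Eventually.of_forall fun h => ?_)
      rw [one_mul, Real.norm_eq_abs, Real.norm_eq_abs, abs_of_nonneg (sq_nonneg _),
        abs_of_nonneg (sq_nonneg _)]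
      rcases le_total h 0 with h0 | h0
      · rw [max_eq_right h0]; nlinarith
      · rw [max_eq_left h0]
    have h2 : (fun h : ℝ => h ^ 2) =o[𝓝 0] fun h : ℝ => h := by
      simpa using Asymptotics.isLittleO_pow_pow (𝕜 := ℝ) (m := 1) (n := 2) (by norm_num)
    simpa using h1.trans_isLittleO h2
  · have : (fun x : ℝ => max x 0 ^ 2) =ᶠ[𝓝 x] fun x => x ^ 2 := by
      filter_upwards [eventually_gt_nhds hx] with y hy
      rw [max_eq_left hy.le]
    rw [max_eq_left hx.le]
    refine HasDerivAt.congr_of_eventuallyEq ?_ this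
    simpa using hasDerivAt_pow 2 x

theorem contDiff_max_sq : ContDiff ℝ 1 fun x : ℝ => max x 0 ^ 2 := by
  rw [contDiff_one_iff_deriv]
  refine ⟨fun x => (hasDerivAt_max_sq x).differentiableAt, ?_⟩
  have : deriv (fun x : ℝ => max x 0 ^ 2) = fun x => 2 * max x 0 :=
    funext fun x => (hasDerivAt_max_sq x).deriv
  rw [this]
  fun_prop

/-- A nondecreasing function of the angle on each side of the angle `τ`, vanishing near the angles
of the real axis. -/
noncomputable def angF (τ δ θ : ℝ) : ℝ :=
  if θ < τ then max (θ - δ) 0 ^ 2 else - max (Real.pi - δ - θ) 0 ^ 2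

/-- The derivative of `angF`. -/
noncomputable def angF' (τ δ θ : ℝ) : ℝ :=
  if θ < τ then 2 * max (θ - δ) 0 else 2 * max (Real.pi - δ - θ) 0

theorem contDiffAt_angF {τ δ θ : ℝ} (h : θ ≠ τ) : ContDiffAt ℝ 1 (angF τ δ) θ := by
  rcases lt_or_gt_of_ne h with h | h
  · refine ((contDiff_max_sq.comp (contDiff_id.sub contDiff_const)).contDiffAt
      (x := θ)).congr_of_eventuallyEq (f := fun θ : ℝ => max (θ - δ) 0 ^ 2) ?_
    filter_upwards [eventually_lt_nhds h] with y hy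
    rw [angF, if_pos hy]
  · refine ((contDiff_max_sq.comp (contDiff_const.sub contDiff_id)).neg.contDiffAt
      (x := θ)).congr_of_eventuallyEq (f := fun θ : ℝ => - max (Real.pi - δ - θ) 0 ^ 2) ?_
    filter_upwards [eventually_gt_nhds h] with y hy
    rw [angF, if_neg hy.not_gt]

theorem hasDerivAt_angF {τ δ θ : ℝ} (h : θ ≠ τ) : HasDerivAt (angF τ δ) (angF' τ δ θ) θ := by
  rcases lt_or_gt_of_ne h with h | h
  · have h1 := (hasDerivAt_max_sq (θ - δ)).comp θ ((hasDerivAt_id θ).sub_const δ)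
    rw [mul_one] at h1
    rw [angF', if_pos h]
    refine h1.congr_of_eventuallyEq ?_
    filter_upwards [eventually_lt_nhds h] with y hy
    rw [angF, if_pos hy]; rfl
  · have h1 := ((hasDerivAt_max_sq (Real.pi - δ - θ)).comp θ
      ((hasDerivAt_id θ).const_sub (Real.pi - δ))).neg
    rw [mul_neg_one, neg_neg] at h1
    rw [angF', if_neg h.not_gt]
    refine h1.congr_of_eventuallyEq ?_
    filter_upwards [eventually_gt_nhds h] with y hy
    rw [angF, if_neg hy.not_gt]; rfl

theorem angF'_nonneg (τ δ θ : ℝ) : 0 ≤ angF' τ δ θ := by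
  unfold angF'; split_ifs <;> positivity

theorem angF'_le {τ δ θ : ℝ} (hτ : 0 ≤ τ) (hδ : 0 ≤ δ) (hθ : θ ≤ Real.pi) :
    angF' τ δ θ ≤ 2 * Real.pi := by
  unfold angF'
  split_ifs with h
  · gcongr; exact max_le (by linarith) Real.pi_pos.le
  · gcongr; exact max_le (by linarith) Real.pi_pos.le

theorem abs_angF_le {τ δ θ : ℝ} (hτ : 0 ≤ τ) (hδ : 0 ≤ δ) (hθ : θ ≤ Real.pi) :
    |angF τ δ θ| ≤ Real.pi ^ 2 := by
  unfold angF
  split_ifs with h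
  · rw [abs_of_nonneg (by positivity)]; gcongr; exact max_le (by linarith) Real.pi_pos.le
  · rw [abs_neg, abs_of_nonneg (by positivity)]; gcongr
    exact max_le (by linarith) Real.pi_pos.le

/-- The point of the quadratic profile: with m the positive part, F² = m⁴ while F' = 2m. This is
what lets the cross term be absorbed in the Caccioppoli inequality. -/
theorem angF_sq_le {τ δ θ : ℝ} (hτ : 0 ≤ τ) (hδ : 0 ≤ δ) (hθ : θ ≤ Real.pi) :
    angF τ δ θ ^ 2 ≤ Real.pi ^ 3 * angF' τ δ θ := by
  have key : ∀ m : ℝ, 0 ≤ m → m ≤ Real.pi → (m ^ 2) ^ 2 ≤ Real.pi ^ 3 * (2 * m) := by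
    intro m h0 h1
    have : m ^ 3 ≤ Real.pi ^ 3 := by gcongr
    nlinarith [mul_le_mul_of_nonneg_right this h0, mul_nonneg (pow_nonneg Real.pi_pos.le 3) h0]
  unfold angF angF'
  split_ifs with h
  · exact key _ (le_max_right _ _) (max_le (by linarith) Real.pi_pos.le)
  · rw [neg_sq]; exact key _ (le_max_right _ _) (max_le (by linarith) Real.pi_pos.le)

theorem angF'_pos {τ δ θ : ℝ} (h1 : δ < θ) (h2 : θ < Real.pi - δ) : 0 < angF' τ δ θ := by
  unfold angF'
  split_ifs with h
  · have : 0 < max (θ - δ) 0 := lt_max_of_lt_left (by linarith)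
    positivity
  · have : 0 < max (Real.pi - δ - θ) 0 := lt_max_of_lt_left (by linarith)
    positivity

theorem angF_of_le {τ δ θ : ℝ} (h : θ < τ) (hθ : θ ≤ δ) :
    angF τ δ θ = 0 ∧ angF' τ δ θ = 0 := by
  rw [angF, angF', if_pos h, if_pos h, max_eq_right (by linarith)]; norm_num

theorem angF_of_ge {τ δ θ : ℝ} (h : τ ≤ θ) (hθ : Real.pi - δ ≤ θ) :
    angF τ δ θ = 0 ∧ angF' τ δ θ = 0 := by
  rw [angF, angF', if_neg h.not_gt, if_neg h.not_gt, max_eq_right (by linarith)]; norm_num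

/-- Near a nonzero horizontal velocity the function of the angle disappears, which makes the
boundary invisible. On the negative axis the argument jumps between π and −π, but both sides of the
jump fall in the zero set. An endpoint value τ = 0 or τ = π is harmless because the corresponding
direction is excluded by `harg`. -/
theorem eventually_angF_arg_eq_zero {τ δ : ℝ} (hτ : 0 ≤ τ) (hδ : 0 < δ)
    {z : ℂ} (hz : z ≠ 0) (him : z.im = 0) (harg : z.arg ≠ τ) (hτπ : τ ≤ Real.pi) :
    ∀ᶠ w in 𝓝 z, angF τ δ w.arg = 0 ∧ angF' τ δ w.arg = 0 := by
  have hre : z.re ≠ 0 := fun h => hz (Complex.ext h him)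
  rcases lt_or_gt_of_ne hre with hre | hre
  · have hπ : z.arg = Real.pi := Complex.arg_eq_pi_iff.2 ⟨hre, him⟩
    have hτ' : τ < Real.pi := lt_of_le_of_ne hτπ fun h => harg (hπ.trans h.symm)
    have h1 := Complex.tendsto_arg_nhdsWithin_im_nonneg_of_re_neg_of_im_zero hre him
    have h2 := h1.eventually_const_lt (u := max τ (Real.pi - δ))
      (max_lt hτ' (by linarith))
    rw [eventually_nhdsWithin_iff] at h2
    filter_upwards [h2] with w hw
    by_cases h : 0 ≤ w.im
    · have := hw h
      exact angF_of_ge ((le_max_left _ _).trans this.le) ((le_max_right _ _).trans this.le)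
    · have : w.arg < 0 := Complex.arg_neg_iff.2 (not_le.1 h)
      exact angF_of_le (by linarith) (by linarith)
  · have h0 : z.arg = 0 := Complex.arg_eq_zero_iff.2 ⟨hre.le, him⟩
    have hτ' : 0 < τ := lt_of_le_of_ne hτ fun h => harg (h0.trans h)
    have hs : z ∈ Complex.slitPlane := Or.inl hre
    have h2 := (Complex.continuousAt_arg hs).eventually_lt_const (u := min τ δ)
      (by rw [h0]; exact lt_min hτ' hδ)
    filter_upwards [h2] with w hw
    exact angF_of_le (hw.trans_le (min_le_left _ _)) (hw.le.trans (min_le_right _ _))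

/-! ### Cutting off near the zeros of the velocity -/

theorem deriv_smoothTransition_of_neg {t : ℝ} (ht : t < 0) : deriv Real.smoothTransition t = 0 := by
  have : Real.smoothTransition =ᶠ[𝓝 t] fun _ => 0 := by
    filter_upwards [eventually_lt_nhds ht] with y hy
    exact Real.smoothTransition.zero_of_nonpos hy.le
  rw [this.deriv_eq]; simp

theorem deriv_smoothTransition_of_gt {t : ℝ} (ht : 1 < t) : deriv Real.smoothTransition t = 0 := by
  have : Real.smoothTransition =ᶠ[𝓝 t] fun _ => 1 := by
    filter_upwards [eventually_gt_nhds ht] with y hy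
    exact Real.smoothTransition.one_of_one_le hy.le
  rw [this.deriv_eq]; simp

/-- Used at t = s|v|² − 1, where t + 1 = s|v|²: it bounds s|v|²|χ'| uniformly in the cutoff
parameter s. -/
theorem exists_deriv_smoothTransition_bound : ∃ C : ℝ, 0 ≤ C ∧ ∀ t : ℝ, 0 ≤ t + 1 →
    |deriv Real.smoothTransition t| * (t + 1) ≤ C := by
  have hc : Continuous (deriv Real.smoothTransition) :=
    (Real.smoothTransition.contDiff (n := 1)).continuous_deriv le_rfl
  obtain ⟨C, hC⟩ := (isCompact_Icc (a := (0 : ℝ)) (b := 1)).exists_bound_of_continuousOn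
    hc.continuousOn
  have hC0 : 0 ≤ C := (norm_nonneg _).trans (hC 0 (by simp))
  refine ⟨C * 2, by positivity, fun t ht => ?_⟩
  rcases lt_or_ge t 0 with h | h
  · rw [deriv_smoothTransition_of_neg h]; simp; positivity
  rcases lt_or_ge 1 t with h' | h'
  · rw [deriv_smoothTransition_of_gt h']; simp; positivity
  · have := hC t ⟨h, h'⟩
    rw [Real.norm_eq_abs] at this
    gcongr
    linarith

/-- `angF` of the argument, cut off near the origin. -/
noncomputable def cutG (τ δ s : ℝ) (z : ℂ) : ℝ :=
  angF τ δ z.arg * Real.smoothTransition (s * Complex.normSq z - 1)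

/-- The derivative of `cutG` at `z` in the direction `h`. -/
noncomputable def cutG' (τ δ s : ℝ) (z h : ℂ) : ℝ :=
  Real.smoothTransition (s * Complex.normSq z - 1)
      * (angF' τ δ z.arg * ((z.re * h.im - z.im * h.re) / Complex.normSq z))
    + angF τ δ z.arg * (deriv Real.smoothTransition (s * Complex.normSq z - 1)
      * (s * (2 * (z.re * h.re + z.im * h.im))))

theorem eventually_cutG_eq_zero {τ δ s : ℝ} {z : ℂ} (h : s * Complex.normSq z < 1) :
    ∀ᶠ w in 𝓝 z, cutG τ δ s w = 0 := by
  have hc : ContinuousAt (fun w => s * Complex.normSq w) z :=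
    (Complex.continuous_normSq.const_mul s |>.continuousAt)
  filter_upwards [hc.eventually_lt_const h] with w hw
  rw [cutG, Real.smoothTransition.zero_of_nonpos (by linarith), mul_zero]

theorem hasFDerivAt_normSq (z : ℂ) : HasFDerivAt (fun w : ℂ => Complex.normSq w)
    ((2 * z.re) • Complex.reCLM + (2 * z.im) • Complex.imCLM) z := by
  have h1 := Complex.reCLM.hasFDerivAt (x := z)
  have h2 := Complex.imCLM.hasFDerivAt (x := z)
  have h3 := (h1.mul h1).add (h2.mul h2)
  have h4 : (2 * z.re) • Complex.reCLM + (2 * z.im) • Complex.imCLM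
      = (Complex.reCLM z • Complex.reCLM + Complex.reCLM z • Complex.reCLM +
      (Complex.imCLM z • Complex.imCLM + Complex.imCLM z • Complex.imCLM)) := by
    ext <;> simp <;> ring
  rw [h4]
  exact h3

/-- The argument is the imaginary part of the logarithm, whose derivative is multiplication by 1/z.
-/
theorem hasFDerivAt_arg {z : ℂ} (hz : z ∈ Complex.slitPlane) :
    ∃ L : ℂ →L[ℝ] ℝ, HasFDerivAt Complex.arg L z ∧
      ∀ h, L h = (z.re * h.im - z.im * h.re) / Complex.normSq z := by
  have h1 := ((Complex.hasStrictDerivAt_log hz).hasDerivAt.hasFDerivAt).restrictScalars ℝ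
  have h2 := Complex.imCLM.hasFDerivAt.comp z h1
  refine ⟨_, h2.congr_of_eventuallyEq (Eventually.of_forall fun w => (Complex.log_im w).symm), ?_⟩
  intro h
  simp [Complex.inv_re, Complex.inv_im, Complex.mul_im]
  ring

/-- At the origin and on the real axis the function vanishes in a neighbourhood, thanks to the
cutoff and to the profile respectively. Elsewhere the argument is smooth, and the profile is C¹ away
from τ. -/
theorem contDiffAt_cutG {τ δ s : ℝ} (hτ : 0 ≤ τ) (hτπ : τ ≤ Real.pi) (hδ : 0 < δ) {z : ℂ}
    (hz : z ≠ 0 → z.arg ≠ τ) :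
    ContDiffAt ℝ 1 (cutG τ δ s) z ∧ ∀ h, fderiv ℝ (cutG τ δ s) z h = cutG' τ δ s z h := by
  by_cases h0 : z = 0
  · have hev := eventually_cutG_eq_zero (τ := τ) (δ := δ) (s := s) (z := z) (by simp [h0])
    have hev' : cutG τ δ s =ᶠ[𝓝 z] fun _ => 0 := hev
    refine ⟨contDiffAt_const.congr_of_eventuallyEq hev', fun h => ?_⟩
    rw [hev'.fderiv_eq, h0]
    simp [cutG']
  have harg := hz h0
  by_cases him : z.im = 0
  · have hev := eventually_angF_arg_eq_zero hτ hδ h0 him harg hτπ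
    have hev' : cutG τ δ s =ᶠ[𝓝 z] fun _ => 0 := by
      filter_upwards [hev] with w hw
      rw [cutG, hw.1, zero_mul]
    refine ⟨contDiffAt_const.congr_of_eventuallyEq hev', fun h => ?_⟩
    rw [hev'.fderiv_eq, cutG', hev.self_of_nhds.1, hev.self_of_nhds.2]
    simp
  have hs : z ∈ Complex.slitPlane := Or.inr him
  have hargc : ContDiffAt ℝ 1 Complex.arg z := by
    have h1 : ContDiffAt ℝ 1 Complex.log z := (Complex.contDiffAt_log hs).restrict_scalars ℝ
    exact (Complex.imCLM.contDiff.contDiffAt.comp z h1).congr_of_eventuallyEq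
      (Eventually.of_forall fun w => (Complex.log_im w).symm)
  have hnsq : ContDiff ℝ 1 fun w : ℂ => Complex.normSq w := by
    have : (fun w : ℂ => Complex.normSq w)
      = fun w => Complex.reCLM w * Complex.reCLM w + Complex.imCLM w * Complex.imCLM w := rfl
    rw [this]
    exact (Complex.reCLM.contDiff.mul Complex.reCLM.contDiff).add
      (Complex.imCLM.contDiff.mul Complex.imCLM.contDiff)
  refine ⟨((contDiffAt_angF harg).comp z hargc).mul
    (Real.smoothTransition.contDiff.comp ((contDiff_const.mul hnsq).sub
      contDiff_const)).contDiffAt, fun h => ?_⟩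
  obtain ⟨L, hL, hLh⟩ := hasFDerivAt_arg hs
  have h1 := (hasDerivAt_angF (δ := δ) harg).hasFDerivAt.comp z hL
  have h2 : HasFDerivAt (fun w : ℂ => s * Complex.normSq w - 1) _ z :=
    ((hasFDerivAt_normSq z).const_mul s).sub_const 1
  have h3 := ((Real.smoothTransition.contDiff (n := 1)).differentiable one_ne_zero
    (s * Complex.normSq z - 1)).hasDerivAt.hasFDerivAt.comp z h2
  have h4 : fderiv ℝ (cutG τ δ s) z = _ := (h1.mul h3).fderiv
  rw [h4]
  simp only [_root_.add_apply, _root_.smul_apply, smul_eq_mul, ContinuousLinearMap.comp_apply,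
    hLh, Function.comp_apply, cutG', ContinuousLinearMap.toSpanSingleton_apply,
    Complex.reCLM_apply, Complex.imCLM_apply]
  ring

/-! ### Planar flows and their angular field -/

/-- The field `J = v₁ ∇v₂ - v₂ ∇v₁ = |v|² ∇θ`. -/
noncomputable def angularField (v : Plane → Plane) (g : Fin 2 → Fin 2 → Plane → ℝ) (j : Fin 2)
    (x : Plane) : ℝ :=
  v x 0 * g j 1 x - v x 1 * g j 0 x

/-- A continuous divergence free field `v` with weak derivatives `g j i = ∂ⱼ vᵢ`, tangent to the
boundary, whose angular field is divergence free. -/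
structure PlanarFlow (Ω : Opens Plane) (v : Plane → Plane) (g : Fin 2 → Fin 2 → Plane → ℝ) : Prop where
  cont : ContinuousOn v (closure (Ω : Set Plane))
  weak : ∀ j i, HasWeakDeriv Ω (stdVec j) (fun x => v x i) (g j i)
  memLp : ∀ j i R, MemLp (g j i) 2 (volume.restrict ((Ω : Set Plane) ∩ ball 0 R))
  div : ∀ᵐ x ∂(volume.restrict (Ω : Set Plane)), g 0 0 x + g 1 1 x = 0
  angular : ∀ φ, IsTest Ω φ → ∫ x, ∑ j, angularField v g j x * fderiv ℝ φ x (stdVec j) = 0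
  slip : ∀ x ∈ frontier (Ω : Set Plane), v x 1 = 0

namespace PlanarFlow

variable {Ω : Opens Plane} {v : Plane → Plane} {g : Fin 2 → Fin 2 → Plane → ℝ}

theorem continuousOn_apply (h : PlanarFlow Ω v g) (i : Fin 2) :
    ContinuousOn (fun x => v x i) (closure (Ω : Set Plane)) :=
  (EuclideanSpace.proj (𝕜 := ℝ) i).continuous.comp_continuousOn h.cont

theorem continuousOn_cvel (h : PlanarFlow Ω v g) : ContinuousOn (cvel v) (closure (Ω : Set Plane)) := by
  have : cvel v = fun x => Complex.equivRealProdCLM.symm (v x 0, v x 1) := rfl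
  rw [this]
  exact Complex.equivRealProdCLM.symm.continuous.comp_continuousOn
    ((h.continuousOn_apply 0).prodMk (h.continuousOn_apply 1))

theorem exists_bound (h : PlanarFlow Ω v g) (R : ℝ) :
    ∃ C, ∀ x ∈ (Ω : Set Plane) ∩ ball 0 R, ∀ i, ‖v x i‖ ≤ C := by
  have hc : IsCompact (closure (Ω : Set Plane) ∩ closedBall 0 R) :=
    (isCompact_closedBall _ _).inter_left isClosed_closure
  obtain ⟨C, hC⟩ := hc.exists_bound_of_continuousOn (h.cont.mono inter_subset_left)
  exact ⟨C, fun x hx i => (PiLp.norm_apply_le (v x) i).trans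
    (hC x ⟨subset_closure hx.1, ball_subset_closedBall hx.2⟩)⟩

theorem aestronglyMeasurable_apply (h : PlanarFlow Ω v g) (i : Fin 2) :
    AEStronglyMeasurable (fun x => v x i) (volume.restrict (Ω : Set Plane)) :=
  ((h.continuousOn_apply i).mono subset_closure).aestronglyMeasurable Ω.isOpen.measurableSet

theorem aestronglyMeasurable_deriv (h : PlanarFlow Ω v g) (j i : Fin 2) :
    AEStronglyMeasurable (g j i) (volume.restrict (Ω : Set Plane)) := by
  have : (Ω : Set Plane) = ⋃ n : ℕ, (Ω : Set Plane) ∩ ball 0 n := by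
    rw [← inter_iUnion, iUnion_ball_nat, inter_univ]
  rw [this, aestronglyMeasurable_iUnion_iff]
  exact fun n => (h.memLp j i n).1

theorem memLp_angularField (h : PlanarFlow Ω v g) (j : Fin 2) (R : ℝ) :
    MemLp (angularField v g j) 2 (volume.restrict ((Ω : Set Plane) ∩ ball 0 R)) := by
  obtain ⟨C, hC⟩ := h.exists_bound R
  have hm : MeasurableSet ((Ω : Set Plane) ∩ ball 0 R) := (Ω.isOpen.inter isOpen_ball).measurableSet
  have key : ∀ i k, MemLp (fun x => v x i * g j k x) 2
      (volume.restrict ((Ω : Set Plane) ∩ ball 0 R)) := fun i k => by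
    refine (h.memLp j k R).of_le_mul (c := C) ?_ ?_
    · exact ((h.aestronglyMeasurable_apply i).mono_measure
        (Measure.restrict_mono inter_subset_left le_rfl)).mul (h.memLp j k R).1
    · refine (ae_restrict_iff' hm).2 (Eventually.of_forall fun x hx => ?_)
      rw [norm_mul]
      exact mul_le_mul_of_nonneg_right (hC x hx i) (norm_nonneg _)
  exact (key 0 1).sub (key 1 0)

theorem restrict_le_of_isCompact {K : Set Plane} (hK : IsCompact K) (hKΩ : K ⊆ Ω) :
    ∃ R, volume.restrict K ≤ volume.restrict ((Ω : Set Plane) ∩ ball 0 R) := by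
  obtain ⟨R, hR⟩ := hK.isBounded.subset_ball (0 : Plane)
  exact ⟨R, Measure.restrict_mono (subset_inter hKΩ hR) le_rfl⟩

theorem memLp_of_isCompact (h : PlanarFlow Ω v g) (j i : Fin 2) (K : Set Plane) (hK : IsCompact K)
    (hKΩ : K ⊆ Ω) : MemLp (g j i) 2 (volume.restrict K) := by
  obtain ⟨R, hR⟩ := restrict_le_of_isCompact hK hKΩ
  exact (h.memLp j i R).mono_measure hR

theorem weaklyDivFree (h : PlanarFlow Ω v g) : WeaklyDivFree Ω (angularField v g) where
  memLp j K hK hKΩ := by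
    obtain ⟨R, hR⟩ := restrict_le_of_isCompact hK hKΩ
    exact (h.memLp_angularField j R).mono_measure hR
  integral_eq_zero := h.angular

end PlanarFlow

/-! ### The weak equation for the angle, up to the boundary -/

theorem exists_cutoff {S U : Set Plane} (hS : IsCompact S) (hU : IsOpen U) (hSU : S ⊆ U) :
    ∃ ζ, IsTest U ζ ∧ ∀ x ∈ S, ζ =ᶠ[𝓝 x] fun _ => 1 := by
  obtain ⟨K, δ, hK, hKU, hδ, hSK⟩ := exists_compact_closedBall_subset hS hU hSU
  have hint : S ⊆ interior K := fun x hx =>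
    mem_interior_iff_mem_nhds.2 (mem_of_superset (closedBall_mem_nhds x hδ) (hSK x hx))
  obtain ⟨ζ, h1, h2, -⟩ := exists_contMDiffMap_one_nhds_of_subset_interior (n := ⊤)
    (modelWithCornersSelf ℝ Plane) hS.isClosed hint
  have hts : tsupport ζ ⊆ K := closure_minimal (fun x hx => by
    by_contra hxK
    exact hx (h2 x hxK)) hK.isClosed
  refine ⟨ζ, ⟨ζ.contMDiff.contDiff, hK.of_isClosed_subset (isClosed_tsupport _) hts,
    hts.trans hKU⟩, fun x hx => ?_⟩
  exact (eventually_nhdsSet_iff_forall.1 h1) x hx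

theorem measurable_angF (τ δ : ℝ) : Measurable (angF τ δ) := by
  unfold angF
  exact Measurable.ite measurableSet_Iio (by fun_prop) (by fun_prop)

theorem measurable_angF' (τ δ : ℝ) : Measurable (angF' τ δ) := by
  unfold angF'
  exact Measurable.ite measurableSet_Iio (by fun_prop) (by fun_prop)

theorem cutG_eq_zero {τ δ s : ℝ} {z : ℂ}
    (h : s * Complex.normSq z < 1 ∨ (angF τ δ z.arg = 0 ∧ angF' τ δ z.arg = 0)) :
    cutG τ δ s z = 0 ∧ ∀ w, cutG' τ δ s z w = 0 := by
  rcases h with h | h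
  · have h1 : s * Complex.normSq z - 1 < 0 := by linarith
    refine ⟨?_, fun w => ?_⟩
    · rw [cutG, Real.smoothTransition.zero_of_nonpos h1.le, mul_zero]
    · rw [cutG', Real.smoothTransition.zero_of_nonpos h1.le, deriv_smoothTransition_of_neg h1]
      ring
  · refine ⟨?_, fun w => ?_⟩
    · rw [cutG, h.1, zero_mul]
    · rw [cutG', h.1, h.2]; ring

namespace PlanarFlow

variable {Ω : Opens Plane} {v : Plane → Plane} {g : Fin 2 → Fin 2 → Plane → ℝ}

/-- The test function `η` may reach the boundary. The part of its support where the cut-off function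
of the angle is active has compact closure inside the domain, because a boundary velocity is either
small, hence cut off, or horizontal, hence in the zero set of the profile. Multiplying `η` by an
interior cutoff that is 1 there changes nothing. -/
theorem integral_cutG_eq_zero (h : PlanarFlow Ω v g) {τ δ s : ℝ} (hτ : 0 ≤ τ) (hτπ : τ ≤ Real.pi)
    (hδ : 0 < δ)
    (hmiss : ∀ x ∈ closure (Ω : Set Plane), cvel v x ≠ 0 → (cvel v x).arg ≠ τ)
    {η : Plane → ℝ} (hη : ContDiff ℝ 1 η) (hηc : HasCompactSupport η) :
    ∫ x in (Ω : Set Plane), ∑ j, angularField v g j x *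
      (cutG τ δ s (cvel v x) * fderiv ℝ η x (stdVec j)
        + η x * cutG' τ δ s (cvel v x) ⟨g j 0 x, g j 1 x⟩) = 0 := by
  set N : Set Plane := {x | x ∈ (Ω : Set Plane) ∧ x ∈ tsupport η ∧
    1 ≤ s * Complex.normSq (cvel v x) ∧
    ¬ (angF τ δ (cvel v x).arg = 0 ∧ angF' τ δ (cvel v x).arg = 0)} with hN
  have hSη : closure N ⊆ tsupport η :=
    closure_minimal (fun x hx => hx.2.1) (isClosed_tsupport η)
  have hScl : closure N ⊆ closure (Ω : Set Plane) := closure_mono fun x hx => hx.1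
  have hS : IsCompact (closure N) := hηc.isCompact.of_isClosed_subset isClosed_closure hSη
  have hSΩ : closure N ⊆ Ω := by
    intro x hx
    by_contra hxΩ
    have hfr : x ∈ frontier (Ω : Set Plane) := by
      rw [Ω.isOpen.frontier_eq]; exact ⟨hScl hx, hxΩ⟩
    have hcw : Tendsto (cvel v) (𝓝[closure (Ω : Set Plane)] x) (𝓝 (cvel v x)) :=
      h.continuousOn_cvel x (hScl hx)
    have hfreq : ∃ᶠ y in 𝓝[closure (Ω : Set Plane)] x, y ∈ N := by
      have h1 := (mem_closure_iff_frequently.1 hx)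
      rw [frequently_nhdsWithin_iff]
      exact h1.mono fun y hy => ⟨hy, subset_closure hy.1⟩
    rcases lt_or_ge (s * Complex.normSq (cvel v x)) 1 with hlt | hge
    · have hc : Tendsto (fun y => s * Complex.normSq (cvel v y)) (𝓝[closure (Ω : Set Plane)] x)
          (𝓝 (s * Complex.normSq (cvel v x))) :=
        ((Complex.continuous_normSq.tendsto _).comp hcw).const_mul s
      obtain ⟨y, hy, hy'⟩ := (hfreq.and_eventually (hc.eventually_lt_const hlt)).exists
      exact absurd hy.2.2.1 (not_le.2 hy')
    · have h0 : cvel v x ≠ 0 := fun h0 => by simp [h0] at hge; linarith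
      have hev := hcw.eventually (eventually_angF_arg_eq_zero hτ hδ h0 (h.slip x hfr)
        (hmiss x (hScl hx) h0) hτπ)
      obtain ⟨y, hy, hy'⟩ := (hfreq.and_eventually hev).exists
      exact hy.2.2.2 hy'
  obtain ⟨ζ, hζ, hζ1⟩ := exists_cutoff hS Ω.isOpen hSΩ
  have hζ' : ContDiff ℝ 1 ζ := hζ.contDiff.of_le (by simp)
  have hts : tsupport (fun x => η x * ζ x) ⊆ tsupport ζ := tsupport_mul_subset_right
  have hGd := fun x (hx : x ∈ tsupport fun x => η x * ζ x) =>
    contDiffAt_cutG (s := s) hτ hτπ hδ (hmiss x (subset_closure (hζ.tsupport_subset (hts hx))))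
  have key := h.weaklyDivFree.integral_comp_eq_zero Ω.isOpen (h.cont.mono subset_closure) h.weak
    h.memLp_of_isCompact (ψ := fun x => η x * ζ x) (hη.mul hζ') hηc.mul_right
    (hts.trans hζ.tsupport_subset) (fun x hx => (hGd x hx).1)
  rw [← setIntegral_eq_integral_of_forall_compl_eq_zero (s := (Ω : Set Plane))] at key
  · rw [← key]
    refine setIntegral_congr_fun Ω.isOpen.measurableSet fun x hx => ?_
    refine Finset.sum_congr rfl fun j _ => ?_
    congr 1
    -- Near points of `N` the interior cutoff is identically 1; off `N` both integrands vanish.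
    by_cases hxN : x ∈ N
    · have h1 := hζ1 x (subset_closure hxN)
      have h2 : (fun x => η x * ζ x) =ᶠ[𝓝 x] η := by
        filter_upwards [h1] with y hy; rw [hy, mul_one]
      rw [h2.fderiv_eq]
      by_cases hxt : x ∈ tsupport fun x => η x * ζ x
      · rw [(hGd x hxt).2, h1.self_of_nhds]; ring
      · have h3 : η x * ζ x = 0 :=
          image_eq_zero_of_notMem_tsupport (f := fun x => η x * ζ x) hxt
        rw [h1.self_of_nhds, mul_one] at h3
        simp [h3]
    · by_cases hxη : x ∈ tsupport η
      · have h1 : s * Complex.normSq (cvel v x) < 1 ∨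
            (angF τ δ (cvel v x).arg = 0 ∧ angF' τ δ (cvel v x).arg = 0) := by
          by_contra hcon
          push Not at hcon
          exact hxN ⟨hx, hxη, hcon.1, fun hh => hcon.2 hh.1 hh.2⟩
        have h2 := cutG_eq_zero h1
        by_cases hxt : x ∈ tsupport fun x => η x * ζ x
        · rw [(hGd x hxt).2, h2.1, h2.2]; ring
        · rw [h2.1, h2.2,
            image_eq_zero_of_notMem_tsupport (f := fun x => η x * ζ x) hxt]
          ring
      · have h3 : (fun x => η x * ζ x) =ᶠ[𝓝 x] fun _ => 0 := by
          filter_upwards [notMem_tsupport_iff_eventuallyEq.1 hxη] with y hy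
          rw [hy]; simp
        have h4 := notMem_tsupport_iff_eventuallyEq.1 hxη
        rw [h3.fderiv_eq, h4.fderiv_eq, h4.self_of_nhds]
        simp
  · intro x hx
    have hxt : x ∉ tsupport fun x => η x * ζ x := fun hh => hx (hζ.tsupport_subset (hts hh))
    have h3 := notMem_tsupport_iff_eventuallyEq.1 hxt
    rw [Finset.sum_eq_zero]
    intro j _
    rw [h3.fderiv_eq, image_eq_zero_of_notMem_tsupport hxt]
    simp

end PlanarFlow

/-- A majorant independent of the cutoff parameter. With J = v × ∂v and K = v · ∂v one has J² + K² =
|v|²|∂v|², so J²/|v|² ≤ |∂v|² and 2|JK| ≤ |v|²|∂v|². In the term where the cutoff is differentiated,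
the factor s|v|² is absorbed by `hd`. -/
theorem abs_cutoff_term_le {a b p q F F' χ d s η e A B C : ℝ} (hF : |F| ≤ A) (hF0 : 0 ≤ F')
    (hFB : F' ≤ B) (hχ0 : 0 ≤ χ) (hχ1 : χ ≤ 1) (hs : 0 ≤ s) (hd : |d| * (s * (a * a + b * b)) ≤ C) :
    |(a * q - b * p) * (F * χ * e + η * (χ * (F' * ((a * q - b * p) / (a * a + b * b)))
      + F * (d * (s * (2 * (a * p + b * q))))))|
      ≤ A * |(a * q - b * p) * e| + |η| * ((B + A * C) * (p ^ 2 + q ^ 2)) := by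
  set J := a * q - b * p with hJ
  set K := a * p + b * q with hK
  set n := a * a + b * b with hn
  have hn0 : 0 ≤ n := add_nonneg (mul_self_nonneg _) (mul_self_nonneg _)
  have hA : 0 ≤ A := (abs_nonneg _).trans hF
  have hB : 0 ≤ B := hF0.trans hFB
  have hJK : J ^ 2 + K ^ 2 = n * (p ^ 2 + q ^ 2) := by rw [hJ, hK, hn]; ring
  have h1 : J * (J / n) ≤ p ^ 2 + q ^ 2 := by
    rcases hn0.eq_or_lt with h0 | h0
    · rw [← h0]; simp; positivity
    · rw [← mul_div_assoc, div_le_iff₀ h0]; nlinarith [sq_nonneg K]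
  have h1' : 0 ≤ J * (J / n) := by
    rw [← mul_div_assoc]; exact div_nonneg (mul_self_nonneg _) hn0
  have h2 : 2 * |J * K| ≤ n * (p ^ 2 + q ^ 2) := by
    rw [abs_mul, ← hJK, ← sq_abs J, ← sq_abs K]; nlinarith [sq_nonneg (|J| - |K|)]
  have e1 : |χ * (F * (J * e))| ≤ A * |J * e| := by
    rw [abs_mul, abs_mul, abs_of_nonneg hχ0]
    calc χ * (|F| * |J * e|) ≤ 1 * (A * |J * e|) := by gcongr
      _ = _ := one_mul _
  have e2 : |η * (χ * (F' * (J * (J / n))))| ≤ |η| * (B * (p ^ 2 + q ^ 2)) := by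
    rw [abs_mul, abs_of_nonneg (by positivity : 0 ≤ χ * (F' * (J * (J / n))))]
    refine mul_le_mul_of_nonneg_left ?_ (abs_nonneg _)
    calc χ * (F' * (J * (J / n))) ≤ 1 * (B * (p ^ 2 + q ^ 2)) := by gcongr
      _ = _ := one_mul _
  have e3 : |η * (F * (d * s * (2 * (J * K))))| ≤ |η| * (A * C * (p ^ 2 + q ^ 2)) := by
    rw [abs_mul, abs_mul]
    have h4 : |d * s * (2 * (J * K))| ≤ C * (p ^ 2 + q ^ 2) := by
      rw [abs_mul, abs_mul, abs_of_nonneg hs, abs_mul 2, abs_two]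
      calc |d| * s * (2 * |J * K|) ≤ |d| * s * (n * (p ^ 2 + q ^ 2)) := by gcongr
        _ = |d| * (s * n) * (p ^ 2 + q ^ 2) := by ring
        _ ≤ C * (p ^ 2 + q ^ 2) := by gcongr
    calc |η| * (|F| * |d * s * (2 * (J * K))|) ≤ |η| * (A * (C * (p ^ 2 + q ^ 2))) := by gcongr
      _ = _ := by ring
  have hsplit : J * (F * χ * e + η * (χ * (F' * (J / n)) + F * (d * (s * (2 * K)))))
      = χ * (F * (J * e)) + η * (χ * (F' * (J * (J / n)))) + η * (F * (d * s * (2 * (J * K)))) := by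
    ring
  rw [hsplit]
  calc _ ≤ |χ * (F * (J * e))| + |η * (χ * (F' * (J * (J / n))))|
        + |η * (F * (d * s * (2 * (J * K))))| := abs_add_three _ _ _
    _ ≤ A * |J * e| + |η| * (B * (p ^ 2 + q ^ 2)) + |η| * (A * C * (p ^ 2 + q ^ 2)) := by gcongr
    _ = _ := by ring

theorem integrable_mul_of_tsupport {Ω : Opens Plane} {f c : Plane → ℝ} {R : ℝ}
    (hf : IntegrableOn f ((Ω : Set Plane) ∩ ball 0 R)) (hc : Continuous c)
    (hcs : tsupport c ⊆ ball 0 R) : IntegrableOn (fun x => c x * f x) (Ω : Set Plane) := by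
  have hcc : HasCompactSupport c := (isCompact_closedBall (0 : Plane) R).of_isClosed_subset
    (isClosed_tsupport _) (hcs.trans ball_subset_closedBall)
  obtain ⟨C, hC⟩ := hc.bounded_above_of_compact_support hcc
  have h1 : IntegrableOn (fun x => c x * f x) ((Ω : Set Plane) ∩ ball 0 R) :=
    Integrable.bdd_mul hf hc.aestronglyMeasurable (Eventually.of_forall hC)
  refine h1.of_forall_sdiff_eq_zero Ω.isOpen.measurableSet fun x hx => ?_
  have : x ∉ tsupport c := fun h => hx.2 ⟨hx.1, hcs h⟩
  rw [image_eq_zero_of_notMem_tsupport this, zero_mul]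

theorem normSq_cvel (v : Plane → Plane) (x : Plane) :
    Complex.normSq (cvel v x) = v x 0 * v x 0 + v x 1 * v x 1 := rfl

theorem integral_le_of_le_add {μ : Measure Plane} {X Y E : Plane → ℝ} {c : ℝ}
    (hX : Integrable X μ) (hY : Integrable Y μ) (hE : Integrable E μ)
    (h : ∀ x, X x ≤ Y x + (1 / 2 * X x + c * E x)) (h0 : ∫ x, Y x ∂μ = 0) :
    ∫ x, X x ∂μ ≤ 2 * c * ∫ x, E x ∂μ := by
  have h1 : Integrable (fun x => 1 / 2 * X x) μ := hX.const_mul _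
  have h2 : Integrable (fun x => c * E x) μ := hE.const_mul _
  have h3 : Integrable (fun x => 1 / 2 * X x + c * E x) μ := h1.add h2
  have hint := integral_mono hX (hY.add h3) h
  simp only [Pi.add_apply] at hint
  rw [integral_add hY h3, h0, integral_add h1 h2, integral_const_mul, integral_const_mul] at hint
  linarith

namespace PlanarFlow

variable {Ω : Opens Plane} {v : Plane → Plane} {g : Fin 2 → Fin 2 → Plane → ℝ}

theorem aemeasurable_cvel (h : PlanarFlow Ω v g) :
    AEMeasurable (cvel v) (volume.restrict (Ω : Set Plane)) :=
  ((h.continuousOn_cvel.mono subset_closure).aestronglyMeasurable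
    Ω.isOpen.measurableSet).aemeasurable

theorem aemeasurable_angularField (h : PlanarFlow Ω v g) (j : Fin 2) :
    AEMeasurable (angularField v g j) (volume.restrict (Ω : Set Plane)) :=
  ((h.aestronglyMeasurable_apply 0).mul (h.aestronglyMeasurable_deriv j 1)).sub
    ((h.aestronglyMeasurable_apply 1).mul (h.aestronglyMeasurable_deriv j 0)) |>.aemeasurable

theorem integrable_angularField_mul (h : PlanarFlow Ω v g) (j : Fin 2) {c : Plane → ℝ}
    (hc : Continuous c) (hcc : HasCompactSupport c) :
    Integrable (fun x => angularField v g j x * c x) (volume.restrict (Ω : Set Plane)) := by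
  obtain ⟨R, hR⟩ := hcc.isCompact.isBounded.subset_ball (0 : Plane)
  have : IsFiniteMeasure (volume.restrict ((Ω : Set Plane) ∩ ball 0 R)) :=
    ⟨by simpa using (measure_mono inter_subset_right).trans_lt measure_ball_lt_top⟩
  have h1 : IntegrableOn (angularField v g j) ((Ω : Set Plane) ∩ ball 0 R) :=
    (h.memLp_angularField j R).integrable (by norm_num)
  simpa only [mul_comm] using! integrable_mul_of_tsupport h1 hc hR

theorem integrable_mul_deriv_sq (h : PlanarFlow Ω v g) (j : Fin 2) {c : Plane → ℝ}
    (hc : Continuous c) (hcc : HasCompactSupport c) :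
    Integrable (fun x => c x * (g j 0 x ^ 2 + g j 1 x ^ 2)) (volume.restrict (Ω : Set Plane)) := by
  obtain ⟨R, hR⟩ := hcc.isCompact.isBounded.subset_ball (0 : Plane)
  have h1 : IntegrableOn (fun x => g j 0 x ^ 2 + g j 1 x ^ 2) ((Ω : Set Plane) ∩ ball 0 R) :=
    ((h.memLp j 0 R).integrable_sq).add ((h.memLp j 1 R).integrable_sq)
  exact integrable_mul_of_tsupport h1 hc hR

/-- The weak form of `div (|v|² ∇θ) = 0`, tested with a function of the angle. -/
theorem integral_angF_eq_zero (h : PlanarFlow Ω v g) {τ δ : ℝ} (hτ : 0 ≤ τ) (hτπ : τ ≤ Real.pi)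
    (hδ : 0 < δ)
    (hmiss : ∀ x ∈ closure (Ω : Set Plane), cvel v x ≠ 0 → (cvel v x).arg ≠ τ)
    {η : Plane → ℝ} (hη : ContDiff ℝ 1 η) (hηc : HasCompactSupport η) :
    ∫ x in (Ω : Set Plane), ∑ j, angularField v g j x *
      (angF τ δ (cvel v x).arg * fderiv ℝ η x (stdVec j) + η x * (angF' τ δ (cvel v x).arg *
        (angularField v g j x / Complex.normSq (cvel v x)))) = 0 := by
  obtain ⟨C, hC0, hC⟩ := exists_deriv_smoothTransition_bound
  have hdη : ∀ j, Continuous fun x => fderiv ℝ η x (stdVec j) := fun j =>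
    (hη.continuous_fderiv one_ne_zero).clm_apply continuous_const
  have hdηc : ∀ j, HasCompactSupport fun x => fderiv ℝ η x (stdVec j) := fun j =>
    (hηc.fderiv ℝ).comp_left (g := fun L : Plane →L[ℝ] ℝ => L (stdVec j)) (by simp)
  set fn : ℕ → Plane → ℝ := fun n x => ∑ j, angularField v g j x *
      (cutG τ δ ((n : ℝ) + 1) (cvel v x) * fderiv ℝ η x (stdVec j)
        + η x * cutG' τ δ ((n : ℝ) + 1) (cvel v x) ⟨g j 0 x, g j 1 x⟩) with hfn
  have hz : ∀ n, ∫ x in (Ω : Set Plane), fn n x = 0 := fun n =>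
    h.integral_cutG_eq_zero hτ hτπ hδ hmiss hη hηc
  have hexp : ∀ n x, fn n x = ∑ j, angularField v g j x *
      (angF τ δ (cvel v x).arg * Real.smoothTransition (((n : ℝ) + 1)
          * Complex.normSq (cvel v x) - 1) * fderiv ℝ η x (stdVec j)
        + η x * (Real.smoothTransition (((n : ℝ) + 1) * Complex.normSq (cvel v x) - 1)
          * (angF' τ δ (cvel v x).arg * (angularField v g j x / Complex.normSq (cvel v x)))
        + angF τ δ (cvel v x).arg * (deriv Real.smoothTransition
          (((n : ℝ) + 1) * Complex.normSq (cvel v x) - 1)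
          * (((n : ℝ) + 1) * (2 * (v x 0 * g j 0 x + v x 1 * g j 1 x)))))) := fun n x => rfl
  set bd : Plane → ℝ := fun x => ∑ j, (Real.pi ^ 2 * |angularField v g j x
      * fderiv ℝ η x (stdVec j)| + |η x| * ((2 * Real.pi + Real.pi ^ 2 * C)
        * (g j 0 x ^ 2 + g j 1 x ^ 2))) with hbd
  have hbdi : Integrable bd (volume.restrict (Ω : Set Plane)) := by
    refine integrable_finsetSum _ fun j _ => ?_
    refine (((h.integrable_angularField_mul j (hdη j) (hdηc j)).abs).const_mul _).add ?_
    have := (h.integrable_mul_deriv_sq j hη.continuous.abs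
      (hηc.comp_left (g := fun t : ℝ => |t|) abs_zero)).const_mul (2 * Real.pi + Real.pi ^ 2 * C)
    refine this.congr (Eventually.of_forall fun x => ?_)
    ring
  have hu := h.aemeasurable_cvel
  have hF : AEMeasurable (fun x => angF τ δ (cvel v x).arg) (volume.restrict (Ω : Set Plane)) :=
    (measurable_angF τ δ).comp_aemeasurable (Complex.measurable_arg.comp_aemeasurable hu)
  have hF' : AEMeasurable (fun x => angF' τ δ (cvel v x).arg) (volume.restrict (Ω : Set Plane)) :=
    (measurable_angF' τ δ).comp_aemeasurable (Complex.measurable_arg.comp_aemeasurable hu)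
  have hN : AEMeasurable (fun x => Complex.normSq (cvel v x)) (volume.restrict (Ω : Set Plane)) :=
    Complex.continuous_normSq.measurable.comp_aemeasurable hu
  have hS : ∀ n : ℕ, AEMeasurable (fun x => Real.smoothTransition (((n : ℝ) + 1)
      * Complex.normSq (cvel v x) - 1)) (volume.restrict (Ω : Set Plane)) := fun n =>
    Real.smoothTransition.continuous.measurable.comp_aemeasurable
      ((hN.const_mul _).sub_const _)
  have hS' : ∀ n : ℕ, AEMeasurable (fun x => deriv Real.smoothTransition (((n : ℝ) + 1)
      * Complex.normSq (cvel v x) - 1)) (volume.restrict (Ω : Set Plane)) := fun n =>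
    (measurable_deriv Real.smoothTransition).comp_aemeasurable
      ((hN.const_mul _).sub_const _)
  have hJ := h.aemeasurable_angularField
  have hv := fun i => (h.aestronglyMeasurable_apply i).aemeasurable
  have hgm := fun j i => (h.aestronglyMeasurable_deriv j i).aemeasurable
  have hηm : AEMeasurable η (volume.restrict (Ω : Set Plane)) := hη.continuous.aemeasurable
  have hdηm : ∀ j, AEMeasurable (fun x => fderiv ℝ η x (stdVec j))
    (volume.restrict (Ω : Set Plane)) := fun j => (hdη j).aemeasurable
  have hmeas : ∀ n, AEStronglyMeasurable (fn n) (volume.restrict (Ω : Set Plane)) := fun n => by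
    refine AEMeasurable.aestronglyMeasurable ?_
    have : fn n = _ := funext (hexp n)
    rw [this]
    refine Finset.aemeasurable_fun_sum _ fun j _ => ?_
    exact (hJ j).mul (((hF.mul (hS n)).mul (hdηm j)).add (hηm.mul (((hS n).mul
      (hF'.mul ((hJ j).div hN))).add (hF.mul ((hS' n).mul
      (((((hv 0).mul (hgm j 0)).add ((hv 1).mul (hgm j 1))).const_mul 2).const_mul _))))))
  -- Let the cutoff parameter n + 1 tend to infinity: the dominating function involves only |∇v|²
  -- and |J|, both integrable on the support of `η`.
  have hlim := tendsto_integral_of_dominated_convergence (μ := volume.restrict (Ω : Set Plane))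
    (F := fn) (f := fun x => ∑ j, angularField v g j x *
      (angF τ δ (cvel v x).arg * fderiv ℝ η x (stdVec j) + η x * (angF' τ δ (cvel v x).arg *
        (angularField v g j x / Complex.normSq (cvel v x))))) bd hmeas hbdi
    (fun n => Eventually.of_forall fun x => ?_) (Eventually.of_forall fun x => ?_)
  · simp only [hz] at hlim
    exact tendsto_nhds_unique tendsto_const_nhds hlim |>.symm
  · rw [hexp, Real.norm_eq_abs]
    refine (Finset.abs_sum_le_sum_abs _ _).trans (Finset.sum_le_sum fun j _ => ?_)
    have harg := Complex.arg_le_pi (cvel v x)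
    have hn0 : (0 : ℝ) ≤ (n : ℝ) + 1 := by positivity
    have hd := hC (((n : ℝ) + 1) * Complex.normSq (cvel v x) - 1)
      (by rw [sub_add_cancel]; exact mul_nonneg hn0 (Complex.normSq_nonneg _))
    rw [sub_add_cancel] at hd
    exact abs_cutoff_term_le (abs_angF_le hτ hδ.le harg) (angF'_nonneg _ _ _)
      (angF'_le hτ hδ.le harg) (Real.smoothTransition.nonneg _) (Real.smoothTransition.le_one _)
      hn0 hd
  -- At a zero of the velocity J vanishes, so nothing is lost; at any other point the cutoff is
  -- eventually 1 with zero derivative.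
  · by_cases h0 : cvel v x = 0
    · have hv0 : v x 0 = 0 := congrArg Complex.re h0
      have hv1 : v x 1 = 0 := congrArg Complex.im h0
      have : ∀ j, angularField v g j x = 0 := fun j => by simp [angularField, hv0, hv1]
      simp [hfn, this]
    · have hpos : 0 < Complex.normSq (cvel v x) := Complex.normSq_pos.2 h0
      have ht : Tendsto (fun n : ℕ => ((n : ℝ) + 1) * Complex.normSq (cvel v x) - 1) atTop atTop :=
        tendsto_atTop_add_const_right _ _ (Tendsto.atTop_mul_const hpos
          (tendsto_atTop_add_const_right _ _ tendsto_natCast_atTop_atTop))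
      refine tendsto_const_nhds.congr' ?_
      filter_upwards [ht.eventually_gt_atTop 1] with n hn
      rw [hexp]
      refine Finset.sum_congr rfl fun j _ => ?_
      rw [Real.smoothTransition.one_of_one_le hn.le, deriv_smoothTransition_of_gt hn]
      ring

/-! ### The Caccioppoli inequality -/

theorem caccioppoli_term {J e η F F' n κ : ℝ} (hn : 0 ≤ n) (hJ : n = 0 → J = 0) (hF' : 0 ≤ F')
    (hκ : 0 ≤ κ) (hF : F ^ 2 ≤ κ * F') :
    -(J * (F * (2 * η * e))) ≤ 1 / 2 * (η ^ 2 * (F' * (J ^ 2 / n))) + 2 * κ * (n * e ^ 2) := by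
  rcases hn.eq_or_lt with h0 | h0
  · rw [hJ h0.symm, ← h0]; simp
  -- Young's inequality in squared form, 4AB ≤ (A + B)², with A and B the two summands on the right;
  -- the hypothesis F² ≤ κF' turns the left side into at most 4AB.
  have key : (2 * (J * η) * F * e) ^ 2 ≤ (1 / 2 * (F' * (J * η) ^ 2 / n) + 2 * κ * (n * e ^ 2)) ^ 2 := by
    have h1 : (2 * (J * η) * F * e) ^ 2 ≤ 4 * ((J * η) ^ 2 * e ^ 2 * (κ * F')) := by
      have : (2 * (J * η) * F * e) ^ 2 = 4 * ((J * η) ^ 2 * e ^ 2 * F ^ 2) := by ring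
      rw [this]; gcongr
    have h2 : 4 * ((J * η) ^ 2 * e ^ 2 * (κ * F'))
        = 4 * ((1 / 2 * (F' * (J * η) ^ 2 / n)) * (2 * κ * (n * e ^ 2))) := by
      field_simp
    rw [h2] at h1
    nlinarith [sq_nonneg (1 / 2 * (F' * (J * η) ^ 2 / n) - 2 * κ * (n * e ^ 2))]
  have h3 := abs_le_of_sq_le_sq key (by positivity)
  have h4 : η ^ 2 * (F' * (J ^ 2 / n)) = F' * (J * η) ^ 2 / n := by ring
  rw [h4]
  calc _ = -(2 * (J * η) * F * e) := by ring
    _ ≤ _ := by linarith [(abs_le.1 h3).1]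

/-- Caccioppoli inequality for the angle. -/
theorem integral_angF'_le (h : PlanarFlow Ω v g) {τ δ : ℝ} (hτ : 0 ≤ τ) (hτπ : τ ≤ Real.pi)
    (hδ : 0 < δ)
    (hmiss : ∀ x ∈ closure (Ω : Set Plane), cvel v x ≠ 0 → (cvel v x).arg ≠ τ)
    {η : Plane → ℝ} (hη : ContDiff ℝ 1 η) (hηc : HasCompactSupport η) :
    (Integrable (fun x => ∑ j, η x ^ 2 * (angF' τ δ (cvel v x).arg *
        (angularField v g j x ^ 2 / Complex.normSq (cvel v x))))
          (volume.restrict (Ω : Set Plane))) ∧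
    ∫ x in (Ω : Set Plane), ∑ j, η x ^ 2 * (angF' τ δ (cvel v x).arg *
        (angularField v g j x ^ 2 / Complex.normSq (cvel v x)))
      ≤ 4 * Real.pi ^ 3 * ∫ x in (Ω : Set Plane), ∑ j, Complex.normSq (cvel v x)
        * fderiv ℝ η x (stdVec j) ^ 2 := by
  have hdη : ∀ j, Continuous fun x => fderiv ℝ η x (stdVec j) := fun j =>
    (hη.continuous_fderiv one_ne_zero).clm_apply continuous_const
  have hdηc : ∀ j, HasCompactSupport fun x => fderiv ℝ η x (stdVec j) := fun j =>
    (hηc.fderiv ℝ).comp_left (g := fun L : Plane →L[ℝ] ℝ => L (stdVec j)) (by simp)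
  have hη2c : HasCompactSupport fun x => η x ^ 2 :=
    hηc.comp_left (g := fun t : ℝ => t ^ 2) (by simp)
  have hu := h.aemeasurable_cvel
  have hF : AEMeasurable (fun x => angF τ δ (cvel v x).arg) (volume.restrict (Ω : Set Plane)) :=
    (measurable_angF τ δ).comp_aemeasurable (Complex.measurable_arg.comp_aemeasurable hu)
  have hF' : AEMeasurable (fun x => angF' τ δ (cvel v x).arg) (volume.restrict (Ω : Set Plane)) :=
    (measurable_angF' τ δ).comp_aemeasurable (Complex.measurable_arg.comp_aemeasurable hu)
  have hN : AEMeasurable (fun x => Complex.normSq (cvel v x)) (volume.restrict (Ω : Set Plane)) :=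
    Complex.continuous_normSq.measurable.comp_aemeasurable hu
  have hJ := h.aemeasurable_angularField
  -- Integrability is needed before half of this term can be absorbed; it follows from |J|² ≤
  -- |v|²|∂v|² and the boundedness of F'.
  have hX : ∀ j, Integrable (fun x => η x ^ 2 * (angF' τ δ (cvel v x).arg *
        (angularField v g j x ^ 2 / Complex.normSq (cvel v x))))
          (volume.restrict (Ω : Set Plane)) := fun j => by
    refine ((h.integrable_mul_deriv_sq j (c := fun x => 2 * Real.pi * η x ^ 2)
      (by have := hη.continuous; fun_prop)
      (hηc.comp_left (g := fun t : ℝ => 2 * Real.pi * t ^ 2) (by simp)))).mono' ?_ ?_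
    · exact ((hη.continuous.aemeasurable.pow_const 2).mul (hF'.mul
        (((hJ j).pow_const 2).div hN))).aestronglyMeasurable
    · refine Eventually.of_forall fun x => ?_
      have h0 := angF'_nonneg τ δ (cvel v x).arg
      have h1 := angF'_le hτ hδ.le (Complex.arg_le_pi (cvel v x))
      have h2 : angularField v g j x ^ 2 / Complex.normSq (cvel v x)
          ≤ g j 0 x ^ 2 + g j 1 x ^ 2 := by
        refine div_le_of_le_mul₀ (Complex.normSq_nonneg _) (by positivity) ?_
        rw [normSq_cvel, angularField]
        have e1 : (v x 0 * g j 1 x - v x 1 * g j 0 x) ^ 2 + (v x 0 * g j 0 x + v x 1 * g j 1 x) ^ 2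
          = (g j 0 x ^ 2 + g j 1 x ^ 2) * (v x 0 * v x 0 + v x 1 * v x 1) := by ring
        linarith [sq_nonneg (v x 0 * g j 0 x + v x 1 * g j 1 x)]
      have h3 : 0 ≤ angularField v g j x ^ 2 / Complex.normSq (cvel v x) :=
        div_nonneg (sq_nonneg _) (Complex.normSq_nonneg _)
      rw [Real.norm_eq_abs, abs_of_nonneg (by positivity)]
      calc _ ≤ η x ^ 2 * (2 * Real.pi * (g j 0 x ^ 2 + g j 1 x ^ 2)) := by gcongr
        _ = _ := by ring
  have hXs := integrable_finsetSum Finset.univ fun j _ => hX j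
  refine ⟨hXs, ?_⟩
  have hE : ∀ j, Integrable (fun x => Complex.normSq (cvel v x) * fderiv ℝ η x (stdVec j) ^ 2)
      (volume.restrict (Ω : Set Plane)) := fun j => by
    obtain ⟨R, hR⟩ := (hdηc j).isCompact.isBounded.subset_ball (0 : Plane)
    have h1 : IntegrableOn (fun x => Complex.normSq (cvel v x)) ((Ω : Set Plane) ∩ ball 0 R) :=
      ((Complex.continuous_normSq.comp_continuousOn (h.continuousOn_cvel.mono
        inter_subset_left)).integrableOn_compact ((isCompact_closedBall (0 : Plane) R).inter_left
          isClosed_closure)).mono_set (inter_subset_inter subset_closure ball_subset_closedBall)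
    have h2 := integrable_mul_of_tsupport h1 (c := fun x => fderiv ℝ η x (stdVec j) ^ 2)
      ((hdη j).pow 2) ((tsupport_comp_subset (g := fun t : ℝ => t ^ 2) (by simp) _).trans hR)
    simpa only [mul_comm] using! h2
  have hEs := integrable_finsetSum Finset.univ fun j _ => hE j
  have h0 := h.integral_angF_eq_zero hτ hτπ hδ hmiss (η := fun x => η x ^ 2) (hη.pow 2) hη2c
  have hpt : ∀ x, ∑ j, η x ^ 2 * (angF' τ δ (cvel v x).arg *
        (angularField v g j x ^ 2 / Complex.normSq (cvel v x)))
      ≤ ∑ j, angularField v g j x *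
      (angF τ δ (cvel v x).arg * fderiv ℝ (fun x => η x ^ 2) x (stdVec j) + η x ^ 2 *
        (angF' τ δ (cvel v x).arg * (angularField v g j x / Complex.normSq (cvel v x))))
      + (1 / 2 * (∑ j, η x ^ 2 * (angF' τ δ (cvel v x).arg *
        (angularField v g j x ^ 2 / Complex.normSq (cvel v x))))
      + 2 * Real.pi ^ 3 * ∑ j, Complex.normSq (cvel v x) * fderiv ℝ η x (stdVec j) ^ 2) := by
    intro x
    rw [Finset.mul_sum, Finset.mul_sum, ← Finset.sum_add_distrib, ← Finset.sum_add_distrib]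
    refine Finset.sum_le_sum fun j _ => ?_
    have hfd : fderiv ℝ (fun x => η x ^ 2) x (stdVec j)
        = 2 * η x * fderiv ℝ η x (stdVec j) := by
      have := ((hη.differentiable one_ne_zero x).hasFDerivAt.pow 2).fderiv
      rw [this]; simp
    have hz : Complex.normSq (cvel v x) = 0 → angularField v g j x = 0 := fun hz => by
      have h1 := Complex.normSq_eq_zero.1 hz
      have hv0 : v x 0 = 0 := congrArg Complex.re h1
      have hv1 : v x 1 = 0 := congrArg Complex.im h1
      simp [angularField, hv0, hv1]
    have := caccioppoli_term (e := fderiv ℝ η x (stdVec j)) (η := η x)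
      (Complex.normSq_nonneg (cvel v x)) hz
      (angF'_nonneg τ δ (cvel v x).arg) (pow_nonneg Real.pi_pos.le 3)
      (angF_sq_le hτ hδ.le (Complex.arg_le_pi (cvel v x)))
    rw [hfd]
    have e1 : angularField v g j x * (η x ^ 2 * (angF' τ δ (cvel v x).arg
      * (angularField v g j x / Complex.normSq (cvel v x))))
      = η x ^ 2 * (angF' τ δ (cvel v x).arg
      * (angularField v g j x ^ 2 / Complex.normSq (cvel v x))) := by ring
    rw [mul_add, e1]
    linarith
  have hYi : Integrable (fun x => ∑ j, angularField v g j x *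
      (angF τ δ (cvel v x).arg * fderiv ℝ (fun x => η x ^ 2) x (stdVec j) + η x ^ 2 *
        (angF' τ δ (cvel v x).arg * (angularField v g j x / Complex.normSq (cvel v x)))))
      (volume.restrict (Ω : Set Plane)) := by
    refine integrable_finsetSum _ fun j _ => ?_
    have hd2 : Continuous fun x => fderiv ℝ (fun x => η x ^ 2) x (stdVec j) :=
      ((hη.pow 2).continuous_fderiv one_ne_zero).clm_apply continuous_const
    have hd2c : HasCompactSupport fun x => fderiv ℝ (fun x => η x ^ 2) x (stdVec j) :=
      (hη2c.fderiv ℝ).comp_left (g := fun L : Plane →L[ℝ] ℝ => L (stdVec j)) (by simp)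
    have h1 := (h.integrable_angularField_mul j hd2 hd2c).bdd_mul (c := Real.pi ^ 2)
      (f := fun x => angF τ δ (cvel v x).arg) hF.aestronglyMeasurable
      (Eventually.of_forall fun x => abs_angF_le hτ hδ.le (Complex.arg_le_pi _))
    refine (h1.add (hX j)).congr (Eventually.of_forall fun x => ?_)
    simp only [Pi.add_apply]
    ring
  -- Absorbing the factor 1/2 doubles the constant 2π³ to 4π³.
  have := integral_le_of_le_add hXs hYi hEs hpt h0
  linarith

end PlanarFlow

/-! ### Slow growth, logarithmic cutoffs and the vanishing of the angular field -/

theorem sq_sum_eq_of_pairwise_mul_eq_zero {ι : Type*} (s : Finset ι) (a : ι → ℝ)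
    (h : ∀ i ∈ s, ∀ j ∈ s, i ≠ j → a i * a j = 0) : (∑ i ∈ s, a i) ^ 2 = ∑ i ∈ s, a i ^ 2 := by
  rw [sq, Finset.sum_mul_sum]
  refine Finset.sum_congr rfl fun i hi => ?_
  rw [Finset.sum_eq_single i (fun j hj hji => h i hi j hj hji.symm) fun hn => absurd hi hn, sq]

/-- The kinetic energy `∫ |v|²` grows at most like `R² log R` in balls of radius `R`. -/
def SlowGrowth (Ω : Opens Plane) (v : Plane → Plane) : Prop :=
  ∃ C : ℝ, ∃ j₀ : ℕ, ∀ j ≥ j₀, ∫ x in (Ω : Set Plane) ∩ ball 0 (2 ^ (j + 1)),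
    Complex.normSq (cvel v x) ≤ C * (4 ^ j * ((j : ℝ) + 1))

/-- A radial cutoff, equal to `1` in the unit ball and supported in the ball of radius `2`. -/
noncomputable def radialBump : ContDiffBump (0 : Plane) := ⟨1, 2, one_pos, one_lt_two⟩

/-- The cutoff `radialBump` at scale `2 ^ j`. -/
noncomputable def dyadicCutoff (j : ℕ) (x : Plane) : ℝ := radialBump (((2 : ℝ) ^ j)⁻¹ • x)

theorem contDiff_dyadicCutoff (j : ℕ) : ContDiff ℝ 1 (dyadicCutoff j) :=
  radialBump.contDiff.comp (contDiff_const_smul _)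

theorem dyadicCutoff_eq_one {j : ℕ} {x : Plane} (h : ‖x‖ ≤ 2 ^ j) : dyadicCutoff j x = 1 := by
  refine radialBump.one_of_mem_closedBall ?_
  rw [mem_closedBall_zero_iff, norm_smul, norm_inv, norm_pow, Real.norm_two]
  rw [inv_mul_le_iff₀ (by positivity)]
  simpa [radialBump] using h

theorem dyadicCutoff_eq_zero {j : ℕ} {x : Plane} (h : 2 ^ (j + 1) ≤ ‖x‖) :
    dyadicCutoff j x = 0 := by
  refine radialBump.zero_of_le_dist ?_
  rw [dist_zero_right, norm_smul, norm_inv, norm_pow, Real.norm_two, le_inv_mul_iff₀ (by positivity)]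
  rw [pow_succ] at h
  exact h

theorem hasCompactSupport_dyadicCutoff (j : ℕ) : HasCompactSupport (dyadicCutoff j) := by
  refine HasCompactSupport.of_support_subset_isCompact
    (isCompact_closedBall (0 : Plane) (2 ^ (j + 1))) fun x hx => ?_
  rw [mem_closedBall_zero_iff]
  by_contra hlt
  exact hx (dyadicCutoff_eq_zero (not_le.1 hlt).le)

theorem fderiv_dyadicCutoff_eq_zero {j : ℕ} {x : Plane}
    (h : ‖x‖ ≤ 2 ^ j ∨ 2 ^ (j + 1) ≤ ‖x‖) : fderiv ℝ (dyadicCutoff j) x = 0 := by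
  rcases h with h | h
  · refine IsLocalMax.fderiv_eq_zero (Eventually.of_forall fun y => ?_)
    rw [dyadicCutoff_eq_one h]
    exact radialBump.le_one
  · refine IsLocalMin.fderiv_eq_zero (Eventually.of_forall fun y => ?_)
    rw [dyadicCutoff_eq_zero h]
    exact radialBump.nonneg

theorem exists_fderiv_dyadicCutoff_bound : ∃ M : ℝ, 0 ≤ M ∧ ∀ j k x,
    fderiv ℝ (dyadicCutoff j) x (stdVec k) ^ 2 ≤ M / 4 ^ j := by
  have hb : ContDiff ℝ 1 (radialBump : Plane → ℝ) := radialBump.contDiff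
  obtain ⟨C, hC⟩ := (hb.continuous_fderiv one_ne_zero).bounded_above_of_compact_support
    (radialBump.hasCompactSupport.fderiv ℝ)
  refine ⟨C ^ 2, sq_nonneg _, fun j k x => ?_⟩
  have h1 : HasFDerivAt (dyadicCutoff j) _ x :=
    (hb.differentiable one_ne_zero (((2 : ℝ) ^ j)⁻¹ • x)).hasFDerivAt.comp x
      ((hasFDerivAt_id x).const_smul (((2 : ℝ) ^ j)⁻¹))
  rw [h1.fderiv]
  have h2 : ‖fderiv ℝ radialBump (((2 : ℝ) ^ j)⁻¹ • x) (stdVec k)‖ ≤ C := by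
    refine (ContinuousLinearMap.le_opNorm _ _).trans ?_
    simpa [stdVec] using hC (((2 : ℝ) ^ j)⁻¹ • x)
  have h3 : (fderiv ℝ radialBump (((2 : ℝ) ^ j)⁻¹ • x) (stdVec k)) ^ 2 ≤ C ^ 2 := by
    rw [← sq_abs]; gcongr; exact h2
  have h4 : (4 : ℝ) ^ j = (2 ^ j) ^ 2 := by rw [← pow_mul, mul_comm, pow_mul]; norm_num
  simp only [ContinuousLinearMap.comp_apply, _root_.smul_apply, ContinuousLinearMap.id_apply,
    map_smul, smul_eq_mul, mul_pow, inv_pow, h4]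
  rw [div_eq_inv_mul]
  gcongr

namespace PlanarFlow

variable {Ω : Opens Plane} {v : Plane → Plane} {g : Fin 2 → Fin 2 → Plane → ℝ}

theorem integrableOn_normSq (h : PlanarFlow Ω v g) (R : ℝ) :
    IntegrableOn (fun x => Complex.normSq (cvel v x)) ((Ω : Set Plane) ∩ ball 0 R) :=
  ((Complex.continuous_normSq.comp_continuousOn (h.continuousOn_cvel.mono
    inter_subset_left)).integrableOn_compact ((isCompact_closedBall (0 : Plane) R).inter_left
      isClosed_closure)).mono_set (inter_subset_inter subset_closure ball_subset_closedBall)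

theorem integrable_normSq_mul_sq (h : PlanarFlow Ω v g) (j : ℕ) (k : Fin 2) :
    Integrable (fun x => Complex.normSq (cvel v x) * fderiv ℝ (dyadicCutoff j) x (stdVec k) ^ 2)
      (volume.restrict (Ω : Set Plane)) := by
  have hc : Continuous fun x => fderiv ℝ (dyadicCutoff j) x (stdVec k) :=
    ((contDiff_dyadicCutoff j).continuous_fderiv one_ne_zero).clm_apply continuous_const
  have hcc : HasCompactSupport fun x => fderiv ℝ (dyadicCutoff j) x (stdVec k) :=
    ((hasCompactSupport_dyadicCutoff j).fderiv ℝ).comp_left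
      (g := fun L : Plane →L[ℝ] ℝ => L (stdVec k)) (by simp)
  obtain ⟨R, hR⟩ := hcc.isCompact.isBounded.subset_ball (0 : Plane)
  have h2 := integrable_mul_of_tsupport (h.integrableOn_normSq R)
    (c := fun x => fderiv ℝ (dyadicCutoff j) x (stdVec k) ^ 2)
    (hc.pow 2) ((tsupport_comp_subset (g := fun t : ℝ => t ^ 2) (by simp) _).trans hR)
  simpa only [mul_comm] using! h2

/-- Average the dyadic cutoffs with weights 1/(j+1), normalised by their sum S. Their gradients live
on disjoint annuli, so squares add without cross terms. The annulus j contributes at most (j+1)⁻² ·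
MC(j+1) before normalisation, so the energy is at most MC/S per direction, and the harmonic sum S
diverges. -/
theorem exists_slow_cutoff (h : PlanarFlow Ω v g) (hs : SlowGrowth Ω v) (m : ℕ) {ε : ℝ}
    (hε : 0 < ε) :
    ∃ η : Plane → ℝ, ContDiff ℝ 1 η ∧ HasCompactSupport η ∧ (∀ x ∈ ball (0 : Plane) m, η x = 1) ∧
      ∫ x in (Ω : Set Plane), ∑ k, Complex.normSq (cvel v x) * fderiv ℝ η x (stdVec k) ^ 2 < ε := by
  obtain ⟨C, j₀, hC⟩ := hs
  obtain ⟨M, hM0, hM⟩ := exists_fderiv_dyadicCutoff_bound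
  -- Starting at `j₀` makes the growth bound available; starting at `m` makes every dyadic cutoff 1
  -- on the ball of radius m, as m ≤ 2 ^ m.
  set a := max j₀ m
  set S : ℕ → ℝ := fun N => ∑ j ∈ Finset.Ico a N, 1 / ((j : ℝ) + 1) with hS
  have hStop : Tendsto S atTop atTop := by
    have h1 := Real.tendsto_sum_range_one_div_nat_succ_atTop
    have h2 := tendsto_atTop_add_const_right atTop
      (-∑ j ∈ Finset.range a, 1 / ((j : ℝ) + 1)) h1
    refine h2.congr' ?_
    filter_upwards [eventually_ge_atTop a] with N hN
    rw [hS]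
    simp only
    rw [Finset.sum_Ico_eq_sub _ hN, sub_eq_add_neg]
  have hlim : Tendsto (fun N => 2 * (M * C) / S N) atTop (𝓝 0) :=
    tendsto_const_nhds.div_atTop hStop
  obtain ⟨N, hN1, hN2⟩ :=
    ((hStop.eventually_gt_atTop 0).and (hlim.eventually_lt_const hε)).exists
  set η : Plane → ℝ := fun x => (S N)⁻¹ * ∑ j ∈ Finset.Ico a N, 1 / ((j : ℝ) + 1) * dyadicCutoff j x
    with hη
  have hηd : ContDiff ℝ 1 η :=
    contDiff_const.mul (ContDiff.sum fun j _ => contDiff_const.mul (contDiff_dyadicCutoff j))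
  have hfd : ∀ x k, fderiv ℝ η x (stdVec k) = (S N)⁻¹ *
      ∑ j ∈ Finset.Ico a N, 1 / ((j : ℝ) + 1) * fderiv ℝ (dyadicCutoff j) x (stdVec k) :=
    fun x k => by
      have h1 : HasFDerivAt η _ x := (HasFDerivAt.fun_sum fun j (_ : j ∈ Finset.Ico a N) =>
        (((contDiff_dyadicCutoff j).differentiable one_ne_zero x).hasFDerivAt.const_mul
          (1 / ((j : ℝ) + 1)))).const_mul (S N)⁻¹
      rw [h1.fderiv]
      simp
  have hsq : ∀ x k, fderiv ℝ η x (stdVec k) ^ 2 = (S N)⁻¹ ^ 2 *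
      ∑ j ∈ Finset.Ico a N, (1 / ((j : ℝ) + 1)) ^ 2
        * fderiv ℝ (dyadicCutoff j) x (stdVec k) ^ 2 := fun x k => by
    rw [hfd, mul_pow, sq_sum_eq_of_pairwise_mul_eq_zero]
    · simp only [mul_pow]
    · intro i hi j hj hij
      clear hi hj
      suffices h0 : fderiv ℝ (dyadicCutoff i) x = 0 ∨ fderiv ℝ (dyadicCutoff j) x = 0 by
        rcases h0 with h0 | h0 <;> simp [h0]
      -- For i < j, the inner cutoff is already 0 where the outer one begins to vary.
      wlog hlt : i < j generalizing i j
      · exact (this j i hij.symm (lt_of_le_of_ne (not_lt.1 hlt) hij.symm)).symm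
      rcases le_or_gt (2 ^ (i + 1)) ‖x‖ with hx | hx
      · exact Or.inl (fderiv_dyadicCutoff_eq_zero (Or.inr hx))
      · refine Or.inr (fderiv_dyadicCutoff_eq_zero (Or.inl (hx.le.trans ?_)))
        exact pow_le_pow_right₀ one_le_two hlt
  refine ⟨η, hηd, ?_, fun x hx => ?_, ?_⟩
  · refine HasCompactSupport.of_support_subset_isCompact
      (isCompact_closedBall (0 : Plane) (2 ^ N)) fun x hx => ?_
    rw [mem_closedBall_zero_iff]
    by_contra hlt
    refine hx ?_
    rw [hη]
    simp only
    rw [Finset.sum_eq_zero, mul_zero]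
    intro j hj
    rw [dyadicCutoff_eq_zero, mul_zero]
    refine le_trans ?_ (not_le.1 hlt).le
    exact pow_le_pow_right₀ one_le_two (Finset.mem_Ico.1 hj).2
  · rw [hη]
    simp only
    have : ∀ j ∈ Finset.Ico a N, 1 / ((j : ℝ) + 1) * dyadicCutoff j x = 1 / ((j : ℝ) + 1) := by
      intro j hj
      rw [dyadicCutoff_eq_one, mul_one]
      have h1 : ‖x‖ < m := mem_ball_zero_iff.1 hx
      have h2 : (m : ℝ) ≤ 2 ^ j := by
        have : m ≤ j := (le_max_right _ _).trans (Finset.mem_Ico.1 hj).1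
        calc (m : ℝ) ≤ j := by exact_mod_cast this
          _ ≤ 2 ^ j := by exact_mod_cast Nat.lt_two_pow_self.le
      linarith
    rw [Finset.sum_congr rfl this]
    exact inv_mul_cancel₀ hN1.ne'
  · refine lt_of_le_of_lt ?_ hN2
    have hone : ∀ j ∈ Finset.Ico a N, ∀ k, ∫ x in (Ω : Set Plane), Complex.normSq (cvel v x)
        * fderiv ℝ (dyadicCutoff j) x (stdVec k) ^ 2 ≤ M * C * ((j : ℝ) + 1) := fun j hj k => by
      have hj0 : j₀ ≤ j := (le_max_left _ _).trans (Finset.mem_Ico.1 hj).1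
      have h1 : ∫ x in (Ω : Set Plane), Complex.normSq (cvel v x)
          * fderiv ℝ (dyadicCutoff j) x (stdVec k) ^ 2
          = ∫ x in (Ω : Set Plane) ∩ ball 0 (2 ^ (j + 1)), Complex.normSq (cvel v x)
          * fderiv ℝ (dyadicCutoff j) x (stdVec k) ^ 2 := by
        refine setIntegral_eq_of_subset_of_forall_sdiff_eq_zero Ω.isOpen.measurableSet
          inter_subset_left fun x hx => ?_
        have : 2 ^ (j + 1) ≤ ‖x‖ := by
          by_contra hlt
          exact hx.2 ⟨hx.1, mem_ball_zero_iff.2 (not_le.1 hlt)⟩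
        rw [fderiv_dyadicCutoff_eq_zero (Or.inr this)]; simp
      rw [h1]
      have h2 := (h.integrableOn_normSq (2 ^ (j + 1))).mul_const (M / 4 ^ j)
      calc _ ≤ ∫ x in (Ω : Set Plane) ∩ ball 0 (2 ^ (j + 1)),
            Complex.normSq (cvel v x) * (M / 4 ^ j) := by
            refine integral_mono ((h.integrable_normSq_mul_sq j k).mono_measure
              (Measure.restrict_mono inter_subset_left le_rfl)) h2 fun x => ?_
            exact mul_le_mul_of_nonneg_left (hM j k x) (Complex.normSq_nonneg _)
        _ = (∫ x in (Ω : Set Plane) ∩ ball 0 (2 ^ (j + 1)), Complex.normSq (cvel v x))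
              * (M / 4 ^ j) := integral_mul_const _ _
        _ ≤ C * (4 ^ j * ((j : ℝ) + 1)) * (M / 4 ^ j) := by gcongr; exact hC j hj0
        _ = M * C * ((j : ℝ) + 1) := by field_simp
    have hsum : ∀ k, ∫ x in (Ω : Set Plane), Complex.normSq (cvel v x)
        * fderiv ℝ η x (stdVec k) ^ 2 = (S N)⁻¹ ^ 2 * ∑ j ∈ Finset.Ico a N,
          (1 / ((j : ℝ) + 1)) ^ 2 * ∫ x in (Ω : Set Plane), Complex.normSq (cvel v x)
        * fderiv ℝ (dyadicCutoff j) x (stdVec k) ^ 2 := fun k => by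
      simp only [← integral_const_mul]
      rw [← integral_finsetSum, ← integral_const_mul]
      · refine integral_congr_ae (Eventually.of_forall fun x => ?_)
        simp only
        rw [hsq, ← mul_assoc, mul_comm (Complex.normSq _), mul_assoc, Finset.mul_sum]
        congr 1
        exact Finset.sum_congr rfl fun j _ => by ring
      · exact fun j _ => (h.integrable_normSq_mul_sq j k).const_mul _
    have hle : ∀ k, ∫ x in (Ω : Set Plane), Complex.normSq (cvel v x)
        * fderiv ℝ η x (stdVec k) ^ 2 ≤ M * C / S N := fun k => by
      rw [hsum]
      calc _ ≤ (S N)⁻¹ ^ 2 * ∑ j ∈ Finset.Ico a N,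
          (1 / ((j : ℝ) + 1)) ^ 2 * (M * C * ((j : ℝ) + 1)) := by
            gcongr with j hj
            exact hone j hj k
        _ = (S N)⁻¹ ^ 2 * (M * C * S N) := by
            congr 1
            rw [hS, Finset.mul_sum]
            refine Finset.sum_congr rfl fun j _ => ?_
            have : (j : ℝ) + 1 ≠ 0 := by positivity
            field_simp
        _ = M * C / S N := by field_simp
    have hint : ∀ k, Integrable (fun x => Complex.normSq (cvel v x)
        * fderiv ℝ η x (stdVec k) ^ 2) (volume.restrict (Ω : Set Plane)) := fun k => by
      have h1 := (integrable_finsetSum (Finset.Ico a N) fun j _ =>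
        ((h.integrable_normSq_mul_sq j k).const_mul ((1 / ((j : ℝ) + 1)) ^ 2))).const_mul
          ((S N)⁻¹ ^ 2)
      refine h1.congr (Eventually.of_forall fun x => ?_)
      simp only [hsq, Finset.mul_sum]
      exact Finset.sum_congr rfl fun j _ => by ring
    rw [integral_finsetSum _ fun k _ => hint k, Fin.sum_univ_two]
    calc _ ≤ M * C / S N + M * C / S N := add_le_add (hle 0) (hle 1)
      _ = _ := by ring

/-- If the angle `τ` is not attained, the angular field vanishes where `v₂ > 0`. -/
theorem angularField_ae_eq_zero (h : PlanarFlow Ω v g) (hs : SlowGrowth Ω v) {τ : ℝ}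
    (hτ : 0 ≤ τ) (hτπ : τ ≤ Real.pi)
    (hmiss : ∀ x ∈ closure (Ω : Set Plane), cvel v x ≠ 0 → (cvel v x).arg ≠ τ) :
    ∀ᵐ x ∂(volume.restrict (Ω : Set Plane)), 0 < v x 1 → ∀ j, angularField v g j x = 0 := by
  have key : ∀ k m : ℕ, ∀ᵐ x ∂(volume.restrict (Ω : Set Plane)), x ∈ ball (0 : Plane) m →
      ∑ j, angF' τ (1 / ((k : ℝ) + 1)) (cvel v x).arg *
        (angularField v g j x ^ 2 / Complex.normSq (cvel v x)) = 0 := by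
    intro k m
    set δ : ℝ := 1 / ((k : ℝ) + 1) with hδdef
    have hδ : 0 < δ := by positivity
    set X : Plane → ℝ := fun x => ∑ j, angF' τ δ (cvel v x).arg *
        (angularField v g j x ^ 2 / Complex.normSq (cvel v x)) with hX
    have hX0 : ∀ x, 0 ≤ X x := fun x => Finset.sum_nonneg fun j _ =>
      mul_nonneg (angF'_nonneg _ _ _) (div_nonneg (sq_nonneg _) (Complex.normSq_nonneg _))
    have hbound : ∀ ε > 0, IntegrableOn X ((Ω : Set Plane) ∩ ball 0 m) ∧
        ∫ x in (Ω : Set Plane) ∩ ball 0 m, X x ≤ 4 * Real.pi ^ 3 * ε := fun ε hε => by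
      obtain ⟨η, h1, h2, h3, h4⟩ := h.exists_slow_cutoff hs m hε
      obtain ⟨h5, h6⟩ := h.integral_angF'_le hτ hτπ hδ hmiss h1 h2
      have hm : MeasurableSet ((Ω : Set Plane) ∩ ball 0 m) :=
        (Ω.isOpen.inter isOpen_ball).measurableSet
      simp only [← Finset.mul_sum] at h5 h6
      have h7 : ∀ x ∈ (Ω : Set Plane) ∩ ball 0 m, η x ^ 2 * X x = X x := fun x hx => by
        rw [h3 x hx.2]; ring
      have h8 : X = fun x => angF' τ δ (cvel v x).arg * ∑ j,
          (angularField v g j x ^ 2 / Complex.normSq (cvel v x)) := by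
        ext x; rw [hX, Finset.mul_sum]
      simp only [h8] at h7
      have h5' := h5.mono_measure
        (Measure.restrict_mono (inter_subset_left (t := ball (0 : Plane) m)) le_rfl)
      refine ⟨?_, ?_⟩
      · rw [h8]
        exact (integrableOn_congr_fun h7 hm).1 h5'
      · rw [h8, ← setIntegral_congr_fun hm h7]
        refine (setIntegral_mono_set h5 (Eventually.of_forall fun x => ?_)
          (Eventually.of_forall inter_subset_left)).trans (h6.trans ?_)
        · exact mul_nonneg (sq_nonneg _) (by have := hX0 x; rwa [h8] at this)
        · simp only [Finset.mul_sum]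
          exact mul_le_mul_of_nonneg_left h4.le (by positivity)
    have hzero : ∫ x in (Ω : Set Plane) ∩ ball 0 m, X x = 0 := by
      refine le_antisymm ?_ (integral_nonneg hX0)
      refine le_of_forall_pos_le_add fun ε hε => ?_
      have := (hbound (ε / (4 * Real.pi ^ 3)) (by positivity)).2
      rw [mul_div_cancel₀ _ (by positivity)] at this
      linarith
    -- The Caccioppoli bound is arbitrarily small while the integrand on the fixed ball is
    -- nonnegative and unchanged, so it vanishes almost everywhere.
    have h9 := (integral_eq_zero_iff_of_nonneg hX0 (hbound 1 one_pos).1).1 hzero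
    rw [inter_comm, ← Measure.restrict_restrict measurableSet_ball] at h9
    exact (ae_restrict_iff' measurableSet_ball).1 h9
  filter_upwards [ae_all_iff.2 fun k => ae_all_iff.2 fun m => key k m] with x hx hpos j
  have hnsq : 0 < Complex.normSq (cvel v x) := by
    rw [normSq_cvel]; nlinarith [mul_self_nonneg (v x 0)]
  have harg0 : 0 < (cvel v x).arg := by
    refine lt_of_le_of_ne (Complex.arg_nonneg_iff.2 hpos.le) fun h0 => ?_
    exact hpos.ne' (Complex.arg_eq_zero_iff.1 h0.symm).2
  have hargπ : (cvel v x).arg < Real.pi :=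
    lt_of_le_of_ne (Complex.arg_le_pi _) fun h0 => hpos.ne' (Complex.arg_eq_pi_iff.1 h0).2
  -- An upward velocity has argument strictly between δ and π − δ once δ = 1/(k+1) is small, and
  -- there F' > 0 forces J = 0.
  obtain ⟨k, hk⟩ := exists_nat_one_div_lt (lt_min harg0 (sub_pos.2 hargπ))
  obtain ⟨m, hm⟩ := exists_nat_gt ‖x‖
  have h0 := hx k m (mem_ball_zero_iff.2 hm)
  have hF : 0 < angF' τ (1 / ((k : ℝ) + 1)) (cvel v x).arg :=
    angF'_pos (hk.trans_le (min_le_left _ _)) (by linarith [hk.trans_le (min_le_right _ _)])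
  have h1 := (Finset.sum_eq_zero_iff_of_nonneg fun j _ =>
    mul_nonneg hF.le (div_nonneg (sq_nonneg _) hnsq.le)).1 h0 j (Finset.mem_univ j)
  rcases mul_eq_zero.1 h1 with h2 | h2
  · exact absurd h2 hF.ne'
  · rcases div_eq_zero_iff.1 h2 with h3 | h3
    · exact pow_eq_zero_iff (two_ne_zero) |>.1 h3
    · exact absurd h3 hnsq.ne'

end PlanarFlow

/-! ### Straight streamlines where the angular field vanishes -/

theorem HasWeakDeriv.smul_zero {U : Set Plane} {e : Plane} {f : Plane → ℝ}
    (h : HasWeakDeriv U e f 0) (a : ℝ) : HasWeakDeriv U (a • e) f 0 := fun φ hφ => by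
  have := h φ hφ
  simp only [Pi.zero_apply, zero_mul, integral_zero, neg_zero] at this ⊢
  simp only [map_smul, smul_eq_mul, mul_left_comm _ a]
  rw [integral_const_mul, this, mul_zero]

theorem integrable_mul_fderiv {U : Set Plane} {f φ : Plane → ℝ} (hf : ContinuousOn f U)
    (hφ : IsTest U φ) (e : Plane) : Integrable fun x => f x * fderiv ℝ φ x e := by
  have hc : Continuous fun x => fderiv ℝ φ x e :=
    (hφ.contDiff.continuous_fderiv (by simp)).clm_apply continuous_const
  have h1 : IntegrableOn (fun x => f x * fderiv ℝ φ x e) (tsupport φ) :=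
    ((hf.mono hφ.tsupport_subset).mul hc.continuousOn).integrableOn_compact
      hφ.hasCompactSupport.isCompact
  refine (integrableOn_iff_integrable_of_support_subset fun x hx => ?_).1 h1
  by_contra hxt
  refine hx ?_
  have : fderiv ℝ φ x = 0 := by
    by_contra hne
    exact hxt (support_fderiv_subset ℝ hne)
  simp [this]

theorem eq_stdVec_combination (d : Plane) : d = d 0 • stdVec 0 + d 1 • stdVec 1 := by
  ext i
  fin_cases i <;> simp [stdVec]

theorem HasWeakDeriv.of_stdVec {U : Set Plane} {f : Plane → ℝ} (hf : ContinuousOn f U)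
    (h : ∀ j, HasWeakDeriv U (stdVec j) f 0) (d : Plane) : HasWeakDeriv U d f 0 := fun φ hφ => by
  have h0 := h 0 φ hφ
  have h1 := h 1 φ hφ
  simp only [Pi.zero_apply, zero_mul, integral_zero, neg_zero] at h0 h1 ⊢
  have : ∀ x, f x * fderiv ℝ φ x d = d 0 * (f x * fderiv ℝ φ x (stdVec 0))
      + d 1 * (f x * fderiv ℝ φ x (stdVec 1)) := fun x => by
    conv_lhs => rw [eq_stdVec_combination d]
    rw [map_add, map_smul, map_smul, smul_eq_mul, smul_eq_mul]; ring
  simp only [this]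
  rw [integral_add ((integrable_mul_fderiv hf hφ _).const_mul _)
    ((integrable_mul_fderiv hf hφ _).const_mul _), integral_const_mul, integral_const_mul, h0, h1]
  simp

/-- With a coordinate field in the role of `A`, `WeaklyDivFree.integral_comp_eq_zero` becomes the
weak chain rule for a function of the velocity. -/
theorem weaklyDivFree_const (U : Set Plane) (l : Fin 2) :
    WeaklyDivFree U fun j _ => if j = l then 1 else 0 where
  memLp j K hK _ := by
    have : IsFiniteMeasure (volume.restrict K) := ⟨by simpa using hK.measure_lt_top⟩
    exact memLp_const _
  integral_eq_zero φ hφ := by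
    have hφ1 : ContDiff ℝ 1 φ := hφ.contDiff.of_le (by simp)
    have hd : Continuous fun x => fderiv ℝ φ x (stdVec l) :=
      (hφ1.continuous_fderiv one_ne_zero).clm_apply continuous_const
    have hdc : HasCompactSupport fun x => fderiv ℝ φ x (stdVec l) :=
      (hφ.hasCompactSupport.fderiv ℝ).comp_left (g := fun L : Plane →L[ℝ] ℝ => L (stdVec l))
        (by simp)
    have := integral_mul_fderiv_eq_neg_fderiv_mul_of_integrable (μ := (volume : Measure Plane))
      (f := φ) (g := fun _ => (1 : ℝ)) (v := stdVec l)
      (by simpa using hd.integrable_of_hasCompactSupport hdc) (by simp)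
      (by simpa using hφ1.continuous.integrable_of_hasCompactSupport hφ.hasCompactSupport)
      (fun x _ => hφ1.differentiable one_ne_zero x) (fun x _ => differentiableAt_const _)
    simpa using this

theorem hasFDerivAt_re_div_im {z : ℂ} (hz : z.im ≠ 0) :
    ∃ L : ℂ →L[ℝ] ℝ, HasFDerivAt (fun w : ℂ => w.re / w.im) L z ∧
      ∀ h, L h = -(z.re * h.im - z.im * h.re) / z.im ^ 2 := by
  have h1 := (Complex.reCLM.hasFDerivAt (x := z)).mul
    ((hasDerivAt_inv hz).comp_hasFDerivAt z (Complex.imCLM.hasFDerivAt (x := z)))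
  refine ⟨_, h1, fun h => ?_⟩
  simp
  field_simp
  ring

namespace PlanarFlow

variable {Ω : Opens Plane} {v : Plane → Plane} {g : Fin 2 → Fin 2 → Plane → ℝ}

/-- By the chain rule, the derivative of v₁/v₂ is −J/v₂², which is zero almost everywhere on this
set. -/
theorem hasWeakDeriv_ratio (h : PlanarFlow Ω v g)
    (hJ : ∀ᵐ x ∂(volume.restrict (Ω : Set Plane)), 0 < v x 1 → ∀ j, angularField v g j x = 0)
    (l : Fin 2) :
    HasWeakDeriv {x | x ∈ Ω ∧ 0 < v x 1} (stdVec l) (fun x => v x 0 / v x 1) 0 := by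
  intro φ hφ
  have hφ1 : ContDiff ℝ 1 φ := hφ.contDiff.of_le (by simp)
  have hφΩ : tsupport φ ⊆ Ω := fun x hx => (hφ.tsupport_subset hx).1
  have hpos : ∀ x ∈ tsupport φ, (cvel v x).im ≠ 0 := fun x hx => (hφ.tsupport_subset hx).2.ne'
  have key := (weaklyDivFree_const Ω l).integral_comp_eq_zero Ω.isOpen
    (h.cont.mono subset_closure) h.weak h.memLp_of_isCompact hφ1 hφ.hasCompactSupport hφΩ
    (G := fun w : ℂ => w.re / w.im) (fun x hx =>
      Complex.reCLM.contDiff.contDiffAt.div Complex.imCLM.contDiff.contDiffAt (hpos x hx))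
  simp only [ite_mul, one_mul, zero_mul, Finset.sum_ite_eq', Finset.mem_univ, if_true] at key
  simp only [Pi.zero_apply, zero_mul, integral_zero, neg_zero]
  rw [← key]
  refine integral_congr_ae ?_
  filter_upwards [(ae_restrict_iff' Ω.isOpen.measurableSet).1 hJ] with x hx
  have : φ x * fderiv ℝ (fun w : ℂ => w.re / w.im) (cvel v x) ⟨g l 0 x, g l 1 x⟩ = 0 := by
    by_cases hxt : x ∈ tsupport φ
    · obtain ⟨L, hL, hLh⟩ := hasFDerivAt_re_div_im (hpos x hxt)
      rw [hL.fderiv, hLh]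
      have h0 := hx (hφΩ hxt) (hφ.tsupport_subset hxt).2 l
      have h1 : (cvel v x).re * g l 1 x - (cvel v x).im * g l 0 x = 0 := h0
      simp only [h1]; simp
    · rw [image_eq_zero_of_notMem_tsupport hxt, zero_mul]
  rw [this, add_zero]
  rfl

theorem isOpen_pos (h : PlanarFlow Ω v g) : IsOpen {x | x ∈ Ω ∧ 0 < v x 1} :=
  ((h.continuousOn_apply 1).mono subset_closure).isOpen_inter_preimage Ω.isOpen isOpen_Ioi

/-- Where `v₂ > 0`, the velocity is constant along the (straight) streamlines. -/
theorem eventually_eq_along_line (h : PlanarFlow Ω v g)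
    (hJ : ∀ᵐ x ∂(volume.restrict (Ω : Set Plane)), 0 < v x 1 → ∀ j, angularField v g j x = 0)
    {y : Plane} (hy : y ∈ Ω) (hpos : 0 < v y 1) :
    ∀ᶠ t in 𝓝 (0 : ℝ), v (y + t • ((v y 0 / v y 1) • stdVec 0 + stdVec 1)) = v y := by
  set c := v y 0 / v y 1 with hc
  set w : Plane := c • stdVec 0 + stdVec 1 with hw
  obtain ⟨r, hr, hrU⟩ := Metric.isOpen_iff.1 h.isOpen_pos y ⟨hy, hpos⟩
  have hvc := fun i => (h.continuousOn_apply i).mono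
    ((hrU.trans fun x hx => hx.1).trans subset_closure : ball y r ⊆ closure (Ω : Set Plane))
  have hρc : ContinuousOn (fun x => v x 0 / v x 1) (ball y r) :=
    (hvc 0).div (hvc 1) fun x hx => (hrU hx).2.ne'
  -- All directional derivatives of v₁/v₂ vanish on the ball, so the ratio has the constant value
  -- `c` there.
  have hρ : ∀ z ∈ ball y r, v z 0 / v z 1 = c := fun z hz => by
    have h1 := HasWeakDeriv.of_stdVec hρc (fun j φ hφ =>
      h.hasWeakDeriv_ratio hJ j φ (hφ.mono hrU)) (z - y)
    have h2 := h1.eq_of_segment_subset isOpen_ball hρc (x := y) fun t ht => by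
      rw [mem_ball, dist_eq_norm, add_sub_cancel_left, norm_smul, Real.norm_eq_abs,
        abs_of_nonneg ht.1]
      rw [mem_ball, dist_eq_norm] at hz
      nlinarith [ht.2, norm_nonneg (z - y)]
    simpa using h2
  have hρ' : ∀ z ∈ ball y r, v z 0 = c * v z 1 := fun z hz => by
    rw [← hρ z hz, div_mul_cancel₀ _ (hrU hz).2.ne']
  -- On the ball v = v₂ w, so w · ∇v₂ = div v = 0.
  have hwd : HasWeakDeriv (ball y r) w (fun x => v x 1) 0 := fun φ hφ => by
    have hφΩ : IsTest Ω φ := hφ.mono (hrU.trans fun x hx => hx.1)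
    have h0 := h.weak 0 0 φ hφΩ
    have h1 := h.weak 1 1 φ hφΩ
    have hint : ∀ j, Integrable fun x => g j j x * φ x := fun j => by
      have := (h.memLp_of_isCompact j j _ hφ.hasCompactSupport.isCompact
        hφΩ.tsupport_subset).integrable_mul ((UnifLim.const hφ.hasCompactSupport.isCompact
          hφ.contDiff.continuous.continuousOn).l2Lim hφ.hasCompactSupport.isCompact).mem
      refine (integrableOn_iff_integrable_of_support_subset fun x hx => ?_).1 this
      by_contra hxt
      exact hx (by simp [image_eq_zero_of_notMem_tsupport hxt])
    have e1 : ∀ x, v x 1 * fderiv ℝ φ x w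
        = v x 0 * fderiv ℝ φ x (stdVec 0) + v x 1 * fderiv ℝ φ x (stdVec 1) := fun x => by
      by_cases hx : x ∈ ball y r
      · rw [hρ' x hx, hw, map_add, map_smul, smul_eq_mul]; ring
      · have : fderiv ℝ φ x = 0 := by
          by_contra hne
          exact hx (hφ.tsupport_subset (support_fderiv_subset ℝ hne))
        simp [this]
    simp only [Pi.zero_apply, zero_mul, integral_zero, neg_zero, e1]
    rw [integral_add (integrable_mul_fderiv (hvc 0) hφ _) (integrable_mul_fderiv (hvc 1) hφ _),
      h0, h1, ← neg_add, ← integral_add (hint 0) (hint 1), neg_eq_zero]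
    refine integral_eq_zero_of_ae ?_
    filter_upwards [(ae_restrict_iff' Ω.isOpen.measurableSet).1 h.div] with x hx
    by_cases hxt : x ∈ tsupport φ
    · rw [← add_mul, hx (hφΩ.tsupport_subset hxt), zero_mul]; rfl
    · simp [image_eq_zero_of_notMem_tsupport hxt]
  have hcont : ContinuousAt (fun t : ℝ => y + t • w) 0 := by fun_prop
  have hev : ∀ᶠ t in 𝓝 (0 : ℝ), y + t • w ∈ ball y r :=
    hcont.preimage_mem_nhds (by rw [zero_smul, add_zero]; exact ball_mem_nhds y hr)
  filter_upwards [hev] with t ht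
  have hy' : y ∈ ball y r := mem_ball_self hr
  have h2 := (hwd.smul_zero t).eq_of_segment_subset isOpen_ball (hvc 1) (x := y) fun s hs => by
    rw [mem_ball, dist_eq_norm, add_sub_cancel_left] at ht ⊢
    rw [norm_smul, Real.norm_eq_abs, abs_of_nonneg hs.1]
    nlinarith [hs.2, norm_nonneg (t • w)]
  have h3 := hρ' _ ht
  rw [h2, ← hρ' y hy'] at h3
  ext i
  fin_cases i
  · exact h3
  · exact h2

/-- If some angle `τ ∈ [0, π]` is not attained by a slowly growing flow, then `v₂ ≤ 0`. -/
theorem apply_one_nonpos (h : PlanarFlow Ω v g) (hs : SlowGrowth Ω v)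
    (hray : ∀ x ∈ Ω, ∀ c : ℝ, ∃ t : ℝ, 0 ≤ t ∧ x - t • (c • stdVec 0 + stdVec 1) ∉ Ω)
    {τ : ℝ} (hτ : 0 ≤ τ) (hτπ : τ ≤ Real.pi)
    (hmiss : ∀ x ∈ closure (Ω : Set Plane), cvel v x ≠ 0 → (cvel v x).arg ≠ τ)
    {x : Plane} (hx : x ∈ Ω) : v x 1 ≤ 0 := by
  by_contra hpos
  rw [not_le] at hpos
  have hJ := h.angularField_ae_eq_zero hs hτ hτπ hmiss
  set c := v x 0 / v x 1 with hc
  set w : Plane := c • stdVec 0 + stdVec 1 with hw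
  set γ : ℝ → Plane := fun t => x - t • w with hγ
  have hγc : Continuous γ := by fun_prop
  -- The times at which the backward line lies outside the domain; its infimum `T` is the first exit
  -- time, and the line is then at a boundary point.
  set A : Set ℝ := {t | 0 ≤ t ∧ γ t ∉ Ω} with hA
  have hAcl : IsClosed A := isClosed_Ici.inter ((Ω.isOpen.preimage hγc).isClosed_compl)
  have hAne : A.Nonempty := hray x hx c
  have hAbdd : BddBelow A := ⟨0, fun t ht => ht.1⟩
  set T := sInf A with hT
  have hTA : T ∈ A := hAcl.csInf_mem hAne hAbdd
  have hlt : ∀ t ∈ Ico 0 T, γ t ∈ Ω := fun t ht => by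
    by_contra hn
    exact absurd (csInf_le hAbdd (show t ∈ A from ⟨ht.1, hn⟩)) (not_le.2 ht.2)
  have hT0 : 0 < T := by
    refine lt_of_le_of_ne hTA.1 fun h0 => hTA.2 ?_
    rw [← h0]; simpa [hγ] using hx
  have hTcl : γ T ∈ closure (Ω : Set Plane) := by
    have : T ∈ closure (Ico 0 T) := by
      rw [closure_Ico hT0.ne]; exact right_mem_Icc.2 hT0.le
    exact map_mem_closure hγc this hlt
  have hmaps : ∀ t ∈ Icc 0 T, γ t ∈ closure (Ω : Set Plane) := fun t ht => by
    rcases ht.2.eq_or_lt with h1 | h1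
    · rwa [h1]
    · exact subset_closure (hlt t ⟨ht.1, h1⟩)
  set S : Set ℝ := {t | v (γ t) = v x} with hS
  have hScl : IsClosed (S ∩ Icc 0 T) := by
    have hcomp : ContinuousOn (fun t => v (γ t)) (Icc 0 T) := h.cont.comp hγc.continuousOn hmaps
    have := hcomp.preimage_isClosed_of_isClosed isClosed_Icc (isClosed_singleton (x := v x))
    rwa [inter_comm] at this
  have hsub : Icc 0 T ⊆ S := by
    -- Continuity method: the set of times at which the velocity still equals `v x` is closed, and
    -- it is open because at such a time the local streamline has the same direction `w`.
    refine hScl.Icc_subset_of_forall_mem_nhdsWithin (by simp [hS, hγ]) fun t ht => ?_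
    have hv : v (γ t) = v x := ht.1
    have hev := h.eventually_eq_along_line hJ (hlt t ht.2) (by rw [hv]; exact hpos)
    rw [hv] at hev
    have hcont : Tendsto (fun s : ℝ => t - s) (𝓝 t) (𝓝 0) := by
      have h1 : Continuous fun s : ℝ => t - s := by fun_prop
      simpa only [sub_self] using h1.tendsto t
    refine mem_nhdsWithin_of_mem_nhds ?_
    filter_upwards [hcont.eventually hev] with s hs
    have : γ s = γ t + (t - s) • w := by simp only [hγ]; module
    show v (γ s) = v x
    rw [this]; exact hs
  have hvT : v (γ T) = v x := hsub (right_mem_Icc.2 hT0.le)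
  have h0 := h.slip (γ T) (by rw [Ω.isOpen.frontier_eq]; exact ⟨hTcl, hTA.2⟩)
  rw [hvT] at h0
  exact hpos.ne' h0

end PlanarFlow

/-! ### Flux through rectangles -/

/-- The point of the plane with coordinates `x` and `y`. -/
noncomputable def planePt (x y : ℝ) : Plane := x • stdVec 0 + y • stdVec 1

@[simp] theorem planePt_zero (x y : ℝ) : planePt x y 0 = x := by simp [planePt, stdVec]

@[simp] theorem planePt_one (x y : ℝ) : planePt x y 1 = y := by simp [planePt, stdVec]

@[simp] theorem planePt_self (x : Plane) : planePt (x 0) (x 1) = x := by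
  ext i; fin_cases i <;> simp

@[fun_prop]
theorem Continuous.planePt {X : Type*} [TopologicalSpace X] {f g : X → ℝ} (hf : Continuous f)
    (hg : Continuous g) : Continuous fun x => planePt (f x) (g x) :=
  (hf.smul continuous_const).add (hg.smul continuous_const)

/-- The divergence theorem in a rectangle, for smooth divergence free fields. -/
theorem boundary_integral_eq_zero_of_fderiv {V : Fin 2 → Plane → ℝ} (hV : ∀ i, ContDiff ℝ 1 (V i))
    {a b s t : ℝ} (hdiv : ∀ x ∈ uIcc a b, ∀ y ∈ uIcc s t,
      fderiv ℝ (V 0) (planePt x y) (stdVec 0) + fderiv ℝ (V 1) (planePt x y) (stdVec 1) = 0) :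
    (((∫ x in a..b, V 1 (planePt x t)) - ∫ x in a..b, V 1 (planePt x s)) +
      ∫ y in s..t, V 0 (planePt b y)) - ∫ y in s..t, V 0 (planePt a y) = 0 := by
  set L : ℝ × ℝ →L[ℝ] Plane := (ContinuousLinearMap.fst ℝ ℝ ℝ).smulRight (stdVec 0) +
    (ContinuousLinearMap.snd ℝ ℝ ℝ).smulRight (stdVec 1) with hL
  have hLp : ∀ p, L p = planePt p.1 p.2 := fun p => by simp [hL, planePt]
  have hd : ∀ i p, HasFDerivAt (fun p => V i (L p)) ((fderiv ℝ (V i) (L p)).comp L) p :=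
    fun i p => (((hV i).differentiable one_ne_zero) (L p)).hasFDerivAt.comp p L.hasFDerivAt
  have hc : ∀ i, Continuous fun p => V i (L p) := fun i => (hV i).continuous.comp L.continuous
  have hL0 : L (1, 0) = stdVec 0 := by simp [hL]
  have hL1 : L (0, 1) = stdVec 1 := by simp [hL]
  have hz : ∀ p ∈ uIcc a b ×ˢ uIcc s t, ((fderiv ℝ (V 0) (L p)).comp L) (1, 0) +
      ((fderiv ℝ (V 1) (L p)).comp L) (0, 1) = 0 := fun p hp => by
    rw [ContinuousLinearMap.comp_apply, ContinuousLinearMap.comp_apply, hL0, hL1, hLp]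
    exact hdiv _ hp.1 _ hp.2
  have key := integral2_divergence_prod_of_hasFDerivAt (fun p => V 0 (L p)) (fun p => V 1 (L p))
    (fun p => (fderiv ℝ (V 0) (L p)).comp L) (fun p => (fderiv ℝ (V 1) (L p)).comp L) a s b t
    (hc 0).continuousOn (hc 1).continuousOn (fun p _ => hd 0 p) (fun p _ => hd 1 p)
    ((integrableOn_zero).congr_fun (fun p hp => (hz p hp).symm)
      (measurableSet_uIcc.prod measurableSet_uIcc))
  simp only [hLp] at key
  rw [← key]
  have : ∀ x ∈ uIcc a b, (∫ y in s..t, ((fderiv ℝ (V 0) (planePt x y)).comp L) (1, 0) +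
      ((fderiv ℝ (V 1) (planePt x y)).comp L) (0, 1)) = 0 := fun x hx => by
    rw [intervalIntegral.integral_congr (g := fun _ => (0 : ℝ)), intervalIntegral.integral_zero]
    intro y hy
    simpa only [hLp] using hz (x, y) ⟨hx, hy⟩
  rw [intervalIntegral.integral_congr (g := fun _ => (0 : ℝ)) this, intervalIntegral.integral_zero]

namespace PlanarFlow

variable {Ω : Opens Plane} {v : Plane → Plane} {g : Fin 2 → Fin 2 → Plane → ℝ}

/-- The flux of a flow through the boundary of a rectangle contained in the domain vanishes. -/
theorem boundary_integral_eq_zero_of_subset (h : PlanarFlow Ω v g) {a b s t : ℝ}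
    (hR : ∀ x ∈ uIcc a b, ∀ y ∈ uIcc s t, planePt x y ∈ Ω) :
    (((∫ x in a..b, v (planePt x t) 1) - ∫ x in a..b, v (planePt x s) 1) +
      ∫ y in s..t, v (planePt b y) 0) - ∫ y in s..t, v (planePt a y) 0 = 0 := by
  set K : Set Plane := (fun p : ℝ × ℝ => planePt p.1 p.2) '' (uIcc a b ×ˢ uIcc s t) with hKdef
  have hK : IsCompact K := (isCompact_uIcc.prod isCompact_uIcc).image (by fun_prop)
  have hmem : ∀ x ∈ uIcc a b, ∀ y ∈ uIcc s t, planePt x y ∈ K := fun x hx y hy =>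
    ⟨(x, y), ⟨hx, hy⟩, rfl⟩
  have hKΩ : K ⊆ Ω := by rintro _ ⟨p, hp, rfl⟩; exact hR _ hp.1 _ hp.2
  obtain ⟨K', δ, hK', hK'Ω, hδ, hKK⟩ := exists_compact_closedBall_subset hK Ω.isOpen hKΩ
  have hvc : ∀ i, ContinuousOn (fun x => v x i) K' := fun i =>
    (h.continuousOn_apply i).mono (hK'Ω.trans subset_closure)
  have hfi : ∀ i, IntegrableOn (fun x => v x i) K' := fun i => (hvc i).integrableOn_compact hK'
  set V : ℕ → Fin 2 → Plane → ℝ := fun n i => moll n (K'.indicator fun x => v x i) with hVdef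
  have hVs : ∀ n i, ContDiff ℝ 1 (V n i) := fun n i => (contDiff_moll
    ((integrable_indicator_iff hK'.measurableSet).2 (hfi i)).locallyIntegrable).of_le (by simp)
  have hunif : ∀ i, TendstoUniformlyOn (fun n => V n i) (fun x => v x i) atTop K := fun i =>
    tendstoUniformlyOn_moll hK' (hvc i) hδ hKK
  have hev : ∀ᶠ n : ℕ in atTop, 1 / ((n : ℝ) + 1) < δ :=
    tendsto_one_div_add_atTop_nhds_zero_nat.eventually_lt_const hδ
  have hflux : ∀ᶠ n in atTop, (((∫ x in a..b, V n 1 (planePt x t)) -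
      ∫ x in a..b, V n 1 (planePt x s)) + ∫ y in s..t, V n 0 (planePt b y)) -
      ∫ y in s..t, V n 0 (planePt a y) = 0 := by
    filter_upwards [hev] with n hn
    refine boundary_integral_eq_zero_of_fderiv (hVs n) fun x hx y hy => ?_
    have hb := (closedBall_subset_closedBall hn.le).trans (hKK _ (hmem x hx y hy))
    simp only [hVdef]
    rw [fderiv_moll_eq_moll hK'.measurableSet hK'Ω (h.weak 0 0) (hfi 0) hb,
      fderiv_moll_eq_moll hK'.measurableSet hK'Ω (h.weak 1 1) (hfi 1) hb]
    -- On the rectangle mollification commutes with the derivatives, so the mollified field is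
    -- exactly divergence free there.
    have hsum : K'.indicator (g 0 0) =ᵐ[volume] fun x => - K'.indicator (g 1 1) x := by
      filter_upwards [(ae_restrict_iff' Ω.isOpen.measurableSet).1 h.div] with x hx
      by_cases hxK : x ∈ K'
      · simp only [indicator_of_mem hxK]; linarith [hx (hK'Ω hxK)]
      · simp [indicator_of_notMem hxK]
    have e : ∀ z, ∀ᵐ y, (mollBump n).normed (volume : Measure Plane) (z - y) *
        K'.indicator (g 0 0) y = - ((mollBump n).normed (volume : Measure Plane) (z - y) *
        K'.indicator (g 1 1) y) := fun z => by
      filter_upwards [hsum] with y hy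
      rw [hy, mul_neg]
    rw [moll_apply, moll_apply, integral_congr_ae (e _), integral_neg, neg_add_cancel]
  have hx : ∀ y ∈ uIcc s t, Tendsto (fun n => ∫ x in a..b, V n 1 (planePt x y)) atTop
      (𝓝 (∫ x in a..b, v (planePt x y) 1)) := fun y hy =>
    TendstoUniformlyOn.tendsto_intervalIntegral_of_continuousOn
      (Eventually.of_forall fun n => ((hVs n 1).continuous.comp (by fun_prop)).continuousOn)
      (((hunif 1).comp fun x => planePt x y).mono fun x hx => hmem x hx y hy)
  have hy : ∀ x ∈ uIcc a b, Tendsto (fun n => ∫ y in s..t, V n 0 (planePt x y)) atTop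
      (𝓝 (∫ y in s..t, v (planePt x y) 0)) := fun x hx =>
    TendstoUniformlyOn.tendsto_intervalIntegral_of_continuousOn
      (Eventually.of_forall fun n => ((hVs n 0).continuous.comp (by fun_prop)).continuousOn)
      (((hunif 0).comp fun y => planePt x y).mono fun y hy => hmem x hx y hy)
  refine tendsto_nhds_unique_of_eventuallyEq ((((hx t right_mem_uIcc).sub
    (hx s left_mem_uIcc)).add (hy b right_mem_uIcc)).sub (hy a left_mem_uIcc))
    tendsto_const_nhds hflux

/-- The flux of a flow through the boundary of a rectangle vanishes, also if one side of the
rectangle lies on the boundary of the domain. -/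
theorem boundary_integral_eq_zero (h : PlanarFlow Ω v g) {a b s t : ℝ}
    (hR : ∀ x ∈ uIcc a b, ∀ r ∈ Ioc (0 : ℝ) 1, planePt x (s + (t - s) * r) ∈ Ω) :
    (((∫ x in a..b, v (planePt x t) 1) - ∫ x in a..b, v (planePt x s) 1) +
      ∫ y in s..t, v (planePt b y) 0) - ∫ y in s..t, v (planePt a y) 0 = 0 := by
  -- Tietze extension to the plane, so that continuity of parametric integrals can be used without
  -- domain restrictions.
  obtain ⟨E, hE⟩ := ContinuousMap.exists_restrict_eq (isClosed_closure (s := (Ω : Set Plane)))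
    ⟨_, h.cont.domRestrict⟩
  have hEv : ∀ x ∈ closure (Ω : Set Plane), E x = v x := fun x hx =>
    DFunLike.congr_fun hE ⟨x, hx⟩
  have hcl : ∀ x ∈ uIcc a b, ∀ r ∈ Icc (0 : ℝ) 1,
      planePt x (s + (t - s) * r) ∈ closure (Ω : Set Plane) := fun x hx r hr => by
    have hcont : Continuous fun r : ℝ => planePt x (s + (t - s) * r) := by fun_prop
    have hr' : r ∈ closure (Ioc (0 : ℝ) 1) := by rwa [closure_Ioc zero_ne_one]
    have := map_mem_closure hcont hr' (t := (Ω : Set Plane)) fun r hr => hR x hx r hr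
    exact this
  have hcl' : ∀ x ∈ uIcc a b, ∀ y ∈ uIcc s t, planePt x y ∈ closure (Ω : Set Plane) :=
    fun x hx y hy => by
      have : segment ℝ s t = uIcc s t := segment_eq_uIcc s t
      rw [← this, segment_eq_image'] at hy
      obtain ⟨r, hr, rfl⟩ := hy
      have := hcl x hx r hr
      rwa [mul_comm, ← smul_eq_mul] at this
  -- The flux of the rectangle with the side at height `s` moved inwards by the fraction `r`. The
  -- vertical integrals start at the fixed endpoint `t`, hence the minus signs, and only their upper
  -- limit depends on `r`. The flux is zero for r > 0, and continuity gives r = 0.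
  set F : ℝ → ℝ := fun r => (((∫ x in a..b, E (planePt x t) 1) -
    ∫ x in a..b, E (planePt x (s + (t - s) * r)) 1) +
      ∫ y in t..(s + (t - s) * r), -E (planePt b y) 0) -
      ∫ y in t..(s + (t - s) * r), -E (planePt a y) 0 with hF
  have hFc : Continuous F := by
    refine ((continuous_const.sub ?_).add ?_).sub ?_
    · exact intervalIntegral.continuous_parametric_intervalIntegral_of_continuous'
        (f := fun r x => E (planePt x (s + (t - s) * r)) 1) (by unfold Function.uncurry; fun_prop) a b
    · exact intervalIntegral.continuous_parametric_intervalIntegral_of_continuous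
        (f := fun (_ : ℝ) y => -E (planePt b y) 0) (by unfold Function.uncurry; fun_prop) (by fun_prop)
    · exact intervalIntegral.continuous_parametric_intervalIntegral_of_continuous
        (f := fun (_ : ℝ) y => -E (planePt a y) 0) (by unfold Function.uncurry; fun_prop) (by fun_prop)
  have hFeq : ∀ r ∈ Icc (0 : ℝ) 1, F r = (((∫ x in a..b, v (planePt x t) 1) -
      ∫ x in a..b, v (planePt x (s + (t - s) * r)) 1) +
      ∫ y in (s + (t - s) * r)..t, v (planePt b y) 0) -
      ∫ y in (s + (t - s) * r)..t, v (planePt a y) 0 := fun r hr => by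
    have hmem : s + (t - s) * r ∈ uIcc s t := by
      rw [← segment_eq_uIcc, segment_eq_image']
      exact ⟨r, hr, by simp [mul_comm]⟩
    have hsub : uIcc (s + (t - s) * r) t ⊆ uIcc s t := uIcc_subset_uIcc hmem right_mem_uIcc
    simp only [hF, intervalIntegral.integral_neg]
    rw [← intervalIntegral.integral_symm, ← intervalIntegral.integral_symm]
    congr 1
    · congr 1
      · congr 1
        · exact intervalIntegral.integral_congr fun x hx => by
            simp only [hEv _ (hcl' x hx t right_mem_uIcc)]
        · exact intervalIntegral.integral_congr fun x hx => by
            simp only [hEv _ (hcl' x hx _ hmem)]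
      · exact intervalIntegral.integral_congr fun y hy => by
          simp only [hEv _ (hcl' b right_mem_uIcc y (hsub hy))]
    · exact intervalIntegral.integral_congr fun y hy => by
        simp only [hEv _ (hcl' a left_mem_uIcc y (hsub hy))]
  have hF0 : ∀ r ∈ Ioc (0 : ℝ) 1, F r = 0 := fun r hr => by
    rw [hFeq r ⟨hr.1.le, hr.2⟩]
    refine h.boundary_integral_eq_zero_of_subset fun x hx y hy => ?_
    rw [← segment_eq_uIcc, segment_eq_image'] at hy
    obtain ⟨q, hq, rfl⟩ := hy
    have := hR x hx (r + q * (1 - r)) ⟨by nlinarith [hr.1, hr.2, hq.1], by nlinarith [hr.1, hr.2, hq.2]⟩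
    convert this using 2
    simp only [smul_eq_mul]; ring
  have h0 : F 0 = 0 := by
    have : (0 : ℝ) ∈ closure (Ioc (0 : ℝ) 1) := by
      rw [closure_Ioc zero_ne_one]; simp
    have hc : IsClosed {r | F r = 0} := isClosed_eq hFc continuous_const
    exact closure_minimal hF0 hc this
  rw [hFeq 0 (by simp), mul_zero, add_zero] at h0
  exact h0

end PlanarFlow

/-! ### A flux argument at a wall -/

theorem pos_or_neg_of_ne_zero {f : ℝ → ℝ} (hf : Continuous f) {a b : ℝ}
    (h : ∀ x ∈ Icc a b, f x ≠ 0) : (∀ x ∈ Icc a b, 0 < f x) ∨ ∀ x ∈ Icc a b, f x < 0 := by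
  by_contra! hcon
  obtain ⟨⟨x, hx, hfx⟩, y, hy, hfy⟩ := hcon
  obtain ⟨z, hz, hfz⟩ := isPreconnected_Icc.intermediate_value hx hy hf.continuousOn ⟨hfx, hfy⟩
  exact h z hz hfz

theorem intervalIntegral_pos_of_continuous {f : ℝ → ℝ} (hf : Continuous f) {a b : ℝ} (hab : a < b)
    (h : ∀ x ∈ Icc a b, 0 < f x) : 0 < ∫ x in a..b, f x :=
  intervalIntegral.integral_pos hab hf.continuousOn (fun x hx => (h x (Ioc_subset_Icc_self hx)).le)
    ⟨a, left_mem_Icc.2 hab.le, h a (left_mem_Icc.2 hab.le)⟩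

theorem exists_first_hitting {f : ℝ → ℝ} (hf : Continuous f) {x₀ b c : ℝ} (hx₀ : f x₀ < c)
    (hb : x₀ ≤ b) (hfb : c ≤ f b) :
    ∃ b', x₀ < b' ∧ f b' = c ∧ ∀ x ∈ Icc x₀ b', f x ≤ c := by
  have hK : IsCompact (Icc x₀ b ∩ {x | c ≤ f x}) :=
    isCompact_Icc.inter_right (isClosed_le continuous_const hf)
  obtain ⟨b', hb', hleast⟩ := hK.exists_isLeast ⟨b, ⟨hb, le_rfl⟩, hfb⟩
  have hc' : c ≤ f b' := hb'.2
  have hlt : x₀ < b' := lt_of_le_of_ne hb'.1.1 fun h => by rw [← h] at hc'; linarith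
  have hIco : ∀ x ∈ Ico x₀ b', f x ≤ c := fun x hx => by
    by_contra! hcon
    exact absurd (hleast ⟨⟨hx.1, hx.2.le.trans hb'.1.2⟩, hcon.le⟩) (not_le.2 hx.2)
  have hIcc : ∀ x ∈ Icc x₀ b', f x ≤ c := fun x hx => by
    rw [← closure_Ico hlt.ne] at hx
    exact closure_minimal hIco (isClosed_le hf continuous_const) hx
  exact ⟨b', hlt, le_antisymm (hIcc b' (right_mem_Icc.2 hlt.le)) hc', hIcc⟩

theorem exists_last_hitting {f : ℝ → ℝ} (hf : Continuous f) {x₀ a c : ℝ} (hx₀ : f x₀ < c)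
    (ha : a ≤ x₀) (hfa : c ≤ f a) :
    ∃ a', a' < x₀ ∧ f a' = c ∧ ∀ x ∈ Icc a' x₀, f x ≤ c := by
  obtain ⟨b', h1, h2, h3⟩ := exists_first_hitting (f := fun x => f (-x)) (x₀ := -x₀) (b := -a)
    (by fun_prop) (by simpa using hx₀) (by linarith) (by simpa using hfa)
  exact ⟨-b', by linarith, h2, fun x hx => by
    simpa using h3 (-x) ⟨by linarith [hx.2], by linarith [hx.1]⟩⟩

/-- A field `(U, W)` with vanishing flux near a wall `s = 0`, tangent to it, and with zero mean
vertical component, can not move to the left on the wall without moving straight to the left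
somewhere near it. -/
theorem nonneg_of_vanishing_flux {U W : ℝ → ℝ → ℝ} (hU : Continuous (Function.uncurry U))
    (hW : Continuous (Function.uncurry W)) {T δ : ℝ} (hT : 0 < T) (hδ : 0 < δ)
    (hzero : ∀ x, ∀ s ∈ Ioo 0 δ, W x s = 0 → 0 ≤ U x s)
    (hflux : ∀ a b, ∀ s ∈ Ioo 0 δ, (∫ y in (0 : ℝ)..s, (U b y - U a y)) + ∫ x in a..b, W x s = 0)
    (hmean : ∀ a, ∀ s ∈ Ioo 0 δ, ∫ x in a..(a + T), W x s = 0) (x₀ : ℝ) : 0 ≤ U x₀ 0 := by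
  have hUs : ∀ s, Continuous fun x => U x s := fun s => hU.comp (by fun_prop : Continuous fun x => (x, s))
  have hWs : ∀ s, Continuous fun x => W x s := fun s => hW.comp (by fun_prop : Continuous fun x => (x, s))
  have hUx : ∀ x, Continuous fun s => U x s := fun x => hU.comp (by fun_prop : Continuous fun s => (x, s))
  have hIoo : ∀ᶠ s in 𝓝[>] (0 : ℝ), s ∈ Ioo 0 δ := Ioo_mem_nhdsGT hδ
  -- Close to a stretch of the wall where U < 0, a zero of W would be a point of straight leftward
  -- motion, which `hzero` forbids; so W has a fixed sign at each small height.
  have hsign : ∀ a b, (∀ x ∈ Icc a b, U x 0 < 0) → ∀ᶠ s in 𝓝[>] (0 : ℝ),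
      (∀ x ∈ Icc a b, 0 < W x s) ∨ ∀ x ∈ Icc a b, W x s < 0 := fun a b hneg => by
    have htube : ∀ᶠ s in 𝓝 (0 : ℝ), ∀ x ∈ Icc a b, U x s < 0 := by
      refine isCompact_Icc.eventually_forall_of_forall_eventually fun x hx => ?_
      exact (hU.comp continuous_swap).tendsto (0, x) |>.eventually_lt_const (hneg x hx)
    filter_upwards [hIoo, nhdsWithin_le_nhds htube] with s hs hUneg
    exact pos_or_neg_of_ne_zero (hWs s) fun x hx h0 =>
      absurd (hzero x s hs h0) (not_le.2 (hUneg x hx))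
  -- If U were negative along a whole period of the wall, W would have a sign there, against its
  -- zero mean.
  have hex : ∀ a, ∃ x ∈ Icc a (a + T), 0 ≤ U x 0 := fun a => by
    by_contra! hcon
    obtain ⟨s, hs, hsg⟩ := (hIoo.and (hsign a (a + T) hcon)).exists
    rcases hsg with hsg | hsg
    · exact (intervalIntegral_pos_of_continuous (hWs s) (by linarith) hsg).ne' (hmean a s hs)
    · have := intervalIntegral_pos_of_continuous (f := fun x => -W x s) (hWs s).neg
        (by linarith : a < a + T) fun x hx => neg_pos.2 (hsg x hx)
      simp only [intervalIntegral.integral_neg, hmean a s hs, neg_zero, lt_irrefl] at this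
  by_contra! hcon
  set c := U x₀ 0 / 2 with hc
  have hxc : U x₀ 0 < c := by linarith
  obtain ⟨b₁, hb₁, hUb₁⟩ := hex x₀
  obtain ⟨a₁, ha₁, hUa₁⟩ := hex (x₀ - T)
  -- The nearest points on both sides of `x₀` where U rises to half of its negative value at `x₀`:
  -- between them U stays negative, and at both it exceeds its value at `x₀`.
  obtain ⟨b, hb, hUb, hbI⟩ := exists_first_hitting (hUs 0) hxc hb₁.1 (by linarith)
  obtain ⟨a, ha, hUa, haI⟩ := exists_last_hitting (hUs 0) hxc (by linarith [ha₁.2] : a₁ ≤ x₀)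
    (by linarith)
  have hneg : ∀ x ∈ Icc a b, U x 0 < 0 := fun x hx => by
    rcases le_total x x₀ with h | h
    · linarith [haI x ⟨hx.1, h⟩]
    · linarith [hbI x ⟨h, hx.2⟩]
  have hcmp : ∀ d, U d 0 = c → ∀ᶠ s in 𝓝 (0 : ℝ), 0 < U d s - U x₀ s := fun d hd =>
    (((hUx d).sub (hUx x₀)).tendsto 0).eventually_const_lt (by
      show 0 < U d 0 - U x₀ 0
      linarith)
  obtain ⟨ε, hε, hball⟩ := Metric.eventually_nhds_iff.1 ((hcmp a hUa).and (hcmp b hUb))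
  have hev : ∀ᶠ s in 𝓝[>] (0 : ℝ), s < ε := nhdsWithin_le_nhds (eventually_lt_nhds hε)
  obtain ⟨s, hs, hsε, hsg⟩ := (hIoo.and (hev.and (hsign a b hneg))).exists
  have hy : ∀ y ∈ Icc 0 s, 0 < U a y - U x₀ y ∧ 0 < U b y - U x₀ y := fun y hy => hball (by
    rw [Real.dist_eq, sub_zero, abs_of_nonneg hy.1]; exact hy.2.trans_lt hsε)
  -- If W > 0, the rectangle between `x₀` and `b` has strictly positive total flux; if W < 0, the
  -- rectangle between `a` and `x₀` plays this role.
  rcases hsg with hsg | hsg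
  · have h1 := intervalIntegral_pos_of_continuous (hWs s) hb fun x hx => hsg x ⟨ha.le.trans hx.1, hx.2⟩
    have h2 := intervalIntegral_pos_of_continuous (f := fun y => U b y - U x₀ y)
      ((hUx b).sub (hUx x₀)) hs.1 fun y h => (hy y h).2
    linarith [hflux x₀ b s hs]
  · have h1 := intervalIntegral_pos_of_continuous (f := fun x => -W x s) (hWs s).neg ha
      fun x hx => neg_pos.2 (hsg x ⟨hx.1, hx.2.trans hb.le⟩)
    have h2 := intervalIntegral_pos_of_continuous (f := fun y => U a y - U x₀ y)
      ((hUx a).sub (hUx x₀)) hs.1 fun y h => (hy y h).1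
    have h3 := hflux x₀ a s hs
    rw [intervalIntegral.integral_symm a x₀] at h3
    simp only [intervalIntegral.integral_neg] at h1
    linarith

/-! ### Shear flows and periodic flows -/

namespace PlanarFlow

variable {Ω : Opens Plane} {v : Plane → Plane} {g : Fin 2 → Fin 2 → Plane → ℝ}

/-- A flow with vanishing vertical component is a shear flow. -/
theorem isShearFlow (h : PlanarFlow Ω v g) (htrans : ∀ x ∈ Ω, ∀ t : ℝ, x + t • stdVec 0 ∈ Ω)
    (h1 : ∀ x ∈ Ω, v x 1 = 0) : IsShearFlow Ω v := by
  -- With v₂ = 0 incompressibility reads ∂₁v₁ = 0, so v₁ is constant on horizontal lines.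
  have hweak : HasWeakDeriv Ω (stdVec 0) (fun x => v x 0) 0 := fun φ hφ => by
    rw [h.weak 0 0 φ hφ]
    have e1 : ∫ x, g 0 0 x * φ x = - ∫ x, g 1 1 x * φ x := by
      rw [← integral_neg]
      refine integral_congr_ae ?_
      filter_upwards [(ae_restrict_iff' Ω.isOpen.measurableSet).1 h.div] with x hx
      by_cases hxt : x ∈ tsupport φ
      · have := hx (hφ.tsupport_subset hxt)
        rw [← neg_mul]; congr 1; linarith
      · simp [image_eq_zero_of_notMem_tsupport hxt]
    have e2 : ∫ x, v x 1 * fderiv ℝ φ x (stdVec 1) = 0 := by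
      refine integral_eq_zero_of_ae (Eventually.of_forall fun x => ?_)
      by_cases hxt : x ∈ tsupport φ
      · simp [h1 x (hφ.tsupport_subset hxt)]
      · have : fderiv ℝ φ x = 0 := by
          by_contra hne
          exact hxt (support_fderiv_subset ℝ hne)
        simp [this]
    have e3 := h.weak 1 1 φ hφ
    rw [e1, ← e3, e2]; simp
  have hΩ : ∀ x ∈ Ω, ∀ t : ℝ, v (x + t • stdVec 0) 0 = v x 0 := fun x hx t =>
    (hweak.smul_zero t).eq_of_segment_subset Ω.isOpen
      ((h.continuousOn_apply 0).mono subset_closure) fun s _ => by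
        rw [smul_smul]; exact htrans x hx _
  have hcl : ∀ x ∈ closure (Ω : Set Plane), ∀ t : ℝ, x + t • stdVec 0 ∈ closure (Ω : Set Plane) :=
    fun x hx t => map_mem_closure (f := fun x => x + t • stdVec 0) (by fun_prop) hx
      fun x hx => htrans x hx t
  refine ⟨fun y => v (planePt 0 y) 0, fun x hx => ?_⟩
  have h10 : v x 1 = 0 := by
    by_cases hxΩ : x ∈ Ω
    · exact h1 x hxΩ
    · exact h.slip x (by rw [Ω.isOpen.frontier_eq]; exact ⟨hx, hxΩ⟩)
  have hp : planePt 0 (x 1) = x + (-x 0) • stdVec 0 := by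
    ext i; fin_cases i <;> simp [stdVec]
  have h00 : v (planePt 0 (x 1)) 0 = v x 0 := by
    rw [hp]
    have hc : ContinuousOn (fun y => v (y + (-x 0) • stdVec 0) 0 - v y 0) (closure (Ω : Set Plane)) :=
      (((h.continuousOn_apply 0).comp (f := fun y : Plane => y + (-x 0) • stdVec 0)
        (by fun_prop) fun y hy => hcl y hy _)).sub (h.continuousOn_apply 0)
    have hmaps : MapsTo (fun y => v (y + (-x 0) • stdVec 0) 0 - v y 0) (Ω : Set Plane) {0} :=
      fun y hy => sub_eq_zero.2 (hΩ y hy _)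
    have := hmaps.closure_of_continuousOn hc hx
    simpa [sub_eq_zero] using this
  ext i
  fin_cases i
  · simpa using h00.symm
  · simpa using h10

theorem apply_add_period (h : PlanarFlow Ω v g) (htrans : ∀ x ∈ Ω, ∀ t : ℝ, x + t • stdVec 0 ∈ Ω)
    {T : ℝ} (hper : ∀ x ∈ Ω, v (x + T • stdVec 0) = v x) :
    ∀ x ∈ closure (Ω : Set Plane), v (x + T • stdVec 0) = v x := fun x hx => by
  have hcl : ∀ x ∈ closure (Ω : Set Plane), x + T • stdVec 0 ∈ closure (Ω : Set Plane) :=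
    fun x hx => map_mem_closure (f := fun x => x + T • stdVec 0) (by fun_prop) hx
      fun x hx => htrans x hx T
  have hc : ContinuousOn (fun y => v (y + T • stdVec 0) - v y) (closure (Ω : Set Plane)) :=
    (h.cont.comp (f := fun y : Plane => y + T • stdVec 0)
      (by fun_prop) fun y hy => hcl y hy).sub h.cont
  have hmaps : MapsTo (fun y => v (y + T • stdVec 0) - v y) (Ω : Set Plane) {0} :=
    fun y hy => by simp [hper y hy]
  have := hmaps.closure_of_continuousOn hc hx
  simpa [sub_eq_zero] using this

/-- The flux balance of a rectangle resting on the wall at height `b`, whose wall side carries no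
flux. The sign σ measures distance into the domain, so lower and upper walls are treated at once. -/
theorem integral_add_integral_eq_zero (h : PlanarFlow Ω v g) {b σ s : ℝ} (hσ : σ = 1 ∨ σ = -1)
    (hb : ∀ x, planePt x b ∈ frontier (Ω : Set Plane))
    (hseg : ∀ x, ∀ r ∈ Ioc 0 s, planePt x (b + σ * r) ∈ Ω) (hs : 0 < s) (a c : ℝ) :
    ((∫ y in (0 : ℝ)..s, v (planePt c (b + σ * y)) 0) - ∫ y in (0 : ℝ)..s, v (planePt a (b + σ * y)) 0)
      + ∫ x in a..c, σ * v (planePt x (b + σ * s)) 1 = 0 := by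
  have key := h.boundary_integral_eq_zero (a := a) (b := c) (s := b) (t := b + σ * s)
    fun x _ r hr => by
      have := hseg x (s * r) ⟨mul_pos hs hr.1, by nlinarith [hr.2]⟩
      rwa [← mul_assoc, ← add_sub_cancel_left b (σ * s)] at this
  have h0 : ∀ x, v (planePt x b) 1 = 0 := fun x => h.slip _ (hb x)
  have hsub : ∀ x, ∫ y in b..(b + σ * s), v (planePt x y) 0
      = σ * ∫ y in (0 : ℝ)..s, v (planePt x (b + σ * y)) 0 := fun x => by
    have := intervalIntegral.smul_integral_comp_add_mul (a := 0) (b := s)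
      (fun y => v (planePt x y) 0) σ b
    rw [mul_zero, add_zero] at this
    rw [← this, smul_eq_mul]
  simp only [h0, hsub, intervalIntegral.integral_zero, sub_zero] at key
  have hσ2 : σ * σ = 1 := by rcases hσ with rfl | rfl <;> norm_num
  rw [intervalIntegral.integral_const_mul]
  linear_combination σ * key - ((∫ y in (0 : ℝ)..s, v (planePt c (b + σ * y)) 0) -
    ∫ y in (0 : ℝ)..s, v (planePt a (b + σ * y)) 0) * hσ2

/-- In a rectangle one period wide the fluxes through the two vertical sides cancel. -/
theorem integral_apply_one_eq_zero (h : PlanarFlow Ω v g) {b σ s T : ℝ} (hσ : σ = 1 ∨ σ = -1)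
    (htrans : ∀ x ∈ Ω, ∀ t : ℝ, x + t • stdVec 0 ∈ Ω)
    (hper : ∀ x ∈ Ω, v (x + T • stdVec 0) = v x)
    (hb : ∀ x, planePt x b ∈ frontier (Ω : Set Plane))
    (hseg : ∀ x, ∀ r ∈ Ioc 0 s, planePt x (b + σ * r) ∈ Ω) (hs : 0 < s) (a : ℝ) :
    ∫ x in a..(a + T), σ * v (planePt x (b + σ * s)) 1 = 0 := by
  have key := h.integral_add_integral_eq_zero hσ hb hseg hs a (a + T)
  have : ∀ y ∈ uIcc 0 s, v (planePt (a + T) (b + σ * y)) 0 = v (planePt a (b + σ * y)) 0 :=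
    fun y hy => by
      rw [uIcc_of_le hs.le] at hy
      have hmem : planePt a (b + σ * y) ∈ closure (Ω : Set Plane) := by
        rcases hy.1.eq_or_lt with h0 | h0
        · rw [← h0, mul_zero, add_zero]; exact frontier_subset_closure (hb a)
        · exact subset_closure (hseg a y ⟨h0, hy.2⟩)
      rw [← h.apply_add_period htrans hper _ hmem]
      have : planePt (a + T) (b + σ * y) = planePt a (b + σ * y) + T • stdVec 0 := by
        simp only [planePt]; module
      rw [this]
  rw [intervalIntegral.integral_congr this, sub_self, zero_add] at key
  exact key

/-- If a periodic flow never points to the left in the domain, it does not do so on the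
boundary. -/
theorem apply_zero_nonneg_of_frontier (h : PlanarFlow Ω v g) {b σ δ T : ℝ} (hσ : σ = 1 ∨ σ = -1)
    (htrans : ∀ x ∈ Ω, ∀ t : ℝ, x + t • stdVec 0 ∈ Ω) (hT : 0 < T)
    (hper : ∀ x ∈ Ω, v (x + T • stdVec 0) = v x)
    (hb : ∀ x, planePt x b ∈ frontier (Ω : Set Plane)) (hδ : 0 < δ)
    (hseg : ∀ x, ∀ r ∈ Ioo 0 δ, planePt x (b + σ * r) ∈ Ω)
    (hmiss : ∀ x ∈ Ω, v x 1 = 0 → 0 ≤ v x 0) (x₀ : ℝ) : 0 ≤ v (planePt x₀ b) 0 := by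
  obtain ⟨E, hE⟩ := ContinuousMap.exists_restrict_eq (isClosed_closure (s := (Ω : Set Plane)))
    ⟨_, h.cont.domRestrict⟩
  have hEv : ∀ x ∈ closure (Ω : Set Plane), E x = v x := fun x hx =>
    DFunLike.congr_fun hE ⟨x, hx⟩
  have hEΩ : ∀ x, ∀ r ∈ Ioo 0 δ, E (planePt x (b + σ * r)) = v (planePt x (b + σ * r)) :=
    fun x r hr => hEv _ (subset_closure (hseg x r hr))
  have hEb : ∀ x, E (planePt x b) = v (planePt x b) := fun x =>
    hEv _ (frontier_subset_closure (hb x))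
  have hσ0 : σ ≠ 0 := by rcases hσ with rfl | rfl <;> norm_num
  have hsub : ∀ s ∈ Ioo 0 δ, ∀ x, ∀ r ∈ Ioc 0 s, planePt x (b + σ * r) ∈ Ω :=
    fun s hs x r hr => hseg x r ⟨hr.1, hr.2.trans_lt hs.2⟩
  have key := nonneg_of_vanishing_flux (U := fun x s => E (planePt x (b + σ * s)) 0)
    (W := fun x s => σ * E (planePt x (b + σ * s)) 1) (T := T) (δ := δ)
    (by unfold Function.uncurry; fun_prop) (by unfold Function.uncurry; fun_prop) hT hδ
    (fun x s hs h0 => by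
      rw [mul_eq_zero, or_iff_right hσ0, hEΩ x s hs] at h0
      simpa only [hEΩ x s hs] using hmiss _ (hseg x s hs) h0)
    (fun a c s hs => by
      have := h.integral_add_integral_eq_zero hσ hb (hsub s hs) hs.1 a c
      have hcongr : ∀ x, ∫ y in (0 : ℝ)..s, v (planePt x (b + σ * y)) 0
          = ∫ y in (0 : ℝ)..s, E (planePt x (b + σ * y)) 0 := fun x =>
        intervalIntegral.integral_congr fun y hy => by
          rw [uIcc_of_le hs.1.le] at hy
          rcases hy.1.eq_or_lt with h0 | h0
          · simp only [← h0, mul_zero, add_zero, hEb]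
          · simp only [hEΩ x y ⟨h0, hy.2.trans_lt hs.2⟩]
      rw [intervalIntegral.integral_sub (Continuous.intervalIntegrable (by fun_prop) _ _)
        (Continuous.intervalIntegrable (by fun_prop) _ _)]
      simpa only [hcongr, hEΩ _ s hs] using this)
    (fun a s hs => by
      simpa only [hEΩ _ s hs] using
        h.integral_apply_one_eq_zero hσ htrans hper hb (hsub s hs) hs.1 a) x₀
  simpa [hEb] using key

end PlanarFlow

/-! ### From the Euler system to planar flows -/

section TestFunctions

variable {Ω : Opens Plane}

/-- A test function as an element of the space `𝓓(Ω, ℝ)`. -/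
def IsTest.toTestFunction {φ : Plane → ℝ} (hφ : IsTest Ω φ) : 𝓓(Ω, ℝ) :=
  ⟨φ, hφ.contDiff, hφ.hasCompactSupport, hφ.tsupport_subset⟩

theorem TestFunction.isTest (φ : 𝓓(Ω, ℝ)) : IsTest Ω φ :=
  ⟨φ.contDiff, φ.hasCompactSupport, φ.tsupport_subset⟩

theorem TestFunction.lineDerivOp_apply_eq_fderiv (φ : 𝓓(Ω, ℝ)) (e x : Plane) :
    (∂_{e} φ) x = fderiv ℝ φ x e := by
  rw [TestFunction.lineDerivOp_eq_lineDerivCLM ℝ, TestFunction.lineDerivCLM_apply_of_le (by simp)]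
  exact ((φ.contDiff.differentiable (by simp)).differentiableAt).lineDeriv_eq_fderiv

theorem TestFunction.lineDerivOp_comm (φ : 𝓓(Ω, ℝ)) (a b : Plane) :
    ∂_{a} (∂_{b} φ) = ∂_{b} (∂_{a} φ) := by
  ext x
  have key : ∀ c d : Plane, (∂_{c} (∂_{d} φ)) x = fderiv ℝ (fderiv ℝ φ) x c d := fun c d => by
    rw [lineDerivOp_apply_eq_fderiv]
    have : (⇑(∂_{d} φ : 𝓓(Ω, ℝ)) : Plane → ℝ) = fun y => fderiv ℝ φ y d :=
      funext fun y => lineDerivOp_apply_eq_fderiv φ d y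
    rw [this]
    have hd : DifferentiableAt ℝ (fderiv ℝ φ) x :=
      ((φ.contDiff.fderiv_right (m := 1) (WithTop.coe_le_coe.2 (le_top : (2 : ℕ∞) ≤ ⊤))).differentiable one_ne_zero) x
    rw [fderiv_clm_apply hd (differentiableAt_const d)]
    simp
  rw [key, key]
  exact (φ.contDiff.contDiffAt.isSymmSndFDerivAt (by
    rw [minSmoothness_of_isRCLikeNormedField]; exact WithTop.coe_le_coe.2 (le_top : (2 : ℕ∞) ≤ ⊤))) a b

theorem setIntegral_mul_eq_integral {f φ : Plane → ℝ} (hφ : tsupport φ ⊆ Ω) :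
    ∫ x in (Ω : Set Plane), f x * φ x = ∫ x, f x * φ x :=
  setIntegral_eq_integral_of_forall_compl_eq_zero fun x hx => by
    rw [image_eq_zero_of_notMem_tsupport fun h => hx (hφ h), mul_zero]

theorem integrable_mul_of_isTest {f φ : Plane → ℝ}
    (hf : LocallyIntegrableOn f (Ω : Set Plane)) (hφ : IsTest Ω φ) :
    Integrable fun x => f x * φ x := by
  have hK : IsCompact (tsupport φ) := hφ.hasCompactSupport
  have h1 : IntegrableOn (fun x => φ x * f x) (tsupport φ) :=
    (hf.integrableOn_compact_subset hφ.tsupport_subset hK).continuousOn_mul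
      hφ.contDiff.continuous.continuousOn hK
  have h2 := (integrableOn_iff_integrable_of_support_subset fun x hx => ?_).1 h1
  · simpa only [mul_comm] using h2
  · exact subset_tsupport φ (left_ne_zero_of_mul hx)

theorem IsWeakDeriv.hasWeakDeriv {f g : Plane → ℝ} {i : Fin 2} (h : IsWeakDeriv Ω i f g) :
    HasWeakDeriv Ω (stdVec i) f g := fun φ hφ => by
  have key := h.2.2 hφ.toTestFunction
  rw [setIntegral_mul_eq_integral (TestFunction.tsupport_subset _),
    setIntegral_mul_eq_integral (TestFunction.tsupport_subset _)] at key
  simpa only [TestFunction.lineDerivOp_apply_eq_fderiv] using! key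

/-- The weak derivatives in the Euler system and those in the Sobolev hypothesis are given
separately; the fundamental lemma of the calculus of variations identifies them, so square
integrability transfers. -/
theorem IsWeakDeriv.ae_eq {f g g' : Plane → ℝ} {i : Fin 2} (h : IsWeakDeriv Ω i f g)
    (h' : IsWeakDeriv Ω i f g') : ∀ᵐ x, x ∈ (Ω : Set Plane) → g x = g' x := by
  have := Ω.isOpen.ae_eq_zero_of_integral_contDiff_smul_eq_zero (h.2.1.sub h'.2.1)
    fun φ h1 h2 h3 => by
      have hφ : IsTest Ω φ := ⟨h1, h2, h3⟩
      have e1 := h.hasWeakDeriv φ hφ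
      have e2 := h'.hasWeakDeriv φ hφ
      have e3 : ∀ x, φ x • (g - g') x = g x * φ x - g' x * φ x := fun x => by
        simp only [smul_eq_mul, Pi.sub_apply]; ring
      simp only [e3]
      rw [integral_sub (integrable_mul_of_isTest h.2.1 hφ) (integrable_mul_of_isTest h'.2.1 hφ)]
      linarith
  filter_upwards [this] with x hx hxΩ
  exact sub_eq_zero.1 (hx hxΩ)

end TestFunctions

/-- A continuous weak solution of the Euler system is a planar flow. -/
theorem IsSteadyEuler.exists_planarFlow {Ω : Opens Plane} {v : Plane → Plane}
    (hE : IsSteadyEuler Ω v) (hH1 : ∀ i, MemSobolevLocBar Ω 2 1 (fun x => v x i))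
    (hcont : ContinuousOn v (closure (Ω : Set Plane)))
    (hslip : ∀ x ∈ frontier (Ω : Set Plane), v x 1 = 0) : ∃ g, PlanarFlow Ω v g := by
  obtain ⟨G, P, hG, hdiv, heq⟩ := hE
  refine ⟨G, hcont, fun j i => (hG j i).hasWeakDeriv, fun j i R => ?_, hdiv, fun φ hφ => ?_, hslip⟩
  · obtain ⟨g', hg', hL⟩ := (hH1 i).2 j
    refine (memLp_congr_ae ?_).1 (hL R)
    have hm : MeasurableSet ((Ω : Set Plane) ∩ ball 0 R) :=
      (Ω.isOpen.inter isOpen_ball).measurableSet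
    refine (ae_restrict_iff' hm).2 ?_
    filter_upwards [hg'.ae_eq (hG j i)] with x hx hxΩ
    exact hx hxΩ.1
  · have hvc : ∀ i, ContinuousOn (fun x => v x i) (Ω : Set Plane) := fun i =>
      (EuclideanSpace.proj (𝕜 := ℝ) i).continuous.comp_continuousOn (hcont.mono subset_closure)
    have hconv : ∀ i, LocallyIntegrableOn (fun x => v x 0 * G 0 i x + v x 1 * G 1 i x)
        (Ω : Set Plane) := fun i =>
      ((hG 0 i).2.1.continuousOn_mul (hvc 0) Ω.isOpen.isLocallyClosed).add
        ((hG 1 i).2.1.continuousOn_mul (hvc 1) Ω.isOpen.isLocallyClosed)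
    set Φ : 𝓓(Ω, ℝ) := hφ.toTestFunction with hΦ
    -- Test the first equation with ∂₂Φ and the second with ∂₁Φ: by symmetry of second derivatives
    -- the pressure terms coincide and cancel in the difference. Replacing ∂₁v₁ by −∂₂v₂ turns what
    -- remains into the divergence of J.
    have h0 := heq 0 (∂_{stdVec 1} Φ)
    have h1 := heq 1 (∂_{stdVec 0} Φ)
    rw [Distribution.lineDerivOp_apply_apply, map_neg] at h0 h1
    rw [TestFunction.lineDerivOp_comm Φ (stdVec 1) (stdVec 0)] at h1
    rw [setIntegral_mul_eq_integral (TestFunction.tsupport_subset _)] at h0 h1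
    have hsum : ∫ x, ((v x 0 * G 0 1 x + v x 1 * G 1 1 x) * (∂_{stdVec 0} Φ) x -
        (v x 0 * G 0 0 x + v x 1 * G 1 0 x) * (∂_{stdVec 1} Φ) x) = 0 := by
      rw [integral_sub (integrable_mul_of_isTest (hconv 1) (TestFunction.isTest _))
        (integrable_mul_of_isTest (hconv 0) (TestFunction.isTest _))]
      linarith
    rw [← hsum]
    refine integral_congr_ae ?_
    filter_upwards [(ae_restrict_iff' Ω.isOpen.measurableSet).1 hdiv] with x hx
    have e : ∀ j, (∂_{stdVec j} Φ) x = fderiv ℝ φ x (stdVec j) := fun j =>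
      TestFunction.lineDerivOp_apply_eq_fderiv Φ _ x
    rw [Fin.sum_univ_two, e, e]
    by_cases hxt : x ∈ tsupport φ
    · have h3 : G 0 0 x = - G 1 1 x := by linarith [hx (hφ.tsupport_subset hxt)]
      simp only [angularField, h3]; ring
    · have : fderiv ℝ φ x = 0 := by
        by_contra hne
        exact hxt (support_fderiv_subset ℝ hne)
      simp [this]

/-- Reversing a planar flow gives a planar flow. -/
theorem PlanarFlow.neg {Ω : Opens Plane} {v : Plane → Plane} {g : Fin 2 → Fin 2 → Plane → ℝ}
    (h : PlanarFlow Ω v g) : PlanarFlow Ω (fun x => -v x) (fun j i x => -g j i x) where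
  cont := h.cont.neg
  weak j i φ hφ := by
    have := h.weak j i φ hφ
    simp only [PiLp.neg_apply, neg_mul, integral_neg, this]
  memLp j i R := (h.memLp j i R).neg
  div := by filter_upwards [h.div] with x hx; linarith
  angular φ hφ := by
    rw [← h.angular φ hφ]
    simp [angularField]
  slip x hx := by simp [h.slip x hx]

/-! ### The growth conditions imply slow growth of the energy -/

theorem SlowGrowth.neg {Ω : Opens Plane} {v : Plane → Plane} (h : SlowGrowth Ω v) :
    SlowGrowth Ω (fun x => -v x) := by
  have : ∀ x, Complex.normSq (cvel (fun x => -v x) x) = Complex.normSq (cvel v x) := fun x => by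
    simp [normSq_cvel]
  simpa only [SlowGrowth, this] using h

theorem normSq_cvel_eq_norm_sq (v : Plane → Plane) (x : Plane) :
    Complex.normSq (cvel v x) = ‖v x‖ ^ 2 := by
  rw [normSq_cvel, EuclideanSpace.real_norm_sq_eq, Fin.sum_univ_two]; ring

theorem volume_box {a b : Fin 2 → ℝ} (hab : a ≤ b) :
    volume {x : Plane | ∀ i, x i ∈ Icc (a i) (b i)} < ⊤ ∧
      volume.real {x : Plane | ∀ i, x i ∈ Icc (a i) (b i)} = (b 0 - a 0) * (b 1 - a 1) := by
  have e : {x : Plane | ∀ i, x i ∈ Icc (a i) (b i)} = WithLp.ofLp ⁻¹' Icc a b := by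
    ext x
    simp [Pi.le_def, forall_and]
  have hvol := (PiLp.volume_preserving_ofLp (Fin 2)).measure_preimage
    (measurableSet_Icc (a := a) (b := b)).nullMeasurableSet
  rw [e, Measure.real, hvol]
  refine ⟨isCompact_Icc.measure_lt_top, ?_⟩
  rw [Real.volume_Icc_pi_toReal hab, Fin.prod_univ_two]

theorem setIntegral_normSq_cvel_le {v : Plane → Plane} {S : Set Plane} {a b : Fin 2 → ℝ} {M : ℝ}
    (hM : 0 ≤ M) (hab : a ≤ b) (hS : ∀ x ∈ S, ∀ i, x i ∈ Icc (a i) (b i))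
    (hv : ∀ x ∈ S, ‖v x‖ ^ 2 ≤ M) :
    ∫ x in S, Complex.normSq (cvel v x) ≤ M * ((b 0 - a 0) * (b 1 - a 1)) := by
  obtain ⟨hfin, hreal⟩ := volume_box hab
  have hle := norm_setIntegral_le_of_norm_le_const (μ := (volume : Measure Plane)) (s := S)
    (f := fun x => Complex.normSq (cvel v x)) (C := M) ((measure_mono hS).trans_lt hfin)
    fun x hx => by
      rw [Real.norm_of_nonneg (Complex.normSq_nonneg _), normSq_cvel_eq_norm_sq]
      exact hv x hx
  refine (Real.le_norm_self _).trans (hle.trans (mul_le_mul_of_nonneg_left ?_ hM))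
  rw [← hreal]
  exact measureReal_mono hS hfin.ne

theorem hundred_lt_two_pow {j : ℕ} (hj : 6 ≤ j) : (100 : ℝ) < 2 ^ (j + 1) :=
  calc (100 : ℝ) < 2 ^ 7 := by norm_num
    _ ≤ 2 ^ (j + 1) := pow_le_pow_right₀ one_le_two (by omega)

theorem abs_apply_le_of_mem_ball {x : Plane} {R : ℝ} (hx : x ∈ ball (0 : Plane) R) (i : Fin 2) :
    x i ∈ Icc (-R) R :=
  abs_le.1 ((PiLp.norm_apply_le x i).trans (mem_ball_zero_iff.1 hx).le)

/-- In the strip |v|² = O(R) on a set of area 4R, so the energy is O(R²) even without the logarithm.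
-/
theorem StripGrowth.slowGrowth {v : Plane → Plane} (h : StripGrowth v) : SlowGrowth strip v := by
  obtain ⟨C, hC, h⟩ := h
  -- The first j with 2 ^ (j + 1) > 100 is 6. The constant comes from C²R · 4R with R² = 4 · 4 ^ j.
  refine ⟨16 * C ^ 2, 6, fun j hj => ?_⟩
  set R : ℝ := 2 ^ (j + 1) with hR
  have hR100 : 100 < R := hundred_lt_two_pow hj
  have hR0 : 0 ≤ R := by linarith
  have hmem : ∀ x ∈ (strip : Set Plane) ∩ ball 0 R, x 0 ∈ Icc (-R) R ∧ x 1 ∈ Icc (-1 : ℝ) 1 :=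
    fun x hx => ⟨abs_apply_le_of_mem_ball hx.2 0, hx.1.1.le, hx.1.2.le⟩
  have := setIntegral_normSq_cvel_le (v := v) (S := (strip : Set Plane) ∩ ball 0 R)
    (a := ![-R, -1]) (b := ![R, 1]) (M := C ^ 2 * R) (by positivity)
    (by rw [Pi.le_def, Fin.forall_fin_two]; simp; linarith)
    (fun x hx => by rw [Fin.forall_fin_two]; exact hmem x hx)
    (fun x hx => by
      calc ‖v x‖ ^ 2 ≤ (C * Real.sqrt R) ^ 2 :=
            pow_le_pow_left₀ (norm_nonneg _) (h R hR100 x (hmem x hx).1 (hmem x hx).2) 2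
        _ = C ^ 2 * R := by rw [mul_pow, Real.sq_sqrt hR0])
  refine this.trans ?_
  have hR2 : R * R = 4 * 4 ^ j := by
    rw [hR, ← mul_pow, pow_succ]; norm_num; ring
  have hx : C ^ 2 * R * ((![R, 1] 0 - ![-R, -1] 0) * (![R, 1] 1 - ![-R, -1] 1))
      = 16 * C ^ 2 * 4 ^ j := by
    simp only [Matrix.cons_val_zero, Matrix.cons_val_one]
    linear_combination 4 * C ^ 2 * hR2
  rw [hx]
  refine mul_le_mul_of_nonneg_left ?_ (by positivity)
  nlinarith [pow_pos (show (0 : ℝ) < 4 by norm_num) j, (Nat.cast_nonneg j : (0 : ℝ) ≤ j)]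

/-- Here the area is of order R², and log R ≤ j + 1 at R = 2 ^ (j + 1) uses up the whole logarithmic
factor. -/
theorem HalfPlaneGrowth.slowGrowth {v : Plane → Plane} (h : HalfPlaneGrowth v) :
    SlowGrowth upperHalfPlane v := by
  obtain ⟨C, hC, h⟩ := h
  refine ⟨16 * C ^ 2, 6, fun j hj => ?_⟩
  set R : ℝ := 2 ^ (j + 1) with hR
  have hR100 : 100 < R := hundred_lt_two_pow hj
  have hlog0 : 0 ≤ Real.log R := Real.log_nonneg (by linarith)
  have hlog : Real.log R ≤ j + 1 := by
    rw [hR, Real.log_pow]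
    push_cast
    have : Real.log 2 ≤ 1 := by linarith [Real.log_two_lt_d9]
    nlinarith [(Nat.cast_nonneg j : (0 : ℝ) ≤ j)]
  have := setIntegral_normSq_cvel_le (v := v) (S := (upperHalfPlane : Set Plane) ∩ ball 0 R)
    (a := fun _ => -R) (b := fun _ => R) (M := C ^ 2 * Real.log R) (by positivity)
    (fun _ => by show -R ≤ R; linarith) (fun x hx i => abs_apply_le_of_mem_ball hx.2 i)
    (fun x hx => by
      calc ‖v x‖ ^ 2 ≤ (C * Real.sqrt (Real.log R)) ^ 2 :=
            pow_le_pow_left₀ (norm_nonneg _)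
              (h R hR100 x hx.1 (mem_ball_zero_iff.1 hx.2).le) 2
        _ = C ^ 2 * Real.log R := by rw [mul_pow, Real.sq_sqrt hlog0])
  refine this.trans ?_
  have hR2 : R * R = 4 * 4 ^ j := by
    rw [hR, ← mul_pow, pow_succ]; norm_num; ring
  have hx : C ^ 2 * Real.log R * ((R - -R) * (R - -R)) = 16 * C ^ 2 * (4 ^ j * Real.log R) := by
    linear_combination 4 * C ^ 2 * Real.log R * hR2
  rw [hx]
  gcongr

/-! ### Flat domains: the strip and the half-plane -/

/-- The horizontal line at height `b` is a part of the boundary of `Ω`, next to which the domain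
contains a strip of width `δ` in the direction `σ = ± 1`. -/
structure IsWall (Ω : Opens Plane) (b σ δ : ℝ) : Prop where
  sign : σ = 1 ∨ σ = -1
  pos : 0 < δ
  mem_frontier : ∀ x, planePt x b ∈ frontier (Ω : Set Plane)
  mem : ∀ x, ∀ r ∈ Ioo 0 δ, planePt x (b + σ * r) ∈ Ω

/-- `Ω` is a horizontal strip or a half-plane bounded below. -/
structure IsFlatDomain (Ω : Opens Plane) : Prop where
  add_mem : ∀ x ∈ Ω, ∀ t : ℝ, x + t • stdVec 0 ∈ Ω
  exists_sub_notMem : ∀ x ∈ Ω, ∀ c : ℝ, ∃ t : ℝ, 0 ≤ t ∧ x - t • (c • stdVec 0 + stdVec 1) ∉ Ω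
  exists_wall : ∀ x ∈ Ω, ∃ b σ δ, IsWall Ω b σ δ ∧ ∃ s ∈ Ioo 0 δ, x 1 = b + σ * s
  exists_wall_frontier : ∀ x ∈ frontier (Ω : Set Plane), ∃ σ δ, IsWall Ω (x 1) σ δ

theorem IsWall.of_notMem {Ω : Opens Plane} {b σ δ : ℝ} (hσ : σ = 1 ∨ σ = -1) (hδ : 0 < δ)
    (hb : ∀ x, planePt x b ∉ Ω) (hmem : ∀ x, ∀ r ∈ Ioo 0 δ, planePt x (b + σ * r) ∈ Ω) :
    IsWall Ω b σ δ where
  sign := hσ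
  pos := hδ
  mem_frontier x := by
    rw [Ω.isOpen.frontier_eq]
    refine ⟨?_, hb x⟩
    have hc : Continuous fun r : ℝ => planePt x (b + σ * r) := by fun_prop
    have h0 : (0 : ℝ) ∈ closure (Ioo 0 δ) := by
      rw [closure_Ioo hδ.ne]; exact left_mem_Icc.2 hδ.le
    have := map_mem_closure hc h0 (t := (Ω : Set Plane)) fun r hr => hmem x r hr
    simpa using this
  mem := hmem

theorem mem_strip {x : Plane} : x ∈ strip ↔ -1 < x 1 ∧ x 1 < 1 := Iff.rfl

theorem mem_upperHalfPlane {x : Plane} : x ∈ upperHalfPlane ↔ 0 < x 1 := Iff.rfl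

theorem isFlatDomain_strip : IsFlatDomain strip := by
  have hbot : IsWall strip (-1) 1 2 := IsWall.of_notMem (Or.inl rfl) two_pos
    (fun x => by simp [mem_strip]) fun x r hr => by
      rw [mem_strip, planePt_one]; constructor <;> linarith [hr.1, hr.2]
  have htop : IsWall strip 1 (-1) 2 := IsWall.of_notMem (Or.inr rfl) two_pos
    (fun x => by simp [mem_strip]) fun x r hr => by
      rw [mem_strip, planePt_one]; constructor <;> linarith [hr.1, hr.2]
  -- Descending by the full width 2 leaves the strip, and the lower wall with δ = 2 reaches every
  -- interior point.
  refine ⟨fun x hx t => ?_, fun x hx c => ⟨2, zero_le_two, ?_⟩, fun x hx =>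
    ⟨-1, 1, 2, hbot, x 1 + 1, ?_, by ring⟩, fun x hx => ?_⟩
  · simpa [mem_strip, stdVec] using hx
  · rw [mem_strip] at hx ⊢
    simp only [stdVec, PiLp.sub_apply, PiLp.smul_apply, PiLp.add_apply, PiLp.single_apply]
    simp
    intro h
    linarith
  · rw [mem_strip] at hx
    constructor <;> linarith
  · rw [strip.isOpen.frontier_eq] at hx
    have hcl : IsClosed ((fun x : Plane => x 1) ⁻¹' Icc (-1) 1) := isClosed_Icc.preimage (by fun_prop)
    have hsub : (strip : Set Plane) ⊆ (fun x : Plane => x 1) ⁻¹' Icc (-1) 1 :=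
      fun y hy => ⟨hy.1.le, hy.2.le⟩
    have h1 : -1 ≤ x 1 ∧ x 1 ≤ 1 := closure_minimal hsub hcl hx.1
    have h2 : ¬ (-1 < x 1 ∧ x 1 < 1) := hx.2
    rcases h1.1.eq_or_lt with h | h
    · rw [← h]; exact ⟨1, 2, hbot⟩
    · rw [le_antisymm h1.2 (not_lt.1 fun h' => h2 ⟨h, h'⟩)]; exact ⟨-1, 2, htop⟩

theorem isFlatDomain_upperHalfPlane : IsFlatDomain upperHalfPlane := by
  have hbot : ∀ δ : ℝ, 0 < δ → IsWall upperHalfPlane 0 1 δ := fun δ hδ =>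
    IsWall.of_notMem (Or.inl rfl) hδ (fun x => by simp [mem_upperHalfPlane]) fun x r hr => by
      rw [mem_upperHalfPlane, planePt_one]; linarith [hr.1]
  refine ⟨fun x hx t => ?_, fun x hx c => ⟨x 1, le_of_lt hx, ?_⟩, fun x hx =>
    ⟨0, 1, x 1 + 1, hbot _ ?_, x 1, ?_, by ring⟩, fun x hx => ?_⟩
  · simpa [mem_upperHalfPlane, stdVec] using hx
  · simp [mem_upperHalfPlane, stdVec]
  · rw [mem_upperHalfPlane] at hx
    linarith
  · rw [mem_upperHalfPlane] at hx
    constructor <;> linarith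
  · rw [upperHalfPlane.isOpen.frontier_eq] at hx
    have hcl : IsClosed ((fun x : Plane => x 1) ⁻¹' Ici 0) := isClosed_Ici.preimage (by fun_prop)
    have hsub : (upperHalfPlane : Set Plane) ⊆ (fun x : Plane => x 1) ⁻¹' Ici 0 :=
      fun y hy => show 0 ≤ y 1 from le_of_lt hy
    have h1 : 0 ≤ x 1 := closure_minimal hsub hcl hx.1
    have h2 : ¬ (0 < x 1) := hx.2
    rw [le_antisymm (not_lt.1 h2) h1]
    exact ⟨1, 1, hbot 1 one_pos⟩

/-! ### Flow angles and arcs of the circle -/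

section Angles

variable {v : Plane → Plane} {A : Set Plane}

theorem norm_cvel (v : Plane → Plane) (x : Plane) : ‖cvel v x‖ = ‖v x‖ := by
  rw [← sq_eq_sq₀ (norm_nonneg _) (norm_nonneg _), ← normSq_cvel_eq_norm_sq, Complex.normSq_eq_norm_sq]

theorem cos_sin_arg_mem_flowAngles {x : Plane} (hx : x ∈ A) (h0 : cvel v x ≠ 0) :
    !₂[Real.cos (cvel v x).arg, Real.sin (cvel v x).arg] ∈ flowAngles v A := by
  have hpos : 0 < ‖v x‖ := by rw [← norm_cvel]; exact norm_pos_iff.2 h0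
  refine ⟨x, hx, hpos, ?_⟩
  have hc := Complex.norm_mul_cos_arg (cvel v x)
  have hs := Complex.norm_mul_sin_arg (cvel v x)
  rw [norm_cvel] at hc hs
  ext i
  fin_cases i
  · show Real.cos (cvel v x).arg = ‖v x‖⁻¹ * v x 0
    rw [eq_inv_mul_iff_mul_eq₀ hpos.ne']; exact hc
  · show Real.sin (cvel v x).arg = ‖v x‖⁻¹ * v x 1
    rw [eq_inv_mul_iff_mul_eq₀ hpos.ne']; exact hs

theorem flowAngles_subset_unitCircle : flowAngles v A ⊆ unitCircle := by
  rintro _ ⟨x, -, hpos, rfl⟩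
  rw [unitCircle, mem_sphere_zero_iff_norm, norm_smul, norm_inv, norm_norm,
    inv_mul_cancel₀ hpos.ne']

theorem neg_mem_flowAngles {z : Plane} (hz : z ∈ flowAngles (fun x => -v x) A) :
    -z ∈ flowAngles v A := by
  obtain ⟨x, hx, hpos, rfl⟩ := hz
  exact ⟨x, hx, by simpa using hpos, by simp⟩

/-- Reversing the flow rotates every angle by π; this carries statements about the upper semicircle
over to the lower one. -/
theorem cos_sin_mem_flowAngles_of_neg {τ : ℝ}
    (h : !₂[Real.cos (τ + Real.pi), Real.sin (τ + Real.pi)] ∈ flowAngles (fun x => -v x) A) :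
    !₂[Real.cos τ, Real.sin τ] ∈ flowAngles v A := by
  have : !₂[Real.cos τ, Real.sin τ] = -!₂[Real.cos (τ + Real.pi), Real.sin (τ + Real.pi)] := by
    ext i
    fin_cases i <;> simp
  rw [this]
  exact neg_mem_flowAngles h

theorem exists_eq_cos_sin {z : Plane} (hz : z ∈ unitCircle) :
    ∃ τ ∈ Ioc (-Real.pi) Real.pi, z = !₂[Real.cos τ, Real.sin τ] := by
  rw [unitCircle, mem_sphere_zero_iff_norm] at hz
  have hn : ‖cvel id z‖ = 1 := by rw [norm_cvel]; exact hz
  have hc := Complex.norm_mul_cos_arg (cvel id z)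
  have hs := Complex.norm_mul_sin_arg (cvel id z)
  rw [hn, one_mul] at hc hs
  refine ⟨(cvel id z).arg, Complex.arg_mem_Ioc _, ?_⟩
  ext i
  fin_cases i
  · exact hc.symm
  · exact hs.symm

theorem cos_sin_mem_unitCircle (τ : ℝ) : !₂[Real.cos τ, Real.sin τ] ∈ unitCircle := by
  rw [unitCircle, mem_sphere_zero_iff_norm, EuclideanSpace.norm_eq, Fin.sum_univ_two]
  simp

theorem mem_upperSemicircle {z : Plane} :
    z ∈ upperSemicircle ↔ ∃ τ ∈ Icc 0 Real.pi, z = !₂[Real.cos τ, Real.sin τ] := by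
  have h1 : -Real.pi + Real.pi / 2 + Real.pi / 2 = 0 := by ring
  have h2 : Real.pi - Real.pi / 2 + Real.pi / 2 = Real.pi := by ring
  simp only [upperSemicircle, arc, mem_ofPred_eq, h1, h2, mem_Icc, and_assoc]

theorem mem_lowerSemicircle {z : Plane} :
    z ∈ lowerSemicircle ↔ ∃ τ ∈ Icc (-Real.pi) 0, z = !₂[Real.cos τ, Real.sin τ] := by
  have h1 : -Real.pi + Real.pi / 2 + -(Real.pi / 2) = -Real.pi := by ring
  have h2 : Real.pi - Real.pi / 2 + -(Real.pi / 2) = 0 := by ring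
  simp only [lowerSemicircle, arc, mem_ofPred_eq, h1, h2, mem_Icc, and_assoc]

theorem mem_upperSemicircle_iff {z : Plane} : z ∈ upperSemicircle ↔ z ∈ unitCircle ∧ 0 ≤ z 1 := by
  rw [mem_upperSemicircle]
  constructor
  · rintro ⟨τ, hτ, rfl⟩
    exact ⟨cos_sin_mem_unitCircle τ, Real.sin_nonneg_of_mem_Icc hτ⟩
  · rintro ⟨hz, h0⟩
    obtain ⟨τ, hτ, rfl⟩ := exists_eq_cos_sin hz
    refine ⟨τ, ⟨?_, hτ.2⟩, rfl⟩
    by_contra! hneg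
    exact absurd (Real.sin_neg_of_neg_of_neg_pi_lt hneg hτ.1) (not_lt.2 h0)

theorem mem_lowerSemicircle_iff {z : Plane} : z ∈ lowerSemicircle ↔ z ∈ unitCircle ∧ z 1 ≤ 0 := by
  rw [mem_lowerSemicircle]
  constructor
  · rintro ⟨τ, hτ, rfl⟩
    exact ⟨cos_sin_mem_unitCircle τ, Real.sin_nonpos_of_nonpos_of_neg_pi_le hτ.2 hτ.1⟩
  · rintro ⟨hz, h0⟩
    obtain ⟨τ, hτ, rfl⟩ := exists_eq_cos_sin hz
    rcases hτ.2.eq_or_lt with h | h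
    -- The angle π is the one value in (−π, π] whose point lies on the lower semicircle but which
    -- must be renamed, as −π.
    · exact ⟨-Real.pi, ⟨le_rfl, by linarith [Real.pi_pos]⟩, by simp [h]⟩
    refine ⟨τ, ⟨hτ.1.le, ?_⟩, rfl⟩
    by_contra! hpos
    exact absurd (Real.sin_pos_of_pos_of_lt_pi hpos h) (not_lt.2 h0)

theorem neg_cos_le_cos {θ β : ℝ} (hβ : 0 < β) (h1 : -Real.pi + β ≤ θ)
    (h2 : θ ≤ Real.pi - β) : -Real.cos β ≤ Real.cos θ := by
  rw [← Real.cos_pi_sub, ← Real.cos_abs θ]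
  exact Real.cos_le_cos_of_nonneg_of_le_pi (abs_nonneg θ) (by linarith)
    (abs_le.2 ⟨by linarith, h2⟩)

theorem neg_cos_le_of_mem_arc_zero {β : ℝ} (hβ : 0 < β) {z : Plane} (hz : z ∈ arc 0 β) :
    -Real.cos β ≤ z 0 := by
  obtain ⟨θ, h1, h2, rfl⟩ := hz
  exact neg_cos_le_cos hβ (by linarith) (by linarith)

theorem le_cos_of_mem_arc_pi {β : ℝ} (hβ : 0 < β) {z : Plane} (hz : z ∈ arc Real.pi β) :
    z 0 ≤ Real.cos β := by
  obtain ⟨θ, h1, h2, rfl⟩ := hz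
  have := neg_cos_le_cos hβ (θ := θ - Real.pi) (by linarith) (by linarith)
  rw [Real.cos_sub_pi] at this
  show Real.cos θ ≤ Real.cos β
  linarith

end Angles

/-! ### The flow angles of a flow in a flat domain -/

namespace PlanarFlow

variable {Ω : Opens Plane} {v : Plane → Plane} {g : Fin 2 → Fin 2 → Plane → ℝ}

theorem exists_arg_eq (h : PlanarFlow Ω v g) (hs : SlowGrowth Ω v) (hΩ : IsFlatDomain Ω)
    {x : Plane} (hx : x ∈ Ω) (hpos : 0 < v x 1) {τ : ℝ} (hτ : τ ∈ Icc 0 Real.pi) :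
    ∃ y ∈ closure (Ω : Set Plane), cvel v y ≠ 0 ∧ (cvel v y).arg = τ := by
  by_contra! hcon
  exact absurd (h.apply_one_nonpos hs hΩ.exists_sub_notMem hτ.1 hτ.2 hcon hx) (not_le.2 hpos)

theorem upperSemicircle_subset (h : PlanarFlow Ω v g) (hs : SlowGrowth Ω v) (hΩ : IsFlatDomain Ω)
    {x : Plane} (hx : x ∈ Ω) (hpos : 0 < v x 1) :
    upperSemicircle ⊆ flowAngles v (closure (Ω : Set Plane)) := fun z hz => by
  obtain ⟨τ, hτ, rfl⟩ := mem_upperSemicircle.1 hz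
  obtain ⟨y, hy, h0, rfl⟩ := h.exists_arg_eq hs hΩ hx hpos hτ
  exact cos_sin_arg_mem_flowAngles hy h0

theorem lowerSemicircle_subset (h : PlanarFlow Ω v g) (hs : SlowGrowth Ω v) (hΩ : IsFlatDomain Ω)
    {x : Plane} (hx : x ∈ Ω) (hneg : v x 1 < 0) :
    lowerSemicircle ⊆ flowAngles v (closure (Ω : Set Plane)) := fun z hz => by
  obtain ⟨τ, hτ, rfl⟩ := mem_lowerSemicircle.1 hz
  refine cos_sin_mem_flowAngles_of_neg (h.neg.upperSemicircle_subset hs.neg hΩ hx (by simpa using hneg)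
    (mem_upperSemicircle.2 ⟨τ + Real.pi, ⟨by linarith [hτ.1], by linarith [hτ.2]⟩, rfl⟩))

/-- If the flow angles omit a point of each of the semicircles, then the flow is a shear flow. -/
theorem isShearFlow_of_notMem (h : PlanarFlow Ω v g) (hs : SlowGrowth Ω v) (hΩ : IsFlatDomain Ω)
    {τ : ℝ} (hτ : τ ∈ Icc 0 Real.pi)
    (h1 : !₂[Real.cos τ, Real.sin τ] ∉ flowAngles v (closure (Ω : Set Plane)))
    (h2 : !₂[Real.cos (-τ), Real.sin (-τ)] ∉ flowAngles v (closure (Ω : Set Plane))) :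
    IsShearFlow Ω v := by
  refine h.isShearFlow hΩ.add_mem fun x hx => le_antisymm ?_ ?_
  · by_contra! hpos
    exact h1 (h.upperSemicircle_subset hs hΩ hx hpos (mem_upperSemicircle.2 ⟨τ, hτ, rfl⟩))
  · by_contra! hneg
    exact h2 (h.lowerSemicircle_subset hs hΩ hx hneg
      (mem_lowerSemicircle.2 ⟨-τ, ⟨by linarith [hτ.2], by linarith [hτ.1]⟩, rfl⟩))

/-- The gap of the arc has half-width β around (−1, 0) or (1, 0). The pair of angles ±(π − β/2), or
±β/2, lies strictly inside it and has one member in each semicircle; comparing cosines shows that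
neither is attained. -/
theorem isShearFlow_of_flowAngles_subset (h : PlanarFlow Ω v g) (hs : SlowGrowth Ω v)
    (hΩ : IsFlatDomain Ω) {β : ℝ} (hβ : 0 < β) (hβπ : β < Real.pi)
    (hsub : flowAngles v (closure (Ω : Set Plane)) ⊆ arc 0 β ∨
      flowAngles v (closure (Ω : Set Plane)) ⊆ arc Real.pi β) : IsShearFlow Ω v := by
  have hcos : Real.cos β < Real.cos (β / 2) :=
    Real.cos_lt_cos_of_nonneg_of_le_pi (by linarith) hβπ.le (by linarith)
  rcases hsub with hsub | hsub
  · have hout : ∀ τ : ℝ, Real.cos τ = -Real.cos (β / 2) →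
        !₂[Real.cos τ, Real.sin τ] ∉ flowAngles v (closure (Ω : Set Plane)) := fun τ hτ hm => by
      have : -Real.cos β ≤ Real.cos τ := neg_cos_le_of_mem_arc_zero hβ (hsub hm)
      linarith
    exact h.isShearFlow_of_notMem hs hΩ (τ := Real.pi - β / 2) ⟨by linarith, by linarith⟩
      (hout _ (Real.cos_pi_sub _)) (hout _ (by rw [Real.cos_neg, Real.cos_pi_sub]))
  · have hout : ∀ τ : ℝ, Real.cos τ = Real.cos (β / 2) →
        !₂[Real.cos τ, Real.sin τ] ∉ flowAngles v (closure (Ω : Set Plane)) := fun τ hτ hm => by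
      have : Real.cos τ ≤ Real.cos β := le_cos_of_mem_arc_pi hβ (hsub hm)
      linarith
    exact h.isShearFlow_of_notMem hs hΩ (τ := β / 2) ⟨by linarith, by linarith⟩
      (hout _ rfl) (hout _ (Real.cos_neg _))

theorem apply_one_eq_zero_of_notMem (h : PlanarFlow Ω v g) {x : Plane}
    (hx : x ∈ closure (Ω : Set Plane)) (hxΩ : x ∉ Ω) : v x 1 = 0 :=
  h.slip x (by rw [Ω.isOpen.frontier_eq]; exact ⟨hx, hxΩ⟩)

/-- The flow angles of a flow in a flat domain which is not a shear flow. -/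
theorem flowAngles_trichotomy (h : PlanarFlow Ω v g) (hs : SlowGrowth Ω v) (hΩ : IsFlatDomain Ω) :
    IsShearFlow Ω v ∨ flowAngles v (closure (Ω : Set Plane)) = unitCircle ∨
      (flowAngles v (closure (Ω : Set Plane)) = upperSemicircle ∨
        flowAngles v (closure (Ω : Set Plane)) = lowerSemicircle) := by
  by_cases hpos : ∃ x ∈ Ω, 0 < v x 1
  · obtain ⟨x, hx, hvx⟩ := hpos
    have hup := h.upperSemicircle_subset hs hΩ hx hvx
    by_cases hneg : ∃ x ∈ Ω, v x 1 < 0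
    · obtain ⟨y, hy, hvy⟩ := hneg
      have hlow := h.lowerSemicircle_subset hs hΩ hy hvy
      refine Or.inr (Or.inl (flowAngles_subset_unitCircle.antisymm fun z hz => ?_))
      rcases le_total 0 (z 1) with h0 | h0
      · exact hup (mem_upperSemicircle_iff.2 ⟨hz, h0⟩)
      · exact hlow (mem_lowerSemicircle_iff.2 ⟨hz, h0⟩)
    · push Not at hneg
      refine Or.inr (Or.inr (Or.inl (Subset.antisymm (fun z hz => ?_) hup)))
      refine mem_upperSemicircle_iff.2 ⟨flowAngles_subset_unitCircle hz, ?_⟩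
      obtain ⟨y, hy, -, rfl⟩ := hz
      refine mul_nonneg (inv_nonneg.2 (norm_nonneg _)) ?_
      by_cases hyΩ : y ∈ Ω
      · exact hneg y hyΩ
      · exact (h.apply_one_eq_zero_of_notMem hy hyΩ).ge
  · push Not at hpos
    by_cases hneg : ∃ x ∈ Ω, v x 1 < 0
    · obtain ⟨y, hy, hvy⟩ := hneg
      have hlow := h.lowerSemicircle_subset hs hΩ hy hvy
      refine Or.inr (Or.inr (Or.inr (Subset.antisymm (fun z hz => ?_) hlow)))
      refine mem_lowerSemicircle_iff.2 ⟨flowAngles_subset_unitCircle hz, ?_⟩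
      obtain ⟨y, hy, -, rfl⟩ := hz
      refine mul_nonpos_of_nonneg_of_nonpos (inv_nonneg.2 (norm_nonneg _)) ?_
      by_cases hyΩ : y ∈ Ω
      · exact hpos y hyΩ
      · exact (h.apply_one_eq_zero_of_notMem hy hyΩ).le
    · push Not at hneg
      exact Or.inl (h.isShearFlow hΩ.add_mem fun x hx => le_antisymm (hpos x hx) (hneg x hx))

/-- The vertical component of a periodic flow which is somewhere positive is somewhere
negative. -/
theorem exists_apply_one_neg (h : PlanarFlow Ω v g) (hΩ : IsFlatDomain Ω) {T : ℝ} (hT : 0 < T)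
    (hper : ∀ x ∈ Ω, v (x + T • stdVec 0) = v x) {x : Plane} (hx : x ∈ Ω) (hpos : 0 < v x 1) :
    ∃ y ∈ Ω, v y 1 < 0 := by
  by_contra! hcon
  obtain ⟨b, σ, δ, hw, s, hs, hxs⟩ := hΩ.exists_wall x hx
  have hσ0 : σ ≠ 0 := by rcases hw.sign with rfl | rfl <;> norm_num
  have key := h.integral_apply_one_eq_zero hw.sign hΩ.add_mem hper hw.mem_frontier
    (fun z r hr => hw.mem z r ⟨hr.1, hr.2.trans_lt hs.2⟩) hs.1 (x 0)
  rw [intervalIntegral.integral_const_mul, mul_eq_zero, or_iff_right hσ0, ← hxs] at key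
  have hmem : ∀ z, planePt z (x 1) ∈ Ω := fun z => by rw [hxs]; exact hw.mem z s hs
  have hc : Continuous fun z => v (planePt z (x 1)) 1 :=
    ContinuousOn.comp_continuous (h.continuousOn_apply 1) (by fun_prop)
      fun z => subset_closure (hmem z)
  -- A continuous nonnegative function with a positive value has a positive integral, against the
  -- vanishing flux over one period at this height.
  refine (intervalIntegral.integral_pos (by linarith) hc.continuousOn
    (fun z _ => hcon _ (hmem z)) ⟨x 0, left_mem_Icc.2 (by linarith), ?_⟩).ne' key
  rwa [planePt_self]

/-- A boundary velocity is horizontal, so an angle in (0, π) attained on the closure is attained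
inside. For π, if it were not attained inside, `apply_zero_nonneg_of_frontier` would forbid it on
the boundary too. The angle 0 is left out and is recovered as the angle π of the reversed flow. -/
theorem cos_sin_mem_flowAngles_of_periodic (h : PlanarFlow Ω v g) (hs : SlowGrowth Ω v)
    (hΩ : IsFlatDomain Ω) {T : ℝ} (hT : 0 < T) (hper : ∀ x ∈ Ω, v (x + T • stdVec 0) = v x)
    {x : Plane} (hx : x ∈ Ω) (hpos : 0 < v x 1) {τ : ℝ} (hτ : τ ∈ Ioc 0 Real.pi) :
    !₂[Real.cos τ, Real.sin τ] ∈ flowAngles v (Ω : Set Plane) := by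
  obtain ⟨y, hy, h0, rfl⟩ := h.exists_arg_eq hs hΩ hx hpos (Ioc_subset_Icc_self hτ)
  by_cases hyΩ : y ∈ Ω
  · exact cos_sin_arg_mem_flowAngles hyΩ h0
  have hy1 : (cvel v y).im = 0 := h.apply_one_eq_zero_of_notMem hy hyΩ
  have hre : (cvel v y).re < 0 := by
    by_contra! hre
    exact hτ.1.ne' (Complex.arg_eq_zero_iff.2 ⟨hre, hy1⟩)
  rw [Complex.arg_eq_pi_iff.2 ⟨hre, hy1⟩]
  by_contra hcon
  have hyf : y ∈ frontier (Ω : Set Plane) := by rw [Ω.isOpen.frontier_eq]; exact ⟨hy, hyΩ⟩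
  obtain ⟨σ, δ, hw⟩ := hΩ.exists_wall_frontier y hyf
  have key := h.apply_zero_nonneg_of_frontier hw.sign hΩ.add_mem hT hper hw.mem_frontier hw.pos
    hw.mem (fun z hz hz1 => by
      by_contra! hz0
      have harg : (cvel v z).arg = Real.pi := Complex.arg_eq_pi_iff.2 ⟨hz0, hz1⟩
      have hne : cvel v z ≠ 0 := fun h => by
        have : (cvel v z).re = 0 := by rw [h]; rfl
        exact hz0.ne this
      rw [← harg] at hcon
      exact hcon (cos_sin_arg_mem_flowAngles hz hne)) (y 0)
  rw [planePt_self] at key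
  exact absurd key (not_le.2 hre)

/-- A periodic flow in a flat domain is a shear flow or attains all angles. -/
theorem isShearFlow_or_flowAngles_eq (h : PlanarFlow Ω v g) (hs : SlowGrowth Ω v)
    (hΩ : IsFlatDomain Ω) {T : ℝ} (hT : 0 < T) (hper : ∀ x ∈ Ω, v (x + T • stdVec 0) = v x) :
    IsShearFlow Ω v ∨ flowAngles v (Ω : Set Plane) = unitCircle := by
  by_cases hzero : ∀ x ∈ Ω, v x 1 = 0
  · exact Or.inl (h.isShearFlow hΩ.add_mem hzero)
  push Not at hzero
  obtain ⟨x, hx, hvx⟩ := hzero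
  have hper' : ∀ x ∈ Ω, -v (x + T • stdVec 0) = -v x := fun x hx => by rw [hper x hx]
  have hboth : (∃ y ∈ Ω, 0 < v y 1) ∧ ∃ y ∈ Ω, v y 1 < 0 := by
    rcases hvx.lt_or_gt with hlt | hgt
    · refine ⟨?_, x, hx, hlt⟩
      obtain ⟨y, hy, hvy⟩ := h.neg.exists_apply_one_neg hΩ hT hper' hx (by simpa using hlt)
      exact ⟨y, hy, by simpa using hvy⟩
    · exact ⟨⟨x, hx, hgt⟩, h.exists_apply_one_neg hΩ hT hper hx hgt⟩
  obtain ⟨⟨y, hy, hvy⟩, z, hz, hvz⟩ := hboth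
  refine Or.inr (flowAngles_subset_unitCircle.antisymm fun p hp => ?_)
  obtain ⟨τ, hτ, rfl⟩ := exists_eq_cos_sin hp
  rcases lt_or_ge 0 τ with h0 | h0
  · exact h.cos_sin_mem_flowAngles_of_periodic hs hΩ hT hper hy hvy ⟨h0, hτ.2⟩
  · exact cos_sin_mem_flowAngles_of_neg (h.neg.cos_sin_mem_flowAngles_of_periodic hs.neg hΩ hT hper' hz
      (by simpa using hvz) ⟨by linarith [hτ.1], by linarith⟩)

end PlanarFlow

/-! ### Mutual exclusivity and the theorem -/

theorem IsShearFlow.apply_one_eq_zero {Ω : Opens Plane} {v : Plane → Plane} (h : IsShearFlow Ω v)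
    {z : Plane} (hz : z ∈ flowAngles v (closure (Ω : Set Plane))) : z 1 = 0 := by
  obtain ⟨s, hs⟩ := h
  obtain ⟨x, hx, -, rfl⟩ := hz
  simp [hs x hx]

theorem exists_mem_upperSemicircle_pos : ∃ z ∈ upperSemicircle, 0 < z 1 :=
  ⟨!₂[Real.cos (Real.pi / 2), Real.sin (Real.pi / 2)], mem_upperSemicircle.2
    ⟨Real.pi / 2, ⟨by positivity, by linarith [Real.pi_pos]⟩, rfl⟩, by simp⟩

theorem exists_mem_lowerSemicircle_neg : ∃ z ∈ lowerSemicircle, z 1 < 0 :=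
  ⟨!₂[Real.cos (-(Real.pi / 2)), Real.sin (-(Real.pi / 2))], mem_lowerSemicircle.2
    ⟨-(Real.pi / 2), ⟨by linarith [Real.pi_pos], by linarith [Real.pi_pos]⟩, rfl⟩, by simp⟩

/-- The poles (0, ±1) separate the cases: a shear flow attains neither, a semicircle contains
exactly one, the circle both. -/
theorem flowAngles_exclusive {Ω : Opens Plane} {v : Plane → Plane} :
    ¬ (IsShearFlow Ω v ∧ flowAngles v (closure (Ω : Set Plane)) = unitCircle) ∧
    ¬ (IsShearFlow Ω v ∧ (flowAngles v (closure (Ω : Set Plane)) = upperSemicircle ∨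
        flowAngles v (closure (Ω : Set Plane)) = lowerSemicircle)) ∧
    ¬ (flowAngles v (closure (Ω : Set Plane)) = unitCircle ∧
      (flowAngles v (closure (Ω : Set Plane)) = upperSemicircle ∨
        flowAngles v (closure (Ω : Set Plane)) = lowerSemicircle)) := by
  obtain ⟨p, hp, hp1⟩ := exists_mem_upperSemicircle_pos
  obtain ⟨q, hq, hq1⟩ := exists_mem_lowerSemicircle_neg
  have hpc := (mem_upperSemicircle_iff.1 hp).1
  have hqc := (mem_lowerSemicircle_iff.1 hq).1
  refine ⟨fun ⟨hsh, he⟩ => ?_, fun ⟨hsh, he⟩ => ?_, fun ⟨he, he'⟩ => ?_⟩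
  · exact hp1.ne' (hsh.apply_one_eq_zero (he ▸ hpc))
  · rcases he with he | he
    · exact hp1.ne' (hsh.apply_one_eq_zero (he ▸ hp))
    · exact hq1.ne (hsh.apply_one_eq_zero (he ▸ hq))
  · rcases he' with he' | he'
    · exact absurd (mem_upperSemicircle_iff.1 (he' ▸ he ▸ hqc)).2 (not_le.2 hq1)
    · exact absurd (mem_lowerSemicircle_iff.1 (he' ▸ he ▸ hpc)).2 (not_le.2 hp1)

end

theorem theorem1p2 (Ω : Opens Plane) (v : Plane → Plane)
    (hΩ : (Ω = strip ∧ StripGrowth v) ∨ (Ω = upperHalfPlane ∧ HalfPlaneGrowth v))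
    (hH1 : ∀ i, MemSobolevLocBar Ω 2 1 (fun x => v x i))
    (hcont : ContinuousOn v (closure (Ω : Set Plane)))
    (hEuler : IsSteadyEuler Ω v)
    (hslip : ∀ x ∈ frontier (Ω : Set Plane), v x 1 = 0) :
    -- (i)
    ((∃ β : ℝ, 0 < β ∧ β < Real.pi ∧
        (flowAngles v (closure (Ω : Set Plane)) ⊆ arc 0 β ∨
          flowAngles v (closure (Ω : Set Plane)) ⊆ arc Real.pi β)) →
      IsShearFlow Ω v) ∧
    -- (ii)
    (ContDiffOn ℝ 1 v (closure (Ω : Set Plane)) →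
      (∀ i, MemSobolevLocBar Ω 1 2 (fun x => v x i)) →
      (∃ M : ℝ, ∀ x ∈ frontier (Ω : Set Plane), |v x 0| ≤ M) →
      -- at least one of the three cases, and no two of them
      (IsShearFlow Ω v ∨
        flowAngles v (closure (Ω : Set Plane)) = unitCircle ∨
        (flowAngles v (closure (Ω : Set Plane)) = upperSemicircle ∨
          flowAngles v (closure (Ω : Set Plane)) = lowerSemicircle)) ∧
      ¬ (IsShearFlow Ω v ∧ flowAngles v (closure (Ω : Set Plane)) = unitCircle) ∧
      ¬ (IsShearFlow Ω v ∧
        (flowAngles v (closure (Ω : Set Plane)) = upperSemicircle ∨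
          flowAngles v (closure (Ω : Set Plane)) = lowerSemicircle)) ∧
      ¬ (flowAngles v (closure (Ω : Set Plane)) = unitCircle ∧
        (flowAngles v (closure (Ω : Set Plane)) = upperSemicircle ∨
          flowAngles v (closure (Ω : Set Plane)) = lowerSemicircle))) ∧
    -- (iii)
    (ContDiffOn ℝ 1 v (closure (Ω : Set Plane)) →
      (∀ i, MemSobolevLocBar Ω 1 2 (fun x => v x i)) →
      (∃ T : ℝ, 0 < T ∧ ∀ x ∈ Ω, v (x + T • stdVec 0) = v x) →
      IsShearFlow Ω v ∨ flowAngles v (Ω : Set Plane) = unitCircle) := by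
  obtain ⟨g, h⟩ := hEuler.exists_planarFlow hH1 hcont hslip
  obtain ⟨hs, hflat⟩ : SlowGrowth Ω v ∧ IsFlatDomain Ω := by
    rcases hΩ with ⟨rfl, hgrow⟩ | ⟨rfl, hgrow⟩
    · exact ⟨hgrow.slowGrowth, isFlatDomain_strip⟩
    · exact ⟨hgrow.slowGrowth, isFlatDomain_upperHalfPlane⟩
  refine ⟨?_, fun _ _ _ => ⟨h.flowAngles_trichotomy hs hflat, flowAngles_exclusive⟩, ?_⟩
  · rintro ⟨β, hβ, hβπ, hsub⟩
    exact h.isShearFlow_of_flowAngles_subset hs hflat hβ hβπ hsub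
  · rintro - - ⟨T, hT, hper⟩
    exact h.isShearFlow_or_flowAngles_eq hs hflat hT hper
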